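/- **Setting.** Let $d\ge 1$. Let $\Phi,\Psi\colon[0,\infty)\to[0,\infty)$ be complementary Young functions; that is, each is convex, vanishes at $0$, and its quotient by $s$ tends to $0$ as $s\to0^+$ and to $\infty$ as $s\to\infty$, and $\Psi(t)=\sup_{s>0}(st-\Phi(s))$. Assume that both are $\mathrm C^1$ on $[0,\infty)$ and $\mathrm C^2$ on $(0,\infty)$ with $\Phi'',\Psi''>0$ on $(0,\infty)$, that $\Phi'$ is strictly convex on $(0,\infty)$, that $\lim_{s\to0^+}\Phi'(s)/s=0$, and that $$M:=\sup_{s>0}\frac{s\Phi'(s)}{\Phi(s)}<\infty,\qquad 1<\tilde m:=\inf_{s>0}\frac{s\Phi''(s)}{\Phi'(s)}\le \tilde M:=\sup_{s>0}\frac{s\Phi''(s)}{\Phi'(s)}<\infty .$$ Put $p:=\tilde M+1$. For $A\colon\mathbb R^d\to\mathbb C^{d\times d}$ with $\mathrm L^\infty$ coefficients set $$\Lambda(A):=\operatorname*{ess\,sup}_{x}\max_{|\zeta|=|\eta|=1}|\langle A(x)\zeta,\eta\rangle|,\qquad \lambda(A):=\operatorname*{ess\,inf}_{x}\min_{|\xi|=1}\operatorname{Re}\langle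 A(x)\xi,\xi\rangle,$$ $$\Delta_p(A):=\operatorname*{ess\,inf}_{x}\min_{|\xi|=1}\operatorname{Re}\Big\langle A(x)\xi,\ \xi+\big|1-\tfrac2p\big|\bar\xi\Big\rangle .$$ Let $A,B$ be two such matrix functions that are $p$-elliptic, i.e. $\lambda(A),\lambda(B),\Delta_p(A),\Delta_p(B)>0$, and put $$C_p(A,B):=\frac{\max\{\Lambda(A),\Lambda(B)\}}{\min\{\Delta_p(A),\Delta_p(B)\}\min\{\lambda(A),\lambda(B)\}},$$ $$\delta:=\frac{\tilde m-1}{\tilde m}\min\Big\{\frac{\Delta_p(A)}{8\Lambda(A)},\frac{\Delta_p(B)}{4\Lambda(B)},\frac{\lambda(A)\Delta_p(B)}{100\max\{\Lambda(A)^2,\Lambda(B)^2\}}\Big\}.$$ Define the Bellman function $\mathfrak X\colon\mathbb C^2\to[0,\infty)$ by $$\mathfrak X(u,v):=\begin{cases}(1+\delta)\big(\Phi(|u|)+\Psi(|v|)\big)+\delta|u|^2\displaystyle\int_0^{|u|}\frac{\Phi'(s)}{s^2}\,ds, & |v|\le\Phi'(|u|),\\[2mm] \Phi(|u|)+\Psi(|v|)+\delta|u|^2\displaystyle\int_0^{|v|}\frac{ds}{\Psi'(s)},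 & |v|>\Phi'(|u|).\end{cases}$$ Let $\varphi\ge0$ be a radial $\mathrm C^\infty$ function on $\mathbb C^2\equiv\mathbb R^4$ supported in the unit ball with $\int\varphi=1$, and for $\nu\in(0,1]$ let $\varphi_\nu(w,z):=\nu^{-4}\varphi(w/\nu,z/\nu)$ and $\mathfrak X_\nu:=\mathfrak X*\varphi_\nu$. For $\mathfrak F\colon\mathbb C^2\to\mathbb R$, $A_0,B_0\in\mathbb C^{d\times d}$ and $\zeta,\eta\in\mathbb C^d$, the generalized Hessian $H^{A_0,B_0}_{\mathfrak F}[(u,v);(\zeta,\eta)]$ is the inner product in $(\mathbb R^d)^4$ of $(\mathrm{Hess}(\mathfrak F;(u,v))\otimes I_d)\,w$ and $\mathcal M w$, where $w=(\operatorname{Re}\zeta,\operatorname{Im}\zeta,\operatorname{Re}\eta,\operatorname{Im}\eta)^{\mathrm T}$, $\mathrm{Hess}$ is the real $4\times4$ Hessian in the variables $(u_r,u_i,v_r,v_i)$, $u=u_r+iu_i$, $v=v_r+iv_i$, and $\mathcal M$ is the block-diagonal matrix with the blocks $\begin{bmatrix}\operatorname{Re}A_0&-\operatorname{Im}A_0\\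 \operatorname{Im}A_0&\operatorname{Re}A_0\end{bmatrix}$ and $\begin{bmatrix}\operatorname{Re}B_0&-\operatorname{Im}B_0\\ \operatorname{Im}B_0&\operatorname{Re}B_0\end{bmatrix}$. Also $\partial_{\bar u}=\frac12(\partial_{u_r}+i\partial_{u_i})$ and $\partial_{\bar v}=\frac12(\partial_{v_r}+i\partial_{v_i})$. **Proposition 5.1.** The integrals defining $\mathfrak X$ and $\mathfrak X_\nu$ converge, each $\mathfrak X_\nu$, $\nu\in(0,1]$, is $\mathrm C^\infty$ on $\mathbb C^2$, and the following hold. (a) For all $\nu\in(0,1]$ and $(u,v)\in\mathbb C^2$, $$0\le\mathfrak X_\nu(u,v)\le 2\max\Big\{1,\frac M{\tilde m}\Big\}\big(\Phi(|u|+\nu)+\Psi(|v|+\nu)\big).$$ (b) For all $\nu\in(0,1]$ and $(u,v)\in\mathbb C^2$, $$|\partial_{\bar u}\mathfrak X_\nu(u,v)|\le\max\{\Phi'(|u|+\nu),\,|v|+\nu\},\qquad |\partial_{\bar v}\mathfrak X_\nu(u,v)|\le\Psi'(|v|+\nu).$$ (c) For almost every $x\in\mathbb R^d$ and for all $\nu\in(0,1]$,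 $(u,v)\in\mathbb C^2$ and $(\zeta,\eta)\in(\mathbb C^d)^2$, $$H^{A(x),B(x)}_{\mathfrak X_\nu}[(u,v);(\zeta,\eta)]\ge\frac1{10}\Big(\frac{\tilde M}{\tilde m}\,\frac{\tilde m-1}{\tilde M-1}\Big)^{1/2}C_p(A,B)^{-1}|\zeta|\,|\eta| .$$ -/

import Mathlib

open MeasureTheory Set Filter Topology
open scoped ContDiff Matrix Kronecker ENNReal

namespace OrliczBellman

noncomputable section

/-! Functions on `[0,∞)` are represented by functions `ℝ → ℝ`; only their values on `[0,∞)`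
are ever used. -/

/-- First derivative of a function on `[0,∞)` (one-sided at `0`). -/
def D1 (f : ℝ → ℝ) (s : ℝ) : ℝ := derivWithin f (Ici 0) s

/-- Second derivative of a function on `[0,∞)`; it is only used at points `s > 0`. -/
def D2 (f : ℝ → ℝ) (s : ℝ) : ℝ := derivWithin (D1 f) (Ici 0) s

/-- Young functions `[0,∞) → [0,∞)`. -/
structure IsYoung (f : ℝ → ℝ) : Prop where
  nonneg : ∀ s, 0 ≤ s → 0 ≤ f s
  convex : ConvexOn ℝ (Ici 0) f
  zero : f 0 = 0
  lim_zero : Tendsto (fun s => f s / s) (𝓝[>] 0) (𝓝 0)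
  lim_top : Tendsto (fun s => f s / s) atTop atTop

/-- `Ψ` is the complementary function of `Φ`: `Ψ t = sup_{s > 0} (s t - Φ s)` for `t ≥ 0`. -/
def IsComplementary (Φ Ψ : ℝ → ℝ) : Prop :=
  ∀ t, 0 ≤ t → IsLUB ((fun s => s * t - Φ s) '' Ioi 0) (Ψ t)

/-- `M = sup_{s>0} s Φ'(s) / Φ(s)`. -/
def bigM (Φ : ℝ → ℝ) : ℝ := sSup ((fun s => s * D1 Φ s / Φ s) '' Ioi 0)

/-- `m̃ = inf_{s>0} s Φ''(s) / Φ'(s)`. -/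
def tildeSmallM (Φ : ℝ → ℝ) : ℝ := sInf ((fun s => s * D2 Φ s / D1 Φ s) '' Ioi 0)

/-- `M̃ = sup_{s>0} s Φ''(s) / Φ'(s)`. -/
def tildeBigM (Φ : ℝ → ℝ) : ℝ := sSup ((fun s => s * D2 Φ s / D1 Φ s) '' Ioi 0)

/-- The standing assumptions on the pair of Young functions `Φ, Ψ`. -/
structure YoungPair (Φ Ψ : ℝ → ℝ) : Prop where
  young_left : IsYoung Φ
  young_right : IsYoung Ψ
  compl : IsComplementary Φ Ψ
  c1_left : ContDiffOn ℝ 1 Φ (Ici 0)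
  c1_right : ContDiffOn ℝ 1 Ψ (Ici 0)
  c2_left : ContDiffOn ℝ 2 Φ (Ioi 0)
  c2_right : ContDiffOn ℝ 2 Ψ (Ioi 0)
  pos_left : ∀ s, 0 < s → 0 < D2 Φ s
  pos_right : ∀ s, 0 < s → 0 < D2 Ψ s
  strictConvex : StrictConvexOn ℝ (Ioi 0) (D1 Φ)
  lim_zero : Tendsto (fun s => D1 Φ s / s) (𝓝[>] 0) (𝓝 0)
  bdd_bigM : BddAbove ((fun s => s * D1 Φ s / Φ s) '' Ioi 0)
  one_lt_tildeSmallM : 1 < tildeSmallM Φ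
  bdd_tildeBigM : BddAbove ((fun s => s * D2 Φ s / D1 Φ s) '' Ioi 0)

/-- Complex `d × d` matrix functions on `ℝ^d`. -/
abbrev MatFun (d : ℕ) : Type := EuclideanSpace ℝ (Fin d) → Matrix (Fin d) (Fin d) ℂ

/-- The matrix-vector product on `ℂ^d`. -/
def act {d : ℕ} (A : Matrix (Fin d) (Fin d) ℂ) (ξ : EuclideanSpace ℂ (Fin d)) :
    EuclideanSpace ℂ (Fin d) := WithLp.toLp 2 (A *ᵥ ξ.ofLp)

/-- Coordinatewise complex conjugation on `ℂ^d`. -/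
def conjVec {d : ℕ} (ξ : EuclideanSpace ℂ (Fin d)) : EuclideanSpace ℂ (Fin d) :=
  WithLp.toLp 2 (fun i => (starRingEnd ℂ) (ξ i))

/-- `Λ(A)`, the essential supremum of `max_{|ζ|=|η|=1} |⟨A(x)ζ, η⟩|`.
(Mathlib's `inner ℂ` is linear in the second variable: `⟨a, b⟩` of the paper is `inner ℂ b a`.) -/
def bigLambda {d : ℕ} (A : MatFun d) : ℝ :=
  essSup (fun x => sSup ((fun q : EuclideanSpace ℂ (Fin d) × EuclideanSpace ℂ (Fin d) =>
    ‖inner ℂ q.2 (act (A x) q.1)‖) '' (Metric.sphere 0 1 ×ˢ Metric.sphere 0 1))) volume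

/-- `λ(A)`, the essential infimum of `min_{|ξ|=1} Re ⟨A(x)ξ, ξ⟩`. -/
def smallLambda {d : ℕ} (A : MatFun d) : ℝ :=
  essInf (fun x => sInf ((fun ξ : EuclideanSpace ℂ (Fin d) =>
    (inner ℂ ξ (act (A x) ξ)).re) '' Metric.sphere 0 1)) volume

/-- `Δ_p(A)`, the essential infimum of `min_{|ξ|=1} Re ⟨A(x)ξ, ξ + |1 - 2/p| ξ̄⟩`. -/
def Delta {d : ℕ} (p : ℝ) (A : MatFun d) : ℝ :=
  essInf (fun x => sInf ((fun ξ : EuclideanSpace ℂ (Fin d) =>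
    (inner ℂ (ξ + ((|1 - 2 / p| : ℝ) : ℂ) • conjVec ξ) (act (A x) ξ)).re) ''
      Metric.sphere 0 1)) volume

/-- Matrix functions with `L^∞` coefficients that are `p`-elliptic. Essential boundedness of the
coefficients makes `Λ(A)`, `λ(A)`, `Δ_p(A)` genuine (finite) essential suprema and infima. -/
structure IsPElliptic {d : ℕ} (p : ℝ) (A : MatFun d) : Prop where
  memLp : ∀ i j, MemLp (fun x => A x i j) ∞ volume
  elliptic : 0 < smallLambda A
  pElliptic : 0 < Delta p A

/-- The constant `C_p(A,B)`. -/
def ellipC {d : ℕ} (p : ℝ) (A B : MatFun d) : ℝ :=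
  max (bigLambda A) (bigLambda B) /
    (min (Delta p A) (Delta p B) * min (smallLambda A) (smallLambda B))

/-- The exponent `p = M̃ + 1`. -/
def expP (Φ : ℝ → ℝ) : ℝ := tildeBigM Φ + 1

/-- The parameter `δ` of the Bellman function. -/
def delta {d : ℕ} (Φ : ℝ → ℝ) (A B : MatFun d) : ℝ :=
  (tildeSmallM Φ - 1) / tildeSmallM Φ *
    min (Delta (expP Φ) A / (8 * bigLambda A))
      (min (Delta (expP Φ) B / (4 * bigLambda B))
        (smallLambda A * Delta (expP Φ) B /
          (100 * max (bigLambda A ^ 2) (bigLambda B ^ 2))))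

/-- The Bellman function `𝔛`, with parameter `δ`, at the point `q = (u, v)`. -/
def bellman (Φ Ψ : ℝ → ℝ) (δ : ℝ) (q : ℂ × ℂ) : ℝ :=
  if ‖q.2‖ ≤ D1 Φ ‖q.1‖ then
    (1 + δ) * (Φ ‖q.1‖ + Ψ ‖q.2‖) + δ * ‖q.1‖ ^ 2 * ∫ s in (0 : ℝ)..‖q.1‖, D1 Φ s / s ^ 2
  else
    Φ ‖q.1‖ + Ψ ‖q.2‖ + δ * ‖q.1‖ ^ 2 * ∫ s in (0 : ℝ)..‖q.2‖, 1 / D1 Ψ s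

/-- Nonnegative radial smooth functions on `ℂ² = ℝ⁴` supported in the Euclidean unit ball and of
integral `1`. (The volume on `ℂ × ℂ` is the four-dimensional Lebesgue measure.) -/
structure IsMollifier (φ : ℂ × ℂ → ℝ) : Prop where
  nonneg : ∀ q, 0 ≤ φ q
  radial : ∀ q r : ℂ × ℂ, ‖q.1‖ ^ 2 + ‖q.2‖ ^ 2 = ‖r.1‖ ^ 2 + ‖r.2‖ ^ 2 → φ q = φ r
  smooth : ContDiff ℝ ∞ φ
  supp : ∀ q : ℂ × ℂ, 1 < ‖q.1‖ ^ 2 + ‖q.2‖ ^ 2 → φ q = 0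
  integral_eq_one : ∫ q, φ q = 1

/-- `φ_ν(w,z) = ν⁻⁴ φ(w/ν, z/ν)`. -/
def dilate (φ : ℂ × ℂ → ℝ) (ν : ℝ) (q : ℂ × ℂ) : ℝ := (ν ^ 4)⁻¹ * φ (ν⁻¹ • q)

/-- The mollification `F * φ_ν`. -/
def mollify (F φ : ℂ × ℂ → ℝ) (ν : ℝ) (q : ℂ × ℂ) : ℝ :=
  ∫ r : ℂ × ℂ, F (q - r) * dilate φ ν r

/-- The real coordinate directions `u_r, u_i, v_r, v_i` of `ℂ² = ℝ⁴`. -/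
def dir : Fin 4 → ℂ × ℂ := ![(1, 0), (Complex.I, 0), (0, 1), (0, Complex.I)]

/-- The partial derivative in the `j`-th real coordinate direction of `ℂ² = ℝ⁴`. -/
def partialD (j : Fin 4) (F : ℂ × ℂ → ℝ) (q : ℂ × ℂ) : ℝ := lineDeriv ℝ F q (dir j)

/-- `∂_ū F = (∂_{u_r} F + i ∂_{u_i} F) / 2`. -/
def dbarU (F : ℂ × ℂ → ℝ) (q : ℂ × ℂ) : ℂ :=
  ((partialD 0 F q : ℂ) + Complex.I * (partialD 1 F q : ℂ)) / 2

/-- `∂_v̄ F = (∂_{v_r} F + i ∂_{v_i} F) / 2`. -/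
def dbarV (F : ℂ × ℂ → ℝ) (q : ℂ × ℂ) : ℂ :=
  ((partialD 2 F q : ℂ) + Complex.I * (partialD 3 F q : ℂ)) / 2

/-- The real `4 × 4` Hessian matrix. -/
def hess (F : ℂ × ℂ → ℝ) (q : ℂ × ℂ) : Matrix (Fin 4) (Fin 4) ℝ :=
  Matrix.of fun i j => partialD i (partialD j F) q

/-- The vector `(Re ζ, Im ζ, Re η, Im η)` in `(ℝ^d)⁴`. -/
def realVec {d : ℕ} (ζ η : EuclideanSpace ℂ (Fin d)) : Fin 4 × Fin d → ℝ :=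
  fun k => (![fun i => (ζ i).re, fun i => (ζ i).im, fun i => (η i).re, fun i => (η i).im] :
    Fin 4 → Fin d → ℝ) k.1 k.2

/-- The `4 × 4` block matrix built of the real and imaginary parts of `A` and `B`. -/
def realMat {d : ℕ} (A B : Matrix (Fin d) (Fin d) ℂ) :
    Matrix (Fin 4 × Fin d) (Fin 4 × Fin d) ℝ :=
  Matrix.of fun k l =>
    (!![A.map Complex.re, -A.map Complex.im, 0, 0;
        A.map Complex.im, A.map Complex.re, 0, 0;
        0, 0, B.map Complex.re, -B.map Complex.im;
        0, 0, B.map Complex.im, B.map Complex.re] :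
      Matrix (Fin 4) (Fin 4) (Matrix (Fin d) (Fin d) ℝ)) k.1 l.1 k.2 l.2

/-- The generalized Hessian `H_F^{A,B}[q; (ζ, η)]`. -/
def genHess {d : ℕ} (A B : Matrix (Fin d) (Fin d) ℂ) (F : ℂ × ℂ → ℝ) (q : ℂ × ℂ)
    (ζ η : EuclideanSpace ℂ (Fin d)) : ℝ :=
  ((hess F q ⊗ₖ (1 : Matrix (Fin d) (Fin d) ℝ)) *ᵥ realVec ζ η) ⬝ᵥ
    (realMat A B *ᵥ realVec ζ η)

end

end OrliczBellman

open OrliczBellman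

/-! The Bellman function depends only on `s = |u|` and `t = |v|`. Its two formulas meet on the curve
`t = Φ'(s)`, which is also `s = Ψ'(t)`, since `Φ'` and `Ψ'` are inverse to each other
(`D1_right_left`). On this curve `∫₀ᵗ dx/Ψ' = Φ'(s)/s + ∫₀ˢ Φ'/x²` (`intRight_D1`). Hence the
function is continuous and its gradient is `coefU · u` in the `u`-variables and `coefV · v` in the
`v`-variables, with one formula for both regions; only the second derivatives jump. The bounds `m̃
Φ' ≤ s Φ'' ≤ M̃ Φ'` compare the two integrals with `Φ'(s)/s` and `t/Ψ'(t)`. With the smallness of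
`δ` this bounds the function and its gradient, and averaging over the mollifier gives (a) and (b).

For (c), off the curve and the axes the Hessian is explicit. Rotating `u` and `v` to positive reals
(`hessForm_radialHess`) leaves terms `Re⟨Aσ, aσ + bσ̄⟩` and `Re⟨Bτ, a'τ + b'τ̄⟩` and a cross term.
The choice `p = M̃ + 1` makes `|1 - 2/p| = (M̃-1)/(M̃+1)`, the ratio `|b|/a` that `s Φ'' ≤ M̃ Φ'`
permits, so `p`-ellipticity applies. Where `t ≤ Φ'(s)` there is no cross term and AM-GM with
`four_le_mul` suffices. Where `t > Φ'(s)` the cross term has size `δΛ`; the `δ`-part of `coefU`,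
paired with ordinary ellipticity of `A`, dominates it because `δ` is small (`hessForm_lower_outer`).

The bound passes to the mollified function because almost every line in a coordinate direction
avoids the axes and meets the curve in countably many points. Along such lines the function and its
gradient are integrals of their derivatives. The Hessian is locally integrable, with a singularity
no worse than `1/|v|`, so the Hessian of the mollification is the average of the pointwise Hessian
(`hess_mollify_bellman`) and inherits the lower bound. -/

namespace OrliczBellman

noncomputable section

/-! ### Calculus of a single Young function. -/

section Young

variable {F : ℝ → ℝ}

lemma hasDerivWithinAt_of_c1 (h1 : ContDiffOn ℝ 1 F (Ici 0)) {s : ℝ} (hs : 0 ≤ s) :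
    HasDerivWithinAt F (D1 F s) (Ici 0) s :=
  ((h1.differentiableOn one_ne_zero) s hs).hasDerivWithinAt

lemma hasDerivAt_of_c1 (h1 : ContDiffOn ℝ 1 F (Ici 0)) {s : ℝ} (hs : 0 < s) :
    HasDerivAt F (D1 F s) s :=
  (hasDerivWithinAt_of_c1 h1 hs.le).hasDerivAt (Ici_mem_nhds hs)

lemma continuousOn_D1 (h1 : ContDiffOn ℝ 1 F (Ici 0)) : ContinuousOn (D1 F) (Ici 0) :=
  h1.continuousOn_derivWithin (uniqueDiffOn_Ici 0) le_rfl

lemma D1_eq_deriv {s : ℝ} (hs : 0 < s) : D1 F s = deriv F s :=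
  derivWithin_of_mem_nhds (Ici_mem_nhds hs)

lemma D2_eq_deriv {s : ℝ} (hs : 0 < s) : D2 F s = deriv (D1 F) s :=
  derivWithin_of_mem_nhds (Ici_mem_nhds hs)

lemma hasDerivAt_D1 (h2 : ContDiffOn ℝ 2 F (Ioi 0)) {s : ℝ} (hs : 0 < s) :
    HasDerivAt (D1 F) (D2 F s) s := by
  have h3 : ContDiffOn ℝ 1 (deriv F) (Ioi 0) :=
    h2.deriv_of_isOpen isOpen_Ioi (by norm_num)
  have h4 : DifferentiableAt ℝ (deriv F) s :=
    ((h3.differentiableOn one_ne_zero) s hs).differentiableAt (Ioi_mem_nhds hs)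
  have h5 : D1 F =ᶠ[𝓝 s] deriv F := by
    filter_upwards [Ioi_mem_nhds hs] with x hx using D1_eq_deriv hx
  have h6 : DifferentiableAt ℝ (D1 F) s := h4.congr_of_eventuallyEq h5
  rw [D2_eq_deriv hs]
  exact h6.hasDerivAt

lemma IsYoung.D1_zero (hY : IsYoung F) (h1 : ContDiffOn ℝ 1 F (Ici 0)) : D1 F 0 = 0 := by
  have h := hasDerivWithinAt_iff_tendsto_slope.1 (hasDerivWithinAt_of_c1 h1 (le_refl (0 : ℝ)))
  have h2 : Ici (0 : ℝ) \ {0} = Ioi 0 := Ici_sdiff_left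
  rw [h2] at h
  refine tendsto_nhds_unique h (hY.lim_zero.congr' ?_)
  filter_upwards with s
  simp [slope_def_field, hY.zero]

lemma strictMonoOn_D1 (h1 : ContDiffOn ℝ 1 F (Ici 0)) (hp : ∀ s, 0 < s → 0 < D2 F s) :
    StrictMonoOn (D1 F) (Ici 0) := by
  refine strictMonoOn_of_deriv_pos (convex_Ici 0) (continuousOn_D1 h1) fun s hs => ?_
  rw [interior_Ici] at hs
  rw [← D2_eq_deriv hs]
  exact hp s hs

lemma IsYoung.D1_pos (hY : IsYoung F) (h1 : ContDiffOn ℝ 1 F (Ici 0))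
    (hp : ∀ s, 0 < s → 0 < D2 F s) {s : ℝ} (hs : 0 < s) : 0 < D1 F s := by
  rw [← hY.D1_zero h1]
  exact strictMonoOn_D1 h1 hp self_mem_Ici hs.le hs

lemma IsYoung.D1_nonneg (hY : IsYoung F) (h1 : ContDiffOn ℝ 1 F (Ici 0))
    (hp : ∀ s, 0 < s → 0 < D2 F s) {s : ℝ} (hs : 0 ≤ s) : 0 ≤ D1 F s := by
  rcases hs.eq_or_lt with rfl | hs
  · exact (hY.D1_zero h1).ge
  · exact (hY.D1_pos h1 hp hs).le

lemma IsYoung.strictMonoOn (hY : IsYoung F) (h1 : ContDiffOn ℝ 1 F (Ici 0))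
    (hp : ∀ s, 0 < s → 0 < D2 F s) : StrictMonoOn F (Ici 0) := by
  refine strictMonoOn_of_deriv_pos (convex_Ici 0) h1.continuousOn fun s hs => ?_
  rw [interior_Ici] at hs
  rw [← D1_eq_deriv hs]
  exact hY.D1_pos h1 hp hs

/-- The tangent line of a convex function lies below its graph. -/
lemma IsYoung.tangent_le (hY : IsYoung F) (h1 : ContDiffOn ℝ 1 F (Ici 0)) {a s : ℝ}
    (ha : 0 < a) (hs : 0 ≤ s) : F a + D1 F a * (s - a) ≤ F s := by
  have h := hasDerivAt_of_c1 h1 ha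
  rcases lt_trichotomy s a with hlt | rfl | hlt
  · have := hY.convex.slope_le_of_hasDerivAt hs ha.le hlt h
    rw [slope_def_field, div_le_iff₀ (by linarith)] at this
    linarith
  · simp
  · have := hY.convex.le_slope_of_hasDerivAt ha.le hs hlt h
    rw [slope_def_field, le_div_iff₀ (by linarith)] at this
    linarith

lemma IsYoung.le_mul_D1 (hY : IsYoung F) (h1 : ContDiffOn ℝ 1 F (Ici 0)) {s : ℝ}
    (hs : 0 < s) : F s ≤ s * D1 F s := by
  have := hY.tangent_le h1 hs le_rfl
  rw [hY.zero] at this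
  linarith

/-- Superlinear growth together with `F b ≤ b F'(b)` makes the derivative unbounded; the
intermediate value theorem does the rest. -/
lemma IsYoung.exists_D1_eq (hY : IsYoung F) (h1 : ContDiffOn ℝ 1 F (Ici 0)) {t : ℝ}
    (ht : 0 ≤ t) : ∃ s, 0 ≤ s ∧ D1 F s = t := by
  obtain ⟨b, hb1, hb2⟩ := ((hY.lim_top.eventually_ge_atTop t).and (eventually_gt_atTop 0)).exists
  have h3 : t ≤ D1 F b := hb1.trans (by
    rw [div_le_iff₀ hb2, mul_comm]
    exact hY.le_mul_D1 h1 hb2)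
  have := intermediate_value_Icc hb2.le ((continuousOn_D1 h1).mono Icc_subset_Ici_self)
  obtain ⟨s, hs, hst⟩ := this ⟨(hY.D1_zero h1).trans_le ht, h3⟩
  exact ⟨s, hs.1, hst⟩

end Young

/-- `∫₀ˢ Φ'(x) / x² dx`. -/
def intLeft (Φ : ℝ → ℝ) (s : ℝ) : ℝ := ∫ x in (0 : ℝ)..s, D1 Φ x / x ^ 2

/-- `∫₀ᵗ dx / Ψ'(x)`. -/
def intRight (Ψ : ℝ → ℝ) (t : ℝ) : ℝ := ∫ x in (0 : ℝ)..t, 1 / D1 Ψ x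

/-! ### Complementary pairs: duality, growth of derivatives, and the two integrals. -/

namespace YoungPair

variable {Φ Ψ : ℝ → ℝ} (h : YoungPair Φ Ψ)
include h

lemma D1_left_zero : D1 Φ 0 = 0 := h.young_left.D1_zero h.c1_left

lemma D1_right_zero : D1 Ψ 0 = 0 := h.young_right.D1_zero h.c1_right

lemma D1_left_pos {s : ℝ} (hs : 0 < s) : 0 < D1 Φ s :=
  h.young_left.D1_pos h.c1_left h.pos_left hs

lemma D1_right_pos {t : ℝ} (ht : 0 < t) : 0 < D1 Ψ t :=
  h.young_right.D1_pos h.c1_right h.pos_right ht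

lemma D1_left_nonneg {s : ℝ} (hs : 0 ≤ s) : 0 ≤ D1 Φ s :=
  h.young_left.D1_nonneg h.c1_left h.pos_left hs

lemma D1_right_nonneg {t : ℝ} (ht : 0 ≤ t) : 0 ≤ D1 Ψ t :=
  h.young_right.D1_nonneg h.c1_right h.pos_right ht

lemma young_inequality {s t : ℝ} (hs : 0 ≤ s) (ht : 0 ≤ t) : s * t ≤ Φ s + Ψ t := by
  rcases hs.eq_or_lt with rfl | hs
  · have := h.young_left.nonneg 0 le_rfl
    have := h.young_right.nonneg t ht
    simp only [zero_mul]
    positivity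
  · have := (h.compl t ht).1 ⟨s, hs, rfl⟩
    simp only at this
    linarith

/-- The equality case of Young's inequality: the tangent line at `s` shows that the supremum is
attained there. -/
lemma right_D1_left {s : ℝ} (hs : 0 < s) : Ψ (D1 Φ s) = s * D1 Φ s - Φ s := by
  refine (h.compl _ (h.D1_left_pos hs).le).unique ⟨?_, fun b hb => hb ⟨s, hs, rfl⟩⟩
  rintro _ ⟨x, hx, rfl⟩
  have := h.young_left.tangent_le h.c1_left hs (le_of_lt hx)
  simp only
  nlinarith

/-- Fermat's rule: by Young's inequality and its equality case, `t ↦ Ψ t - s t` is minimal at `t =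
Φ'(s)`. -/
lemma D1_right_left {s : ℝ} (hs : 0 ≤ s) : D1 Ψ (D1 Φ s) = s := by
  rcases hs.eq_or_lt with rfl | hs
  · rw [h.D1_left_zero, h.D1_right_zero]
  have hp := h.D1_left_pos hs
  have hmin : IsLocalMin (fun t => Ψ t - s * t) (D1 Φ s) := by
    filter_upwards [Ioi_mem_nhds hp] with t ht
    have := h.young_inequality hs.le (le_of_lt ht)
    rw [h.right_D1_left hs]
    linarith
  have hd := (hasDerivAt_of_c1 h.c1_right hp).sub ((hasDerivAt_id (D1 Φ s)).const_mul s)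
  have := hmin.hasDerivAt_eq_zero hd
  linarith

lemma D1_left_right {t : ℝ} (ht : 0 ≤ t) : D1 Φ (D1 Ψ t) = t := by
  obtain ⟨s, hs, rfl⟩ := h.young_left.exists_D1_eq h.c1_left ht
  rw [h.D1_right_left hs]

lemma strictMonoOn_D1_left : StrictMonoOn (D1 Φ) (Ici 0) := strictMonoOn_D1 h.c1_left h.pos_left

lemma strictMonoOn_D1_right : StrictMonoOn (D1 Ψ) (Ici 0) :=
  strictMonoOn_D1 h.c1_right h.pos_right

/-- Allows the two regions of the Bellman function to be described through either variable. -/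
lemma le_D1_left_iff {s t : ℝ} (hs : 0 ≤ s) (ht : 0 ≤ t) : t ≤ D1 Φ s ↔ D1 Ψ t ≤ s := by
  conv_lhs => rw [← h.D1_left_right ht]
  exact h.strictMonoOn_D1_left.le_iff_le (h.D1_right_nonneg ht) hs

lemma D2_right_mul {t : ℝ} (ht : 0 < t) : D2 Ψ t * D2 Φ (D1 Ψ t) = 1 := by
  have hs := h.D1_right_pos ht
  have h1 := hasDerivAt_D1 h.c2_left hs
  have h2 := hasDerivAt_D1 h.c2_right ht
  have h3 : HasDerivAt (fun x => D1 Φ (D1 Ψ x)) (D2 Φ (D1 Ψ t) * D2 Ψ t) t := h1.comp t h2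
  have h4 : HasDerivAt (fun x => D1 Φ (D1 Ψ x)) 1 t := by
    refine (hasDerivAt_id t).congr_of_eventuallyEq ?_
    filter_upwards [Ioi_mem_nhds ht] with x hx using h.D1_left_right (le_of_lt hx)
  rw [mul_comm]
  exact h3.unique h4

lemma tildeSmallM_mul_le {s : ℝ} (hs : 0 < s) : tildeSmallM Φ * D1 Φ s ≤ s * D2 Φ s := by
  rw [← le_div_iff₀ (h.D1_left_pos hs)]
  refine csInf_le ?_ ⟨s, hs, rfl⟩
  refine ⟨0, ?_⟩
  rintro _ ⟨x, hx, rfl⟩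
  have := h.D1_left_pos hx
  have := h.pos_left x hx
  have : 0 < x := hx
  simp only
  positivity

lemma le_tildeBigM_mul {s : ℝ} (hs : 0 < s) : s * D2 Φ s ≤ tildeBigM Φ * D1 Φ s := by
  rw [← div_le_iff₀ (h.D1_left_pos hs)]
  exact le_csSup h.bdd_tildeBigM ⟨s, hs, rfl⟩

lemma tildeSmallM_le_tildeBigM : tildeSmallM Φ ≤ tildeBigM Φ := by
  have h1 := h.tildeSmallM_mul_le one_pos
  have h2 := h.le_tildeBigM_mul one_pos
  exact le_of_mul_le_mul_right (h1.trans h2) (h.D1_left_pos one_pos)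

lemma one_lt_tildeBigM : 1 < tildeBigM Φ :=
  h.one_lt_tildeSmallM.trans_le h.tildeSmallM_le_tildeBigM

lemma mul_D1_le_bigM_mul {s : ℝ} (hs : 0 < s) : s * D1 Φ s ≤ bigM Φ * Φ s := by
  have hpos : 0 < Φ s := by
    rw [← h.young_left.zero]
    exact h.young_left.strictMonoOn h.c1_left h.pos_left self_mem_Ici hs.le hs
  rw [← div_le_iff₀ hpos]
  exact le_csSup h.bdd_bigM ⟨s, hs, rfl⟩

lemma D1_le_mul_D2 {s : ℝ} (hs : 0 < s) : D1 Φ s ≤ s * D2 Φ s := by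
  have := h.tildeSmallM_mul_le hs
  have := h.one_lt_tildeSmallM
  have := h.D1_left_pos hs
  nlinarith

/-- Growth bounds pass from `Φ` to `Ψ` by evaluation at `s = Ψ'(t)`, where `Φ''(s) = 1/Ψ''(t)`; the
direction of the inequality reverses. -/
lemma mul_D2_right_le {t : ℝ} (ht : 0 < t) : t * D2 Ψ t ≤ D1 Ψ t := by
  have h1 := h.D1_le_mul_D2 (h.D1_right_pos ht)
  rw [h.D1_left_right ht.le] at h1
  have h2 := h.D2_right_mul ht
  have h3 := h.pos_right t ht
  calc t * D2 Ψ t ≤ D1 Ψ t * D2 Φ (D1 Ψ t) * D2 Ψ t := mul_le_mul_of_nonneg_right h1 h3.le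
    _ = D1 Ψ t * (D2 Ψ t * D2 Φ (D1 Ψ t)) := by ring
    _ = D1 Ψ t := by rw [h2, mul_one]

lemma D1_right_le {t : ℝ} (ht : 0 < t) : D1 Ψ t ≤ tildeBigM Φ * (t * D2 Ψ t) := by
  have h1 := h.le_tildeBigM_mul (h.D1_right_pos ht)
  rw [h.D1_left_right ht.le] at h1
  have h2 := h.D2_right_mul ht
  have h3 := h.pos_right t ht
  calc D1 Ψ t = D1 Ψ t * (D2 Ψ t * D2 Φ (D1 Ψ t)) := by rw [h2, mul_one]
    _ = D1 Ψ t * D2 Φ (D1 Ψ t) * D2 Ψ t := by ring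
    _ ≤ tildeBigM Φ * t * D2 Ψ t := mul_le_mul_of_nonneg_right h1 h3.le
    _ = tildeBigM Φ * (t * D2 Ψ t) := by ring

/-- This is where convexity of `Φ'` enters; `four_le_mul` depends on it. -/
lemma D2_left_mono {a b : ℝ} (ha : 0 < a) (hab : a ≤ b) : D2 Φ a ≤ D2 Φ b := by
  rcases hab.eq_or_lt with rfl | hab
  · exact le_rfl
  have hb := ha.trans hab
  have hc := h.strictConvex.convexOn
  exact (hc.le_slope_of_hasDerivAt ha hb hab (hasDerivAt_D1 h.c2_left ha)).trans
    (hc.slope_le_of_hasDerivAt ha hb hab (hasDerivAt_D1 h.c2_left hb))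

lemma hasDerivAt_D1_div {s : ℝ} (hs : 0 < s) :
    HasDerivAt (fun x => D1 Φ x / x) (D2 Φ s / s - D1 Φ s / s ^ 2) s := by
  have := (hasDerivAt_D1 h.c2_left hs).div (hasDerivAt_id s) hs.ne'
  have e : D2 Φ s / s - D1 Φ s / s ^ 2 = (D2 Φ s * id s - D1 Φ s * 1) / id s ^ 2 := by
    simp only [id]
    field_simp
  rw [e]
  exact this

lemma continuousOn_D1_div : ContinuousOn (fun x => D1 Φ x / x) (Ici 0) := by
  intro s hs
  rcases (mem_Ici.1 hs).eq_or_lt with rfl | hs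
  · rw [← Ioi_insert, continuousWithinAt_insert_self]
    simpa [ContinuousWithinAt] using h.lim_zero
  · exact (h.hasDerivAt_D1_div hs).continuousAt.continuousWithinAt

lemma D1_div_nonneg {s : ℝ} (hs : 0 ≤ s) : 0 ≤ D1 Φ s / s :=
  div_nonneg (h.D1_left_nonneg hs) hs

/-- With `deriv_D1_div_le` this makes `(Φ'(s)/s)'` comparable to `Φ'(s)/s²`; integration from `0`
then compares `intLeft` with `Φ'(s)/s`. -/
lemma deriv_D1_div_ge {s : ℝ} (hs : 0 < s) :
    (tildeSmallM Φ - 1) * (D1 Φ s / s ^ 2) ≤ D2 Φ s / s - D1 Φ s / s ^ 2 := by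
  have := h.tildeSmallM_mul_le hs
  have e : D2 Φ s / s = s * D2 Φ s / s ^ 2 := by field_simp
  rw [e, ← sub_div, ← mul_div_assoc]
  gcongr
  linarith

lemma deriv_D1_div_le {s : ℝ} (hs : 0 < s) :
    D2 Φ s / s - D1 Φ s / s ^ 2 ≤ (tildeBigM Φ - 1) * (D1 Φ s / s ^ 2) := by
  have := h.le_tildeBigM_mul hs
  have e : D2 Φ s / s = s * D2 Φ s / s ^ 2 := by field_simp
  rw [e, ← sub_div, ← mul_div_assoc]
  gcongr
  linarith

lemma deriv_D1_div_nonneg {s : ℝ} (hs : 0 < s) : 0 ≤ D2 Φ s / s - D1 Φ s / s ^ 2 := by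
  refine le_trans ?_ (h.deriv_D1_div_ge hs)
  have := h.one_lt_tildeSmallM
  have := h.D1_left_pos hs
  have : 0 ≤ tildeSmallM Φ - 1 := by linarith
  positivity

lemma D1_div_mono {a b : ℝ} (ha : 0 < a) (hab : a ≤ b) : D1 Φ a / a ≤ D1 Φ b / b := by
  have : MonotoneOn (fun x => D1 Φ x / x) (Ioi 0) := by
    refine monotoneOn_of_deriv_nonneg (convex_Ioi 0)
      (h.continuousOn_D1_div.mono Ioi_subset_Ici_self) ?_ ?_
    · intro x hx
      rw [interior_Ioi] at hx
      exact (h.hasDerivAt_D1_div hx).differentiableAt.differentiableWithinAt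
    · intro x hx
      rw [interior_Ioi] at hx
      rw [(h.hasDerivAt_D1_div hx).deriv]
      exact h.deriv_D1_div_nonneg hx
  exact this ha (ha.trans_le hab) hab

/-- A nonnegative derivative of a function that is continuous up to the endpoint is integrable, so
no bound on `Φ''` near `0` is needed. -/
lemma intervalIntegrable_deriv_D1_div {s : ℝ} (hs : 0 ≤ s) :
    IntervalIntegrable (fun x => D2 Φ x / x - D1 Φ x / x ^ 2) volume 0 s := by
  refine intervalIntegral.intervalIntegrable_deriv_of_nonneg
    (g := fun x => D1 Φ x / x) (h.continuousOn_D1_div.mono ?_) ?_ ?_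
  · rw [uIcc_of_le hs]; exact Icc_subset_Ici_self
  · intro x hx
    rw [min_eq_left hs] at hx
    exact h.hasDerivAt_D1_div hx.1
  · intro x hx
    rw [min_eq_left hs] at hx
    exact h.deriv_D1_div_nonneg hx.1

/-- Since `m̃ > 1`, the integrand is dominated by `(Φ'(x)/x)' / (m̃ - 1)`. -/
lemma intervalIntegrable_left {s : ℝ} (hs : 0 ≤ s) :
    IntervalIntegrable (fun x => D1 Φ x / x ^ 2) volume 0 s := by
  have hm := h.one_lt_tildeSmallM
  have hcont : ContinuousOn (fun x => D1 Φ x / x ^ 2) (Ioc 0 s) := by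
    refine ContinuousOn.div ((continuousOn_D1 h.c1_left).mono fun x hx => hx.1.le)
      (by fun_prop) fun x hx => ?_
    have := hx.1
    positivity
  have hi := (h.intervalIntegrable_deriv_D1_div hs).div_const (tildeSmallM Φ - 1)
  rw [intervalIntegrable_iff_integrableOn_Ioc_of_le hs] at hi ⊢
  refine Integrable.mono hi (hcont.aestronglyMeasurable measurableSet_Ioc) ?_
  refine (ae_restrict_iff' measurableSet_Ioc).2 (Eventually.of_forall fun x hx => ?_)
  have h1 := h.deriv_D1_div_ge hx.1
  have h2 := h.deriv_D1_div_nonneg hx.1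
  have h3 := h.D1_left_pos hx.1
  have h4 : 0 < tildeSmallM Φ - 1 := by linarith
  rw [Real.norm_of_nonneg (by positivity), Real.norm_of_nonneg (by positivity),
    le_div_iff₀ h4]
  linarith

lemma integral_deriv_D1_div {s : ℝ} (hs : 0 ≤ s) :
    ∫ x in (0 : ℝ)..s, (D2 Φ x / x - D1 Φ x / x ^ 2) = D1 Φ s / s := by
  rw [intervalIntegral.integral_eq_sub_of_hasDerivAt_of_le (f := fun x => D1 Φ x / x) hs
    (h.continuousOn_D1_div.mono Icc_subset_Ici_self)
    (fun x hx => h.hasDerivAt_D1_div hx.1) (h.intervalIntegrable_deriv_D1_div hs)]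
  simp

lemma intLeft_nonneg {s : ℝ} (hs : 0 ≤ s) : 0 ≤ intLeft Φ s :=
  intervalIntegral.integral_nonneg hs fun x hx =>
    div_nonneg (h.D1_left_nonneg hx.1) (sq_nonneg x)

lemma intLeft_le {s : ℝ} (hs : 0 ≤ s) : (tildeSmallM Φ - 1) * intLeft Φ s ≤ D1 Φ s / s := by
  rw [intLeft, ← intervalIntegral.integral_const_mul, ← h.integral_deriv_D1_div hs]
  exact intervalIntegral.integral_mono_on_of_le_Ioo hs
    ((h.intervalIntegrable_left hs).const_mul _) (h.intervalIntegrable_deriv_D1_div hs)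
    fun x hx => h.deriv_D1_div_ge hx.1

lemma le_intLeft {s : ℝ} (hs : 0 ≤ s) : D1 Φ s / s ≤ (tildeBigM Φ - 1) * intLeft Φ s := by
  rw [intLeft, ← intervalIntegral.integral_const_mul, ← h.integral_deriv_D1_div hs]
  exact intervalIntegral.integral_mono_on_of_le_Ioo hs
    (h.intervalIntegrable_deriv_D1_div hs) ((h.intervalIntegrable_left hs).const_mul _)
    fun x hx => h.deriv_D1_div_le hx.1

lemma hasDerivAt_intLeft {s : ℝ} (hs : 0 < s) :
    HasDerivAt (intLeft Φ) (D1 Φ s / s ^ 2) s := by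
  have hc : ContinuousOn (fun x => D1 Φ x / x ^ 2) (Ioi 0) := by
    refine ContinuousOn.div ((continuousOn_D1 h.c1_left).mono Ioi_subset_Ici_self)
      (by fun_prop) fun x hx => ?_
    have : 0 < x := hx
    positivity
  exact intervalIntegral.integral_hasDerivAt_right (h.intervalIntegrable_left hs.le)
    (hc.stronglyMeasurableAtFilter isOpen_Ioi s hs) (hc.continuousAt (Ioi_mem_nhds hs))

lemma continuousOn_intLeft : ContinuousOn (intLeft Φ) (Ici 0) := by
  intro s hs
  rcases (mem_Ici.1 hs).eq_or_lt with rfl | hs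
  · have := intervalIntegral.continuousOn_primitive_interval'
      (h.intervalIntegrable_left zero_le_one) (left_mem_uIcc)
    rw [uIcc_of_le zero_le_one] at this
    exact (this 0 ⟨le_rfl, zero_le_one⟩).mono_of_mem_nhdsWithin
      (Icc_mem_nhdsGE zero_lt_one)
  · exact (h.hasDerivAt_intLeft hs).continuousAt.continuousWithinAt

lemma mapsTo_D1_right : MapsTo (D1 Ψ) (Ici 0) (Ici 0) := fun _ ht => h.D1_right_nonneg ht

/-- The function is the primitive of `1/Ψ'` suggested by the substitution `x = Φ'(y)` and
integration by parts. Writing `Φ'(Ψ'(t))/Ψ'(t)` for `t/Ψ'(t)` lets continuity at `0` follow from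
that of `Φ'(s)/s`. -/
lemma continuousOn_primitive_right :
    ContinuousOn (fun t => D1 Φ (D1 Ψ t) / D1 Ψ t + intLeft Φ (D1 Ψ t)) (Ici 0) :=
  (h.continuousOn_D1_div.comp (continuousOn_D1 h.c1_right) h.mapsTo_D1_right).add
    (h.continuousOn_intLeft.comp (continuousOn_D1 h.c1_right) h.mapsTo_D1_right)

lemma hasDerivAt_primitive_right {t : ℝ} (ht : 0 < t) :
    HasDerivAt (fun t => D1 Φ (D1 Ψ t) / D1 Ψ t + intLeft Φ (D1 Ψ t)) (1 / D1 Ψ t) t := by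
  have hg := h.D1_right_pos ht
  have hd := hasDerivAt_D1 h.c2_right ht
  have h1 : HasDerivAt (fun t => D1 Φ (D1 Ψ t) / D1 Ψ t) _ t :=
    (h.hasDerivAt_D1_div hg).comp t hd
  have h2 : HasDerivAt (fun t => intLeft Φ (D1 Ψ t)) _ t := (h.hasDerivAt_intLeft hg).comp t hd
  have e : 1 / D1 Ψ t = (D2 Φ (D1 Ψ t) / D1 Ψ t - D1 Φ (D1 Ψ t) / D1 Ψ t ^ 2) * D2 Ψ t +
      D1 Φ (D1 Ψ t) / D1 Ψ t ^ 2 * D2 Ψ t := by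
    -- With `w = Ψ'(t)`, the two terms in `Φ'(w)/w²` cancel, and `Φ''(w) Ψ''(t) = 1` leaves `1/w`.
    rw [← h.D2_right_mul ht]
    ring
  rw [e]
  exact h1.add h2

lemma intervalIntegrable_right {t : ℝ} (ht : 0 ≤ t) :
    IntervalIntegrable (fun x => 1 / D1 Ψ x) volume 0 t := by
  refine intervalIntegral.intervalIntegrable_deriv_of_nonneg
    (g := fun t => D1 Φ (D1 Ψ t) / D1 Ψ t + intLeft Φ (D1 Ψ t))
    (h.continuousOn_primitive_right.mono ?_) ?_ ?_
  · rw [uIcc_of_le ht]; exact Icc_subset_Ici_self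
  · intro x hx
    rw [min_eq_left ht] at hx
    exact h.hasDerivAt_primitive_right hx.1
  · intro x hx
    rw [min_eq_left ht] at hx
    exact (one_div_pos.2 (h.D1_right_pos hx.1)).le

lemma intRight_eq {t : ℝ} (ht : 0 ≤ t) :
    intRight Ψ t = t / D1 Ψ t + intLeft Φ (D1 Ψ t) := by
  rw [intRight, intervalIntegral.integral_eq_sub_of_hasDerivAt_of_le
    (f := fun t => D1 Φ (D1 Ψ t) / D1 Ψ t + intLeft Φ (D1 Ψ t)) ht
    (h.continuousOn_primitive_right.mono Icc_subset_Ici_self)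
    (fun x hx => h.hasDerivAt_primitive_right hx.1) (h.intervalIntegrable_right ht)]
  simp [h.D1_left_right ht, h.D1_right_zero, intLeft]

/-- The matching identity on the interface `t = Φ'(s)`: it makes the function and its first
derivatives agree across the interface. -/
lemma intRight_D1 {s : ℝ} (hs : 0 ≤ s) : intRight Ψ (D1 Φ s) = D1 Φ s / s + intLeft Φ s := by
  rw [h.intRight_eq (h.D1_left_nonneg hs), h.D1_right_left hs]

lemma continuousOn_intRight : ContinuousOn (intRight Ψ) (Ici 0) :=
  h.continuousOn_primitive_right.congr fun t ht => by
    simp only [h.intRight_eq ht, h.D1_left_right ht]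

lemma hasDerivAt_intRight {t : ℝ} (ht : 0 < t) : HasDerivAt (intRight Ψ) (1 / D1 Ψ t) t := by
  refine (h.hasDerivAt_primitive_right ht).congr_of_eventuallyEq ?_
  filter_upwards [Ioi_mem_nhds ht] with x hx
  rw [h.intRight_eq (le_of_lt hx), h.D1_left_right (le_of_lt hx)]

lemma intRight_nonneg {t : ℝ} (ht : 0 ≤ t) : 0 ≤ intRight Ψ t := by
  rw [h.intRight_eq ht]
  exact add_nonneg (div_nonneg ht (h.D1_right_nonneg ht)) (h.intLeft_nonneg (h.D1_right_nonneg ht))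

lemma intRight_le {t : ℝ} (ht : 0 ≤ t) :
    (tildeSmallM Φ - 1) * intRight Ψ t ≤ tildeSmallM Φ * (t / D1 Ψ t) := by
  have := h.intLeft_le (h.D1_right_nonneg ht)
  rw [h.D1_left_right ht] at this
  rw [h.intRight_eq ht]
  linarith

lemma le_intRight {t : ℝ} (ht : 0 ≤ t) :
    tildeBigM Φ * (t / D1 Ψ t) ≤ (tildeBigM Φ - 1) * intRight Ψ t := by
  have := h.le_intLeft (h.D1_right_nonneg ht)
  rw [h.D1_left_right ht] at this
  rw [h.intRight_eq ht]
  linarith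

lemma left_mono {a b : ℝ} (ha : 0 ≤ a) (hab : a ≤ b) : Φ a ≤ Φ b :=
  (h.young_left.strictMonoOn h.c1_left h.pos_left).monotoneOn ha (ha.trans hab) hab

lemma right_mono {a b : ℝ} (ha : 0 ≤ a) (hab : a ≤ b) : Ψ a ≤ Ψ b :=
  (h.young_right.strictMonoOn h.c1_right h.pos_right).monotoneOn ha (ha.trans hab) hab

end YoungPair

instance : Measure.IsAddHaarMeasure (volume : Measure (ℂ × ℂ)) :=
  Measure.prod.instIsAddHaarMeasure volume volume

/-! ### Convolution with a smooth kernel and derivatives along lines. -/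

section Mollify

variable {F F' k : ℂ × ℂ → ℝ}

lemma integrable_sub_mul (hF : LocallyIntegrable F) (hk : Continuous k)
    (hkc : HasCompactSupport k) (q : ℂ × ℂ) : Integrable (fun r => F (q - r) * k r) := by
  have := hkc.convolutionExists_left (ContinuousLinearMap.mul ℝ ℝ) (μ := volume) hk hF q
  simpa [ConvolutionExistsAt, mul_comm] using this

lemma integral_sub_mul_eq_convolution :
    (fun q => ∫ r, F (q - r) * k r) = convolution k F (ContinuousLinearMap.mul ℝ ℝ) volume := by
  ext q
  simp [convolution_def, mul_comm]

lemma continuous_integral_sub_mul (hF : LocallyIntegrable F) (hk : Continuous k)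
    (hkc : HasCompactSupport k) : Continuous (fun q => ∫ r, F (q - r) * k r) := by
  rw [integral_sub_mul_eq_convolution]
  exact hkc.continuous_convolution_left _ hk hF

lemma contDiff_integral_sub_mul (hF : LocallyIntegrable F) (hk : ContDiff ℝ ∞ k)
    (hkc : HasCompactSupport k) : ContDiff ℝ ∞ (fun q => ∫ r, F (q - r) * k r) := by
  rw [integral_sub_mul_eq_convolution]
  exact hkc.contDiff_convolution_left _ hk hF

/-- `F'` is a derivative of `F` in the direction `e`, in the integrated sense, along almost all
lines. -/
def HasIntegralLineDeriv (F F' : ℂ × ℂ → ℝ) (e : ℂ × ℂ) : Prop :=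
  ∀ᵐ p : ℂ × ℂ, ∀ b : ℝ, F (p + b • e) - F p = ∫ s in (0 : ℝ)..b, F' (p + s • e)

/-- Fubini transfers the integrated identity along lines to the convolution. The convolution of `F'`
is continuous, so the fundamental theorem of calculus differentiates the result, although `F'`
itself may be discontinuous and unbounded. -/
lemma HasIntegralLineDeriv.lineDeriv_integral_sub_mul {e : ℂ × ℂ}
    (hd : HasIntegralLineDeriv F F' e) (hF : LocallyIntegrable F) (hF' : LocallyIntegrable F')
    (hm : Measurable F') (hk : Continuous k) (hk0 : ∀ q, 0 ≤ k q) (hkc : HasCompactSupport k)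
    (q : ℂ × ℂ) :
    lineDeriv ℝ (fun q => ∫ r, F (q - r) * k r) q e = ∫ r, F' (q - r) * k r := by
  have hcont : Continuous fun s : ℝ => ∫ r, F' (q + s • e - r) * k r :=
    (continuous_integral_sub_mul hF' hk hkc).comp (by fun_prop : Continuous fun s : ℝ => q + s • e)
  have key : ∀ b : ℝ, ∫ r, F (q + b • e - r) * k r =
      (∫ r, F (q - r) * k r) + ∫ s in (0 : ℝ)..b, ∫ r, F' (q + s • e - r) * k r := by
    intro b
    have hint : Integrable (Function.uncurry fun (s : ℝ) (r : ℂ × ℂ) => F' (q + s • e - r) * k r)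
        ((volume.restrict (uIoc 0 b)).prod volume) := by
      rw [integrable_prod_iff]
      · refine ⟨Eventually.of_forall fun s => integrable_sub_mul hF' hk hkc (q + s • e), ?_⟩
        have hn' : LocallyIntegrable fun p => |F' p| := fun x => (hF' x).norm
        have hn : Continuous fun s : ℝ => ∫ r, |F' (q + s • e - r)| * k r :=
          (continuous_integral_sub_mul (F := fun p => |F' p|) hn' hk hkc).comp
            (by fun_prop : Continuous fun s : ℝ => q + s • e)
        refine ((hn.intervalIntegrable 0 b).def').congr (Eventually.of_forall fun s => ?_)
        simp [Function.uncurry, abs_of_nonneg (hk0 _)]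
      · refine Measurable.aestronglyMeasurable ?_
        refine (hm.comp ?_).mul (hk.measurable.comp measurable_snd)
        exact Continuous.measurable (by fun_prop)
    rw [intervalIntegral_integral_swap hint, ← sub_eq_iff_eq_add',
      ← integral_sub (integrable_sub_mul hF hk hkc _) (integrable_sub_mul hF hk hkc _)]
    -- The identity holds for almost every base point; the reflection `r ↦ q - r` preserves measure,
    -- so it holds at `q - r` for almost every `r`.
    have hae := (Measure.measurePreserving_sub_left (volume : Measure (ℂ × ℂ)) q).quasiMeasurePreserving.ae hd
    refine integral_congr_ae ?_
    filter_upwards [hae] with r hr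
    have := hr b
    rw [intervalIntegral.integral_mul_const, ← sub_mul]
    congr 1
    rw [show q + b • e - r = q - r + b • e by abel, this]
    congr 1
    ext s
    rw [show q + s • e - r = q - r + s • e by abel]
  have hder : HasDerivAt (fun b : ℝ => ∫ r, F (q + b • e - r) * k r)
      (∫ r, F' (q - r) * k r) 0 := by
    simp_rw [key]
    refine HasDerivAt.const_add _ ?_
    have := intervalIntegral.integral_hasDerivAt_right (hcont.intervalIntegrable 0 0)
      (hcont.stronglyMeasurableAtFilter _ _) hcont.continuousAt
    simpa using this
  exact hder.deriv

/-- Averaging against a probability density; vector-valued so as to cover both the real function and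
its complex derivatives. -/
lemma norm_integral_smul_le_of_forall {V : Type*} [NormedAddCommGroup V] [NormedSpace ℝ V]
    {f : ℂ × ℂ → V} {C : ℝ} (hk : Continuous k) (hkc : HasCompactSupport k)
    (hk0 : ∀ q, 0 ≤ k q) (hk1 : ∫ q, k q = 1) (hf : ∀ r, k r ≠ 0 → ‖f r‖ ≤ C) :
    ‖∫ r, k r • f r‖ ≤ C := by
  have hki : Integrable k := hk.integrable_of_hasCompactSupport hkc
  calc ‖∫ r, k r • f r‖ ≤ ∫ r, k r * C := by
        refine norm_integral_le_of_norm_le (hki.mul_const C) (Eventually.of_forall fun r => ?_)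
        rw [norm_smul, Real.norm_of_nonneg (hk0 r)]
        rcases eq_or_ne (k r) 0 with h0 | h0
        · simp [h0]
        · exact mul_le_mul_of_nonneg_left (hf r h0) (hk0 r)
    _ = C := by rw [integral_mul_const, hk1, one_mul]

end Mollify

/-! ### The dilated mollifier. -/

namespace IsMollifier

variable {φ : ℂ × ℂ → ℝ} (hφ : IsMollifier φ) {ν : ℝ} (hν : 0 < ν)
include hφ

lemma dilate_nonneg (q : ℂ × ℂ) : 0 ≤ dilate φ ν q :=
  mul_nonneg (inv_nonneg.2 (by positivity)) (hφ.nonneg _)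

lemma contDiff_dilate : ContDiff ℝ ∞ (dilate φ ν) :=
  contDiff_const.mul (hφ.smooth.comp (contDiff_const_smul _))

lemma continuous_dilate : Continuous (dilate φ ν) := hφ.contDiff_dilate.continuous

include hν

lemma norm_le_of_dilate_ne_zero {r : ℂ × ℂ} (hr : dilate φ ν r ≠ 0) : ‖r.1‖ ≤ ν ∧ ‖r.2‖ ≤ ν := by
  have h1 : φ (ν⁻¹ • r) ≠ 0 := fun h => hr (by simp [dilate, h])
  have h2 : ‖(ν⁻¹ • r).1‖ ^ 2 + ‖(ν⁻¹ • r).2‖ ^ 2 ≤ 1 := by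
    by_contra! h
    exact h1 (hφ.supp _ h)
  simp only [Prod.smul_fst, Prod.smul_snd, norm_smul, norm_inv, Real.norm_of_nonneg hν.le] at h2
  have aux : ∀ a : ℝ, 0 ≤ a → (ν⁻¹ * a) ^ 2 ≤ 1 → a ≤ ν := by
    intro a ha h
    have h3 : ν⁻¹ * a ≤ 1 := by nlinarith [mul_nonneg (inv_nonneg.2 hν.le) ha]
    rwa [inv_mul_le_iff₀ hν, mul_one] at h3
  exact ⟨aux _ (norm_nonneg _) (by nlinarith [sq_nonneg (ν⁻¹ * ‖r.2‖)]),
    aux _ (norm_nonneg _) (by nlinarith [sq_nonneg (ν⁻¹ * ‖r.1‖)])⟩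

lemma hasCompactSupport_dilate : HasCompactSupport (dilate φ ν) := by
  refine HasCompactSupport.intro (isCompact_closedBall (0 : ℂ × ℂ) ν) fun r hr => ?_
  by_contra h
  have := hφ.norm_le_of_dilate_ne_zero hν h
  exact hr (mem_closedBall_zero_iff.2 (max_le this.1 this.2))

lemma integral_dilate : ∫ q, dilate φ ν q = 1 := by
  simp only [dilate]
  rw [integral_const_mul, Measure.integral_comp_inv_smul_of_nonneg _ _ hν.le, hφ.integral_eq_one]
  have : Module.finrank ℝ (ℂ × ℂ) = 4 := by simp
  rw [this, smul_eq_mul, mul_one, inv_mul_cancel₀ (by positivity)]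

end IsMollifier

/-- In polar coordinates on `ℂ` the Jacobian cancels the singularity. This is the worst singularity
in the bound for the Hessian. -/
lemma locallyIntegrable_inv_norm_snd : LocallyIntegrable (fun q : ℂ × ℂ => ‖q.2‖⁻¹) := by
  have h1 : ∀ R : ℝ, IntegrableOn (fun v : ℂ => ‖v‖⁻¹) (Metric.closedBall 0 R) := by
    intro R
    have h2 : IntegrableOn (fun v : ℂ => ‖v‖⁻¹) (Metric.ball 0 (R + 1)) := by
      rw [integrableOn_fun_norm_addHaar (μ := (volume : Measure ℂ)) (f := fun y => y⁻¹)]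
      have : Module.finrank ℝ ℂ - 1 = 1 := by simp
      rw [this]
      refine IntegrableOn.congr_fun (f := fun _ => (1 : ℝ)) (by simp) ?_ measurableSet_Ioo
      intro y hy
      have := hy.1.ne'
      simp [this]
    exact h2.mono_set (Metric.closedBall_subset_ball (by linarith))
  rw [locallyIntegrable_iff]
  intro K hK
  obtain ⟨R, hR⟩ := hK.isBounded.subset_closedBall (0 : ℂ × ℂ)
  refine IntegrableOn.mono_set ?_ hR
  rw [← Prod.mk_zero_zero, ← closedBall_prod_same, IntegrableOn, Measure.volume_eq_prod,
    ← Measure.prod_restrict]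
  have : IsFiniteMeasure (volume.restrict (Metric.closedBall (0 : ℂ) R)) :=
    ⟨by simpa using (isCompact_closedBall (0 : ℂ) R).measure_lt_top (μ := volume)⟩
  exact (h1 R).comp_snd _

/-! ### Ellipticity at a single matrix, and the quadratic form of a radial Hessian. -/

section LinearAlgebra

variable {d : ℕ}

abbrev Vec (d : ℕ) : Type := EuclideanSpace ℂ (Fin d)

lemma act_smul (N : Matrix (Fin d) (Fin d) ℂ) (c : ℂ) (x : Vec d) :
    act N (c • x) = c • act N x := by
  ext i
  simp [act, Matrix.mulVec_smul]

lemma conjVec_smul (c : ℂ) (x : Vec d) : conjVec (c • x) = (starRingEnd ℂ) c • conjVec x := by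
  ext i
  simp [conjVec]

lemma norm_conjVec (x : Vec d) : ‖conjVec x‖ = ‖x‖ := by
  simp [conjVec, EuclideanSpace.norm_eq]

/-- Bounds for a single matrix: `Λ` bounds the sesquilinear form, `lam` is a coercivity constant and
`Δ` is a coercivity constant for all the forms `⟨N ξ, ξ ± c ξ̄⟩`. -/
structure MatBounds (N : Matrix (Fin d) (Fin d) ℂ) (c Λ lam Δ : ℝ) : Prop where
  upper : ∀ ζ η : Vec d, ‖inner ℂ η (act N ζ)‖ ≤ Λ * ‖ζ‖ * ‖η‖
  lower : ∀ ξ : Vec d, lam * ‖ξ‖ ^ 2 ≤ (inner ℂ ξ (act N ξ)).re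
  pLower : ∀ ξ : Vec d, Δ * ‖ξ‖ ^ 2 ≤ (inner ℂ (ξ + (c : ℂ) • conjVec ξ) (act N ξ)).re

namespace MatBounds

variable {N : Matrix (Fin d) (Fin d) ℂ} {c Λ lam Δ : ℝ} (h : MatBounds N c Λ lam Δ)
include h

/-- Replacing `ξ` by `iξ` preserves the first term and flips the sign of the conjugate term, so the
lower bound holds with either sign. -/
lemma pLower_abs (ξ : Vec d) : Δ * ‖ξ‖ ^ 2 ≤
    (inner ℂ ξ (act N ξ)).re - c * |(inner ℂ (conjVec ξ) (act N ξ)).re| := by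
  have h1 := h.pLower ξ
  have h2 := h.pLower (Complex.I • ξ)
  rw [inner_add_left, inner_smul_left] at h1
  rw [inner_add_left, act_smul, conjVec_smul, smul_smul, inner_smul_left, inner_smul_right,
    inner_smul_left, inner_smul_right, norm_smul] at h2
  simp only [map_mul, Complex.conj_I, Complex.conj_ofReal, neg_mul, Complex.norm_I,
    one_mul, Complex.add_re, Complex.neg_re, Complex.mul_re, Complex.I_re, Complex.I_im,
    Complex.mul_im, Complex.ofReal_re, Complex.ofReal_im, Complex.neg_im, map_neg] at h1 h2
  rcases abs_cases (inner ℂ (conjVec ξ) (act N ξ)).re with ⟨h3, -⟩ | ⟨h3, -⟩ <;> rw [h3] <;> linarith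

lemma le_lower (hc : 0 ≤ c) (ξ : Vec d) : Δ * ‖ξ‖ ^ 2 ≤ (inner ℂ ξ (act N ξ)).re :=
  (h.pLower_abs ξ).trans (by
    have := mul_nonneg hc (abs_nonneg (inner ℂ (conjVec ξ) (act N ξ)).re)
    linarith)

lemma re_inner_le (ζ η : Vec d) : |(inner ℂ η (act N ζ)).re| ≤ Λ * ‖ζ‖ * ‖η‖ :=
  (Complex.abs_re_le_norm _).trans (h.upper ζ η)

/-- The form in which `p`-ellipticity is applied to the Hessian: a multiple of `ξ̄` is harmless up
to the ratio `c = |1 - 2/p|`. -/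
lemma elliptic_comb {a b : ℝ} (hab : |b| ≤ c * a) (ha : 0 ≤ a) (ξ : Vec d) :
    a * (Δ * ‖ξ‖ ^ 2) ≤ (inner ℂ ((a : ℂ) • ξ + (b : ℂ) • conjVec ξ) (act N ξ)).re := by
  rw [inner_add_left, inner_smul_left, inner_smul_left]
  simp only [Complex.conj_ofReal, Complex.add_re, Complex.re_ofReal_mul]
  have h1 := mul_le_mul_of_nonneg_left (h.pLower_abs ξ) ha
  set Y := (inner ℂ (conjVec ξ) (act N ξ)).re
  have h2 : -(c * a * |Y|) ≤ b * Y := by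
    have := neg_abs_le (b * Y)
    rw [abs_mul] at this
    have := mul_le_mul_of_nonneg_right hab (abs_nonneg Y)
    linarith
  linarith

lemma norm_comb_le (a b : ℝ) (ξ : Vec d) :
    |(inner ℂ ((a : ℂ) • ξ + (b : ℂ) • conjVec ξ) (act N ξ)).re| ≤
      Λ * ((|a| + |b|) * ‖ξ‖ ^ 2) := by
  rw [inner_add_left, inner_smul_left, inner_smul_left]
  simp only [Complex.conj_ofReal, Complex.add_re, Complex.re_ofReal_mul]
  have h1 := h.re_inner_le ξ ξ
  have h2 := h.re_inner_le ξ (conjVec ξ)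
  rw [norm_conjVec] at h2
  refine (abs_add_le _ _).trans ?_
  rw [abs_mul, abs_mul]
  nlinarith [mul_le_mul_of_nonneg_left h1 (abs_nonneg a),
    mul_le_mul_of_nonneg_left h2 (abs_nonneg b)]

end MatBounds

/-- A crude bound whose purpose is to make the suprema and infima over unit spheres genuine. -/
lemma norm_inner_act_le (N : Matrix (Fin d) (Fin d) ℂ) (ζ η : Vec d) :
    ‖inner ℂ η (act N ζ)‖ ≤ (∑ i, ∑ j, ‖N i j‖) * (‖ζ‖ * ‖η‖) := by
  have e : inner ℂ η (act N ζ) = ∑ i, ∑ j, (N i j * ζ j) * (starRingEnd ℂ) (η i) := by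
    simp [act, PiLp.inner_apply, Matrix.mulVec, dotProduct, Finset.sum_mul]
  rw [e, Finset.sum_mul]
  refine (norm_sum_le _ _).trans (Finset.sum_le_sum fun i _ => ?_)
  rw [Finset.sum_mul]
  refine (norm_sum_le _ _).trans (Finset.sum_le_sum fun j _ => ?_)
  rw [norm_mul, norm_mul, RCLike.norm_conj, mul_assoc]
  gcongr
  · exact PiLp.norm_apply_le ζ j
  · exact PiLp.norm_apply_le η i

lemma homogeneous_le {c : ℝ} {f : Vec d → ℝ} (hf : ∀ (r : ℝ) (ξ : Vec d), f ((r : ℂ) • ξ) = r ^ 2 * f ξ)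
    (h1 : ∀ ξ, ‖ξ‖ = 1 → c ≤ f ξ) (ξ : Vec d) : c * ‖ξ‖ ^ 2 ≤ f ξ := by
  rcases eq_or_ne ξ 0 with rfl | h0
  · have := hf 0 0
    simp at this
    simp [this]
  · have hn : 0 < ‖ξ‖ := norm_pos_iff.2 h0
    have := h1 (((‖ξ‖⁻¹ : ℝ) : ℂ) • ξ) (by
      rw [norm_smul, Complex.norm_real, norm_inv, norm_norm, inv_mul_cancel₀ hn.ne'])
    rw [hf, inv_pow, inv_mul_eq_div, le_div_iff₀ (by positivity)] at this
    exact this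

lemma re_inner_real_smul (N : Matrix (Fin d) (Fin d) ℂ) (c r : ℝ) (ξ : Vec d) :
    (inner ℂ ((r : ℂ) • ξ + (c : ℂ) • conjVec ((r : ℂ) • ξ)) (act N ((r : ℂ) • ξ))).re =
      r ^ 2 * (inner ℂ (ξ + (c : ℂ) • conjVec ξ) (act N ξ)).re := by
  rw [conjVec_smul, Complex.conj_ofReal, smul_comm (c : ℂ) (r : ℂ), ← smul_add, act_smul,
    inner_smul_left, inner_smul_right, Complex.conj_ofReal, Complex.re_ofReal_mul,
    Complex.re_ofReal_mul]
  ring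

lemma exists_norm_eq_one (hd : 0 < d) : ∃ ξ : Vec d, ‖ξ‖ = 1 :=
  ⟨EuclideanSpace.single ⟨0, hd⟩ 1, by simp⟩

lemma abs_re_inner_add_conj_le (N : Matrix (Fin d) (Fin d) ℂ) {c : ℝ} (hc : 0 ≤ c) {ξ : Vec d}
    (hξ : ‖ξ‖ = 1) : |(inner ℂ (ξ + (c : ℂ) • conjVec ξ) (act N ξ)).re| ≤
      (1 + c) * ∑ i, ∑ j, ‖N i j‖ := by
  refine (Complex.abs_re_le_norm _).trans ((norm_inner_act_le _ _ _).trans ?_)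
  have h1 : ‖ξ + (c : ℂ) • conjVec ξ‖ ≤ 1 + c := by
    refine (norm_add_le _ _).trans ?_
    rw [norm_smul, norm_conjVec, hξ, Complex.norm_real, Real.norm_of_nonneg hc, mul_one]
  rw [hξ, one_mul, mul_comm]
  gcongr

lemma ae_entries_le {A : MatFun d} (hA : ∀ i j, MemLp (fun x => A x i j) ∞ volume) :
    ∃ C : ℝ, ∀ᵐ x, ∑ i, ∑ j, ‖A x i j‖ ≤ C := by
  have h1 : ∀ i j, ∃ C : ℝ, ∀ᵐ x, ‖A x i j‖ ≤ C := fun i j =>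
    ⟨_, ae_le_lpNorm_exponent_top (hA i j)⟩
  choose C hC using h1
  refine ⟨∑ i, ∑ j, C i j, ?_⟩
  have := ae_all_iff.2 fun i => ae_all_iff.2 fun j => hC i j
  filter_upwards [this] with x hx
  exact Finset.sum_le_sum fun i _ => Finset.sum_le_sum fun j _ => hx i j

/-- Treats `λ` (with `c = 0`) and `Δ_p` (with `c = |1 - 2/p|`) together. -/
lemma ae_lower_of_essInf (hd : 0 < d) {A : MatFun d}
    (hA : ∀ i j, MemLp (fun x => A x i j) ∞ volume) {c : ℝ} (hc : 0 ≤ c) :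
    ∀ᵐ x, ∀ ξ : Vec d, essInf (fun x => sInf ((fun ξ : Vec d =>
      (inner ℂ (ξ + (c : ℂ) • conjVec ξ) (act (A x) ξ)).re) '' Metric.sphere 0 1)) volume *
        ‖ξ‖ ^ 2 ≤ (inner ℂ (ξ + (c : ℂ) • conjVec ξ) (act (A x) ξ)).re := by
  obtain ⟨C, hC⟩ := ae_entries_le hA
  obtain ⟨ξ₀, hξ₀⟩ := exists_norm_eq_one hd
  -- A real-valued `essInf` is a lower bound almost everywhere only once boundedness from below is
  -- known. Nonemptiness of the unit sphere, hence `0 < d`, is used here.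
  have hb : IsBoundedUnder (· ≥ ·) (ae volume) (fun x => sInf ((fun ξ : Vec d =>
      (inner ℂ (ξ + (c : ℂ) • conjVec ξ) (act (A x) ξ)).re) '' Metric.sphere 0 1)) := by
    refine isBoundedUnder_of_eventually_ge (a := -((1 + c) * C)) ?_
    filter_upwards [hC] with x hx
    refine le_csInf ⟨_, ξ₀, by simpa using hξ₀, rfl⟩ ?_
    rintro _ ⟨ξ, hξ, rfl⟩
    have := abs_re_inner_add_conj_le (A x) hc (mem_sphere_zero_iff_norm.1 hξ)
    have h2 : (1 + c) * ∑ i, ∑ j, ‖A x i j‖ ≤ (1 + c) * C := by gcongr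
    exact (neg_le_neg (this.trans h2)).trans (neg_abs_le _)
  filter_upwards [ae_essInf_le hb] with x hx ξ
  refine homogeneous_le (f := fun ξ => (inner ℂ (ξ + (c : ℂ) • conjVec ξ) (act (A x) ξ)).re)
    (fun r ξ => re_inner_real_smul _ _ _ _) (fun ξ hξ => hx.trans (csInf_le ?_ ?_)) ξ
  · refine ⟨-((1 + c) * ∑ i, ∑ j, ‖A x i j‖), ?_⟩
    rintro _ ⟨ξ, hξ, rfl⟩
    exact (neg_le_neg (abs_re_inner_add_conj_le (A x) hc (mem_sphere_zero_iff_norm.1 hξ))).trans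
      (neg_abs_le _)
  · exact ⟨ξ, by simpa using hξ, rfl⟩

lemma ae_upper_of_essSup (hd : 0 < d) {A : MatFun d}
    (hA : ∀ i j, MemLp (fun x => A x i j) ∞ volume) :
    ∀ᵐ x, ∀ ζ η : Vec d, ‖inner ℂ η (act (A x) ζ)‖ ≤ bigLambda A * ‖ζ‖ * ‖η‖ := by
  obtain ⟨C, hC⟩ := ae_entries_le hA
  obtain ⟨ξ₀, hξ₀⟩ := exists_norm_eq_one hd
  have hle : ∀ x, ∀ ζ η : Vec d, ‖ζ‖ = 1 → ‖η‖ = 1 →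
      ‖inner ℂ η (act (A x) ζ)‖ ≤ ∑ i, ∑ j, ‖A x i j‖ := fun x ζ η h1 h2 => by
    simpa [h1, h2] using norm_inner_act_le (A x) ζ η
  have hb : IsBoundedUnder (· ≤ ·) (ae volume) (fun x =>
      sSup ((fun q : Vec d × Vec d => ‖inner ℂ q.2 (act (A x) q.1)‖) ''
        (Metric.sphere 0 1 ×ˢ Metric.sphere 0 1))) := by
    refine isBoundedUnder_of_eventually_le (a := C) ?_
    filter_upwards [hC] with x hx
    refine csSup_le ⟨_, (ξ₀, ξ₀), by simp [hξ₀], rfl⟩ ?_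
    rintro _ ⟨q, hq, rfl⟩
    exact (hle x _ _ (mem_sphere_zero_iff_norm.1 hq.1) (mem_sphere_zero_iff_norm.1 hq.2)).trans hx
  filter_upwards [ae_le_essSup hb] with x hx ζ η
  rcases eq_or_ne ζ 0 with rfl | hζ
  · have : act (A x) 0 = 0 := by simpa using act_smul (A x) 0 0
    simp [this]
  rcases eq_or_ne η 0 with rfl | hη
  · simp
  have hn : ∀ y : Vec d, y ≠ 0 → ‖((‖y‖⁻¹ : ℝ) : ℂ) • y‖ = 1 := fun y hy => by
    rw [norm_smul, Complex.norm_real, norm_inv, norm_norm, inv_mul_cancel₀ (norm_ne_zero_iff.2 hy)]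
  have h1 : ‖inner ℂ (((‖η‖⁻¹ : ℝ) : ℂ) • η) (act (A x) (((‖ζ‖⁻¹ : ℝ) : ℂ) • ζ))‖ ≤ bigLambda A := by
    refine (le_csSup ?_ ?_).trans hx
    · refine ⟨∑ i, ∑ j, ‖A x i j‖, ?_⟩
      rintro _ ⟨q, hq, rfl⟩
      exact hle x _ _ (mem_sphere_zero_iff_norm.1 hq.1) (mem_sphere_zero_iff_norm.1 hq.2)
    · exact ⟨(((‖ζ‖⁻¹ : ℝ) : ℂ) • ζ, ((‖η‖⁻¹ : ℝ) : ℂ) • η),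
        ⟨mem_sphere_zero_iff_norm.2 (hn ζ hζ), mem_sphere_zero_iff_norm.2 (hn η hη)⟩, rfl⟩
  rw [act_smul, inner_smul_left, inner_smul_right, norm_mul, norm_mul, RCLike.norm_conj,
    Complex.norm_real, Complex.norm_real, norm_inv, norm_inv, norm_norm, norm_norm,
    inv_mul_le_iff₀ (norm_pos_iff.2 hη), inv_mul_le_iff₀ (norm_pos_iff.2 hζ)] at h1
  linarith

lemma IsPElliptic.ae_matBounds (hd : 0 < d) {p : ℝ} {A : MatFun d} (hA : IsPElliptic p A) :
    ∀ᵐ x, MatBounds (A x) |1 - 2 / p| (bigLambda A) (smallLambda A) (Delta p A) := by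
  have h0 := ae_lower_of_essInf hd hA.memLp (le_refl 0)
  simp only [Complex.ofReal_zero, zero_smul, add_zero] at h0
  filter_upwards [ae_upper_of_essSup hd hA.memLp, h0,
    ae_lower_of_essInf hd hA.memLp (abs_nonneg (1 - 2 / p))] with x h1 h2 h3
  exact ⟨h1, h2, h3⟩

lemma IsPElliptic.smallLambda_le (hd : 0 < d) {p : ℝ} {A : MatFun d} (hA : IsPElliptic p A) :
    smallLambda A ≤ bigLambda A ∧ Delta p A ≤ bigLambda A := by
  obtain ⟨x, hx⟩ := (hA.ae_matBounds hd).exists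
  obtain ⟨ξ, hξ⟩ := exists_norm_eq_one hd
  have h1 := (le_abs_self _).trans (hx.re_inner_le ξ ξ)
  have h2 := hx.lower ξ
  have h3 := hx.le_lower (abs_nonneg _) ξ
  rw [hξ] at h1 h2 h3
  constructor <;> linarith

/-- The quadratic form whose value at the Hessian is the generalized Hessian. -/
def hessForm (A B : Matrix (Fin d) (Fin d) ℂ) (N : Matrix (Fin 4) (Fin 4) ℝ) (ζ η : Vec d) : ℝ :=
  ((N ⊗ₖ (1 : Matrix (Fin d) (Fin d) ℝ)) *ᵥ realVec ζ η) ⬝ᵥ (realMat A B *ᵥ realVec ζ η)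

lemma realVec_apply (ζ η : Vec d) (k : Fin d) :
    realVec ζ η (0, k) = (ζ k).re ∧ realVec ζ η (1, k) = (ζ k).im ∧
      realVec ζ η (2, k) = (η k).re ∧ realVec ζ η (3, k) = (η k).im :=
  ⟨rfl, rfl, rfl, rfl⟩

lemma realMat_apply_left (A B : Matrix (Fin d) (Fin d) ℂ) (k l : Fin d) :
    realMat A B (0, k) (0, l) = (A k l).re ∧ realMat A B (0, k) (1, l) = -(A k l).im ∧
    realMat A B (0, k) (2, l) = 0 ∧ realMat A B (0, k) (3, l) = 0 ∧
    realMat A B (1, k) (0, l) = (A k l).im ∧ realMat A B (1, k) (1, l) = (A k l).re ∧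
    realMat A B (1, k) (2, l) = 0 ∧ realMat A B (1, k) (3, l) = 0 :=
  ⟨rfl, rfl, rfl, rfl, rfl, rfl, rfl, rfl⟩

lemma realMat_apply_right (A B : Matrix (Fin d) (Fin d) ℂ) (k l : Fin d) :
    realMat A B (2, k) (0, l) = 0 ∧ realMat A B (2, k) (1, l) = 0 ∧
    realMat A B (2, k) (2, l) = (B k l).re ∧ realMat A B (2, k) (3, l) = -(B k l).im ∧
    realMat A B (3, k) (0, l) = 0 ∧ realMat A B (3, k) (1, l) = 0 ∧
    realMat A B (3, k) (2, l) = (B k l).im ∧ realMat A B (3, k) (3, l) = (B k l).re :=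
  ⟨rfl, rfl, rfl, rfl, rfl, rfl, rfl, rfl⟩

lemma act_apply (N : Matrix (Fin d) (Fin d) ℂ) (x : Vec d) (k : Fin d) :
    act N x k = ∑ l, N k l * x l := rfl

lemma realMat_mulVec (A B : Matrix (Fin d) (Fin d) ℂ) (ζ η : Vec d) :
    realMat A B *ᵥ realVec ζ η = realVec (act A ζ) (act B η) := by
  ext ⟨i, k⟩
  match i with
  | 0 | 1 | 2 | 3 =>
    simp only [Matrix.mulVec, dotProduct, Fintype.sum_prod_type, Fin.sum_univ_four,
      realMat_apply_left, realMat_apply_right, realVec_apply, act_apply, Complex.re_sum,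
      Complex.im_sum, Complex.mul_re, Complex.mul_im, ← Finset.sum_add_distrib]
    exact Finset.sum_congr rfl fun l _ => by ring

lemma kronecker_mulVec (N : Matrix (Fin 4) (Fin 4) ℝ) (ζ η : Vec d) (i : Fin 4) (k : Fin d) :
    ((N ⊗ₖ (1 : Matrix (Fin d) (Fin d) ℝ)) *ᵥ realVec ζ η) (i, k) =
      ∑ j, N i j * realVec ζ η (j, k) := by
  simp [Matrix.mulVec, dotProduct, Fintype.sum_prod_type, Matrix.one_apply]

lemma hessForm_eq_sum (A B : Matrix (Fin d) (Fin d) ℂ) (N : Matrix (Fin 4) (Fin 4) ℝ)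
    (ζ η : Vec d) : hessForm A B N ζ η =
      ∑ i, ∑ j, N i j * ∑ k, realVec ζ η (j, k) * realVec (act A ζ) (act B η) (i, k) := by
  simp only [hessForm, realMat_mulVec, dotProduct, Fintype.sum_prod_type, kronecker_mulVec,
    Finset.sum_mul, Finset.mul_sum]
  refine Finset.sum_congr rfl fun i _ => ?_
  rw [Finset.sum_comm]
  simp only [mul_assoc]

/-- The Hessian matrix of a function of `(|u|, |v|)`. -/
def radialHess (P p m Q q : ℝ) (u v : ℂ) : Matrix (Fin 4) (Fin 4) ℝ :=
  !![P + p * u.re * u.re, p * u.re * u.im, m * u.re * v.re, m * u.re * v.im;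
    p * u.im * u.re, P + p * u.im * u.im, m * u.im * v.re, m * u.im * v.im;
    m * v.re * u.re, m * v.re * u.im, Q + q * v.re * v.re, q * v.re * v.im;
    m * v.im * u.re, m * v.im * u.im, q * v.im * v.re, Q + q * v.im * v.im]

/-- `A` and `B` commute with the unimodular scalars `e`, `e'`, so the form equals its value at the
real point `(s, t)`. There the rank-one parts see only `Re σ = (σ + σ̄)/2` and `Re τ`, which is the
source of the conjugates. -/
lemma hessForm_radialHess (A B : Matrix (Fin d) (Fin d) ℂ) (P p m Q q s t : ℝ) {e e' : ℂ}
    (he : ‖e‖ = 1) (he' : ‖e'‖ = 1) (σ τ : Vec d) :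
    hessForm A B (radialHess P p m Q q (s * e) (t * e')) (e • σ) (e' • τ) =
      (inner ℂ (((P + s ^ 2 * p / 2 : ℝ) : ℂ) • σ + ((s ^ 2 * p / 2 : ℝ) : ℂ) • conjVec σ)
        (act A σ)).re +
      (inner ℂ (((Q + t ^ 2 * q / 2 : ℝ) : ℂ) • τ + ((t ^ 2 * q / 2 : ℝ) : ℂ) • conjVec τ)
        (act B τ)).re +
      (s * t * m / 2) * ((inner ℂ (τ + conjVec τ) (act A σ)).re +
        (inner ℂ (σ + conjVec σ) (act B τ)).re) := by
  have h1 : e.re ^ 2 + e.im ^ 2 = 1 := by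
    rw [← Complex.normSq_add_mul_I, Complex.re_add_im, Complex.normSq_eq_norm_sq, he, one_pow]
  have h2 : e'.re ^ 2 + e'.im ^ 2 = 1 := by
    rw [← Complex.normSq_add_mul_I, Complex.re_add_im, Complex.normSq_eq_norm_sq, he', one_pow]
  obtain ⟨a₁, ha₁⟩ : ∃ x, x = s ^ 2 * p / 2 := ⟨_, rfl⟩
  obtain ⟨b₁, hb₁⟩ : ∃ x, x = t ^ 2 * q / 2 := ⟨_, rfl⟩
  rw [hessForm_eq_sum, ← ha₁, ← hb₁]
  simp only [radialHess, PiLp.inner_apply, Complex.re_sum, act_smul, ← Finset.sum_add_distrib,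
    Finset.mul_sum, Fin.sum_univ_four, Matrix.of_apply, Matrix.cons_val, realVec_apply]
  refine Finset.sum_congr rfl fun k _ => ?_
  simp only [conjVec, PiLp.add_apply, PiLp.smul_apply, smul_eq_mul, RCLike.inner_apply, map_add,
    map_mul, Complex.conj_ofReal, Complex.conj_conj, Complex.add_re, Complex.add_im,
    Complex.mul_re, Complex.mul_im, Complex.conj_re, Complex.conj_im, Complex.ofReal_re,
    Complex.ofReal_im, zero_mul, sub_zero, add_zero]
  generalize (act A σ).ofLp k = a
  generalize (act B τ).ofLp k = b
  generalize σ.ofLp k = x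
  generalize τ.ofLp k = y
  generalize e.re = er at *
  generalize e.im = ei at *
  generalize e'.re = fr at *
  generalize e'.im = fi at *
  subst ha₁ hb₁
  -- With `E = |e|²` and `E' = |e'|²`, the coefficients come from `E² - 1 = (E + 1)(E - 1)` and `E
  -- E' - 1 = E'(E - 1) + (E' - 1)`.
  linear_combination (P * (x.re * a.re + x.im * a.im) +
      p * s ^ 2 * x.re * a.re * (er ^ 2 + ei ^ 2 + 1) +
      m * s * t * (y.re * a.re + x.re * b.re) * (fr ^ 2 + fi ^ 2)) * h1 +
    (Q * (y.re * b.re + y.im * b.im) + q * t ^ 2 * y.re * b.re * (fr ^ 2 + fi ^ 2 + 1) +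
      m * s * t * (y.re * a.re + x.re * b.re)) * h2

end LinearAlgebra

/-! ### Coefficients of the gradient and Hessian, and the scalar inequalities. -/

section Coefficients

/-- `(∂_s 𝔛) / s` as a function of `s = |u|`, `t = |v|`. -/
def coefU (Φ Ψ : ℝ → ℝ) (δ s t : ℝ) : ℝ :=
  D1 Φ s / s + 2 * δ * intRight Ψ (max t (D1 Φ s))

/-- `(∂_t 𝔛) / t` as a function of `s = |u|`, `t = |v|`. -/
def coefV (Ψ : ℝ → ℝ) (δ s t : ℝ) : ℝ :=
  (D1 Ψ t + δ * (min s (D1 Ψ t)) ^ 2 / D1 Ψ t) / t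

/-- `(∂_s coefU) / s`. -/
def coefUU (Φ : ℝ → ℝ) (δ s t : ℝ) : ℝ :=
  (deriv (D1 Φ) s - D1 Φ s / s + if t ≤ D1 Φ s then 2 * δ * deriv (D1 Φ) s else 0) / s ^ 2

/-- `(∂_t coefU) / t = (∂_s coefV) / s`. -/
def coefUV (Φ Ψ : ℝ → ℝ) (δ s t : ℝ) : ℝ :=
  if t ≤ D1 Φ s then 0 else 2 * δ / (t * D1 Ψ t)

/-- `(∂_t coefV) / t`. -/
def coefVV (Φ Ψ : ℝ → ℝ) (δ s t : ℝ) : ℝ :=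
  (deriv (D1 Ψ) t - D1 Ψ t / t + if t ≤ D1 Φ s then δ * (deriv (D1 Ψ) t - D1 Ψ t / t)
    else -(δ * s ^ 2 * (deriv (D1 Ψ) t / D1 Ψ t ^ 2 + 1 / (t * D1 Ψ t)))) / t ^ 2

/-- The pointwise Hessian of the Bellman function. -/
def bellmanHess (Φ Ψ : ℝ → ℝ) (δ : ℝ) (q : ℂ × ℂ) : Matrix (Fin 4) (Fin 4) ℝ :=
  radialHess (coefU Φ Ψ δ ‖q.1‖ ‖q.2‖) (coefUU Φ δ ‖q.1‖ ‖q.2‖) (coefUV Φ Ψ δ ‖q.1‖ ‖q.2‖)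
    (coefV Ψ δ ‖q.1‖ ‖q.2‖) (coefVV Φ Ψ δ ‖q.1‖ ‖q.2‖) q.1 q.2

end Coefficients

/-- AM-GM in discriminant form. -/
lemma mul_le_of_sq_le_mul {a b x y κ : ℝ} (ha : 0 ≤ a) (hb : 0 ≤ b)
    (h : κ ^ 2 ≤ 4 * (a * b)) : κ * (x * y) ≤ a * x ^ 2 + b * y ^ 2 := by
  refine abs_le_of_sq_le_sq' ?_ (by positivity) |>.2
  have h1 : (κ * (x * y)) ^ 2 ≤ 4 * (a * b) * (x * y) ^ 2 := by
    rw [mul_pow]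
    gcongr
  nlinarith [sq_nonneg (a * x ^ 2 - b * y ^ 2)]

/-- Put `S² = δ R lam Δ`. The target needs `κ ≤ S`, and the cross term costs at most `(2/5) S`,
because `100 δ Λ² ≤ lam Δ` and `R ≥ 1`. -/
lemma outer_scalar_bound {δ R lam Δ Λ κ p n k : ℝ} (hδ : 0 < δ) (hR : 1 ≤ R) (hlam : 0 < lam)
    (hΔ : 0 < Δ) (hd2 : 100 * δ * Λ ^ 2 ≤ lam * Δ) (hκ : κ ^ 2 ≤ δ * R * lam * Δ)
    (hp : 0 < p) (hn : 0 ≤ n) (hk : 0 ≤ k) :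
    κ * (n * k) ≤ 2 * δ * (R * p) * (lam * n ^ 2) + p⁻¹ / 4 * (Δ * k ^ 2) -
      4 * δ * Λ * (n * k) := by
  have hR0 : 0 < R := by linarith
  obtain ⟨S, hS⟩ : ∃ S, S = √(δ * R * lam * Δ) := ⟨_, rfl⟩
  have hS2 : S ^ 2 = δ * R * lam * Δ := by rw [hS]; exact Real.sq_sqrt (by positivity)
  have hS0 : 0 ≤ S := by rw [hS]; exact Real.sqrt_nonneg _
  have hκS : κ ≤ S := by rw [hS]; exact Real.le_sqrt_of_sq_le hκ
  have hΛS : 4 * δ * Λ ≤ 2 / 5 * S := by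
    refine (abs_le_of_sq_le_sq' ?_ (by positivity)).2
    have h1 : δ * (100 * δ * Λ ^ 2) ≤ δ * (R * (lam * Δ)) :=
      mul_le_mul_of_nonneg_left (hd2.trans (le_mul_of_one_le_left (by positivity) hR)) hδ.le
    rw [mul_pow (2 / 5), hS2]
    linarith
  -- The weights `p` and `p⁻¹` cancel and leave the discriminant `2 S²`; `7/5 = 1 + 2/5` is
  -- admissible since `(7/5)² < 2`.
  have h4 := mul_le_of_sq_le_mul (a := 2 * δ * (R * p) * lam) (b := p⁻¹ / 4 * Δ)
    (x := n) (y := k) (κ := 7 / 5 * S) (by positivity) (by positivity) (by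
      have h5 : 4 * (2 * δ * (R * p) * lam * (p⁻¹ / 4 * Δ)) = 2 * (δ * R * lam * Δ) := by
        field_simp
      rw [h5, ← hS2, mul_pow]
      linarith [sq_nonneg S])
  have h5 : κ * (n * k) ≤ S * (n * k) := by gcongr
  have h6 : 4 * δ * Λ * (n * k) ≤ 2 / 5 * S * (n * k) := by gcongr
  linarith

/-! ### Pointwise lower bounds for the Hessian form in the two regions. -/

namespace YoungPair

variable {Φ Ψ : ℝ → ℝ} (h : YoungPair Φ Ψ)
include h

/-- On the interface the factors are `f + x` and `1/f + 1/x`, with product at least `4`. For smaller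
`t`, the first factor is compared with its value at `Ψ'(t) ≤ s`: both `Φ''` and `Φ'(s)/s` increase.
-/
lemma four_le_mul {s t : ℝ} (hs : 0 < s) (ht : 0 < t) (hst : t ≤ D1 Φ s) :
    4 ≤ (D2 Φ s + D1 Φ s / s) * (D2 Ψ t + D1 Ψ t / t) := by
  have hw := h.D1_right_pos ht
  have hws : D1 Ψ t ≤ s := (h.le_D1_left_iff hs.le ht.le).1 hst
  have h1 := h.D2_left_mono hw hws
  have h2 := h.D1_div_mono hw hws
  rw [h.D1_left_right ht.le] at h2
  have h3 := h.D2_right_mul ht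
  have h4 := h.pos_right t ht
  have h5 := h.pos_left _ hw
  have h6 : (D2 Φ (D1 Ψ t) + t / D1 Ψ t) * (D2 Ψ t + D1 Ψ t / t) ≤
      (D2 Φ s + D1 Φ s / s) * (D2 Ψ t + D1 Ψ t / t) := by
    have : 0 ≤ D1 Ψ t / t := by positivity
    gcongr
  refine le_trans ?_ h6
  set x := t / D1 Ψ t with hx
  have hx0 : 0 < x := by positivity
  have hxi : D1 Ψ t / t = x⁻¹ := by rw [hx, inv_div]
  have hy : D2 Φ (D1 Ψ t) = (D2 Ψ t)⁻¹ := by rw [← one_div, eq_div_iff h4.ne', mul_comm, h3]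
  rw [hxi, hy]
  have h7 : ((D2 Ψ t)⁻¹ + x) * (D2 Ψ t + x⁻¹) = 2 + (x * D2 Ψ t + (x * D2 Ψ t)⁻¹) := by
    field_simp
    ring
  rw [h7]
  have h8 : 0 < x * D2 Ψ t := by positivity
  have h9 : 2 ≤ x * D2 Ψ t + (x * D2 Ψ t)⁻¹ := by
    have : x * D2 Ψ t + (x * D2 Ψ t)⁻¹ - 2 = (x * D2 Ψ t - 1) ^ 2 / (x * D2 Ψ t) := by
      field_simp
      ring
    have : 0 ≤ (x * D2 Ψ t - 1) ^ 2 / (x * D2 Ψ t) := by positivity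
    linarith
  linarith

lemma D2_right_le_div {t : ℝ} (ht : 0 < t) : D2 Ψ t ≤ D1 Ψ t / t := by
  rw [le_div_iff₀ ht, mul_comm]
  exact h.mul_D2_right_le ht

lemma div_le_D2_right {t : ℝ} (ht : 0 < t) : D1 Ψ t / t ≤ tildeBigM Φ * D2 Ψ t := by
  rw [div_le_iff₀ ht]
  have := h.D1_right_le ht
  linarith

lemma div_le_D2_left {s : ℝ} (hs : 0 < s) : D1 Φ s / s ≤ D2 Φ s := by
  rw [div_le_iff₀ hs, mul_comm]
  exact h.D1_le_mul_D2 hs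

lemma D2_left_le_div {s : ℝ} (hs : 0 < s) : D2 Φ s ≤ tildeBigM Φ * (D1 Φ s / s) := by
  rw [← mul_div_assoc, le_div_iff₀ hs, mul_comm]
  exact h.le_tildeBigM_mul hs

variable {d : ℕ} {A B : Matrix (Fin d) (Fin d) ℂ} {c ΛA lamA ΔA ΛB lamB ΔB δ κ : ℝ}

/-- The mixed derivative vanishes here, so `p`-ellipticity gives separate bounds in `σ` and `τ`,
combined by AM-GM and `four_le_mul`. -/
lemma hessForm_lower_inner (hA : MatBounds A c ΛA lamA ΔA) (hB : MatBounds B c ΛB lamB ΔB)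
    (hc : c * (tildeBigM Φ + 1) = tildeBigM Φ - 1) (hΔA : 0 < ΔA) (hΔB : 0 < ΔB) (hδ : 0 < δ)
    (hκ0 : 0 ≤ κ) (hκA : κ ≤ 2 * ΔA) (hκB : κ ≤ 2 * ΔB) {s t : ℝ} (hs : 0 < s) (ht : 0 < t)
    (hst : t ≤ D1 Φ s) {e e' : ℂ} (he : ‖e‖ = 1) (he' : ‖e'‖ = 1) (σ τ : Vec d) :
    κ * (‖σ‖ * ‖τ‖) ≤ hessForm A B (radialHess (coefU Φ Ψ δ s t) (coefUU Φ δ s t)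
      (coefUV Φ Ψ δ s t) (coefV Ψ δ s t) (coefVV Φ Ψ δ s t) (s * e) (t * e'))
      (e • σ) (e' • τ) := by
  have hw := h.D1_right_pos ht
  have hws : D1 Ψ t ≤ s := (h.le_D1_left_iff hs.le ht.le).1 hst
  have hM := h.one_lt_tildeBigM
  have e1 : coefU Φ Ψ δ s t = D1 Φ s / s + 2 * δ * (D1 Φ s / s + intLeft Φ s) := by
    rw [coefU, max_eq_right hst, h.intRight_D1 hs.le]
  have e2 : s ^ 2 * coefUU Φ δ s t = D2 Φ s - D1 Φ s / s + 2 * δ * D2 Φ s := by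
    rw [coefUU, if_pos hst, ← D2_eq_deriv hs, mul_div_cancel₀ _ (by positivity)]
  have e3 : coefV Ψ δ s t = (1 + δ) * (D1 Ψ t / t) := by
    rw [coefV, min_eq_right hws]
    field_simp
  have e4 : t ^ 2 * coefVV Φ Ψ δ s t = (1 + δ) * (D2 Ψ t - D1 Ψ t / t) := by
    rw [coefVV, if_pos hst, ← D2_eq_deriv ht, mul_div_cancel₀ _ (by positivity)]
    ring
  have e5 : coefUV Φ Ψ δ s t = 0 := by rw [coefUV, if_pos hst]
  rw [hessForm_radialHess _ _ _ _ _ _ _ _ _ he he', e5, e2, e4, e1, e3, mul_zero, zero_div,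
    zero_mul, add_zero]
  have k1 := h.div_le_D2_left hs
  have k2 := h.D2_left_le_div hs
  have k3 := h.D2_right_le_div ht
  have k4 := h.div_le_D2_right ht
  have k5 := h.le_intLeft hs.le
  have k6 := h.intLeft_nonneg hs.le
  have k7 := h.four_le_mul hs ht hst
  have k8 := h.pos_left s hs
  have k9 := h.pos_right t ht
  have k10 : 0 ≤ D1 Φ s / s := h.D1_div_nonneg hs.le
  have k11 : 0 ≤ D1 Ψ t / t := by positivity
  set f' := D2 Φ s
  set g' := D2 Ψ t
  set x := D1 Φ s / s
  set y := D1 Ψ t / t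
  set J := intLeft Φ s
  set M := tildeBigM Φ
  have hM0 : 0 < M + 1 := by linarith
  -- Besides `f' ≤ M x`, the `δ`-terms need `x ≤ (M - 1) J`, which upgrades this to `f' ≤ (M - 1)(x
  -- + J)`.
  have r1 : |(f' - x + 2 * δ * f') / 2| ≤
      c * (x + 2 * δ * (x + J) + (f' - x + 2 * δ * f') / 2) := by
    have q0 : 0 ≤ δ * f' := by positivity
    have q1 : δ * f' ≤ δ * ((M - 1) * (x + J)) := by
      gcongr
      linarith
    rw [abs_of_nonneg (by linarith), ← mul_le_mul_iff_right₀ hM0, ← mul_assoc, mul_comm (M + 1) c, hc]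
    linarith
  have r2 : |(1 + δ) * (g' - y) / 2| ≤ c * ((1 + δ) * y + (1 + δ) * (g' - y) / 2) := by
    have q1 : (1 + δ) * y ≤ (1 + δ) * (M * g') := by gcongr
    have q2 : (1 + δ) * g' ≤ (1 + δ) * y := by gcongr
    rw [abs_of_nonpos (by linarith), ← mul_le_mul_iff_right₀ hM0, ← mul_assoc, mul_comm (M + 1) c, hc]
    linarith
  have q0 : 0 ≤ δ * f' := by positivity
  have q1 : 0 ≤ δ * g' := by positivity
  have q2 : 0 ≤ δ * x := by positivity
  have q3 : 0 ≤ δ * J := by positivity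
  have q4 : 0 ≤ δ * y := by positivity
  have s1 := hA.elliptic_comb r1 (by linarith) σ
  have s2 := hB.elliptic_comb r2 (by linarith) τ
  have t1 : (f' + x) / 2 * (ΔA * ‖σ‖ ^ 2) ≤
      (x + 2 * δ * (x + J) + (f' - x + 2 * δ * f') / 2) * (ΔA * ‖σ‖ ^ 2) := by
    gcongr
    linarith
  have t2 : (g' + y) / 2 * (ΔB * ‖τ‖ ^ 2) ≤
      ((1 + δ) * y + (1 + δ) * (g' - y) / 2) * (ΔB * ‖τ‖ ^ 2) := by
    gcongr
    linarith
  refine le_trans ?_ (add_le_add (t1.trans s1) (t2.trans s2))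
  have hfin := mul_le_of_sq_le_mul (a := (f' + x) / 2 * ΔA) (b := (g' + y) / 2 * ΔB)
    (x := ‖σ‖) (y := ‖τ‖) (κ := κ) (by positivity) (by positivity) ?_
  · linarith
  · calc κ ^ 2 = κ * κ := sq κ
      _ ≤ (2 * ΔA) * (2 * ΔB) := by gcongr
      _ = 4 * (ΔA * ΔB) := by ring
      _ ≤ ((f' + x) * (g' + y)) * (ΔA * ΔB) := by gcongr
      _ = _ := by ring

/-- The gain in `σ` is the `δ`-part of `coefU`, a multiple of the identity, so plain coercivity of
`A` suffices; the gain in `τ` is the `Ψ`-part. Their weights `t/w` and `w/t`, with `w = Ψ'(t)`, are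
reciprocal, so `outer_scalar_bound` absorbs the cross term. -/
lemma hessForm_lower_outer (hA : MatBounds A c ΛA lamA ΔA) (hB : MatBounds B c ΛB lamB ΔB)
    (hc : c * (tildeBigM Φ + 1) = tildeBigM Φ - 1) (hΔA : 0 < ΔA) (hΔB : 0 < ΔB)
    (hlamA : 0 < lamA) (hδ : 0 < δ) {Λ : ℝ} (hΛA : ΛA ≤ Λ) (hΛB : ΛB ≤ Λ)
    (hd1 : 4 * δ * ΛB ≤ ΔB) (hd2 : 100 * δ * Λ ^ 2 ≤ lamA * ΔB) (hΛB0 : 0 ≤ ΛB)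
    (hκ : κ ^ 2 ≤ δ * (tildeBigM Φ / (tildeBigM Φ - 1)) * lamA * ΔB)
    {s t : ℝ} (hs : 0 < s) (ht : 0 < t)
    (hst : D1 Φ s < t) {e e' : ℂ} (he : ‖e‖ = 1) (he' : ‖e'‖ = 1) (σ τ : Vec d) :
    κ * (‖σ‖ * ‖τ‖) ≤ hessForm A B (radialHess (coefU Φ Ψ δ s t) (coefUU Φ δ s t)
      (coefUV Φ Ψ δ s t) (coefV Ψ δ s t) (coefVV Φ Ψ δ s t) (s * e) (t * e'))
      (e • σ) (e' • τ) := by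
  have hw := h.D1_right_pos ht
  have hws : s < D1 Ψ t := not_le.1 fun hle => hst.not_ge ((h.le_D1_left_iff hs.le ht.le).2 hle)
  have hM := h.one_lt_tildeBigM
  have k1 := h.div_le_D2_left hs
  have k2 := h.D2_left_le_div hs
  have k3 := h.D2_right_le_div ht
  have k4 := h.div_le_D2_right ht
  have k6 := h.intRight_nonneg ht.le
  have k8 := h.pos_left s hs
  have k9 := h.pos_right t ht
  have k10 : 0 ≤ D1 Φ s / s := h.D1_div_nonneg hs.le
  have k11 : 0 < D1 Ψ t / t := by positivity
  have k12 := h.le_intRight ht.le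
  obtain ⟨w, hwdef⟩ : ∃ w, w = D1 Ψ t := ⟨_, rfl⟩
  obtain ⟨g', hg'⟩ : ∃ w, w = D2 Ψ t := ⟨_, rfl⟩
  obtain ⟨f', hf'⟩ : ∃ w, w = D2 Φ s := ⟨_, rfl⟩
  obtain ⟨x, hx⟩ : ∃ w, w = D1 Φ s / s := ⟨_, rfl⟩
  obtain ⟨K, hK⟩ : ∃ w, w = intRight Ψ t := ⟨_, rfl⟩
  obtain ⟨M, hMdef⟩ : ∃ w, w = tildeBigM Φ := ⟨_, rfl⟩
  have e1 : coefU Φ Ψ δ s t = x + 2 * δ * K := by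
    rw [coefU, max_eq_left hst.le, hx, hK]
  have e2 : s ^ 2 * coefUU Φ δ s t = f' - x := by
    rw [coefUU, if_neg hst.not_ge, ← D2_eq_deriv hs, mul_div_cancel₀ _ (by positivity), hf', hx,
      add_zero]
  have e3 : coefV Ψ δ s t = w / t + δ * s ^ 2 / (t * w) := by
    rw [coefV, min_eq_left hws.le, hwdef]
    field_simp
  have e4 : t ^ 2 * coefVV Φ Ψ δ s t =
      g' - w / t - δ * s ^ 2 * (g' / w ^ 2 + 1 / (t * w)) := by
    rw [coefVV, if_neg hst.not_ge, ← D2_eq_deriv ht, mul_div_cancel₀ _ (by positivity), hg', hwdef]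
    ring
  have e5 : s * t * coefUV Φ Ψ δ s t / 2 = δ * (s / w) := by
    rw [coefUV, if_neg hst.not_ge, hwdef]
    field_simp
  rw [hessForm_radialHess _ _ _ _ _ _ _ _ _ he he', e5, e2, e4, e1, e3]
  simp only [← hwdef, ← hg', ← hf', ← hx, ← hK, ← hMdef] at *
  have hM0 : 0 < M + 1 := by linarith
  have hM1 : 0 < M - 1 := by linarith
  have r1 : |(f' - x) / 2| ≤ c * ((f' + x) / 2) := by
    rw [abs_of_nonneg (by linarith), ← mul_le_mul_iff_right₀ hM0, ← mul_assoc, mul_comm (M + 1) c, hc]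
    linarith
  have r2 : |(g' - w / t) / 2| ≤ c * ((g' + w / t) / 2) := by
    rw [abs_of_nonpos (by linarith), ← mul_le_mul_iff_right₀ hM0, ← mul_assoc, mul_comm (M + 1) c, hc]
    linarith
  have s1 := hA.elliptic_comb r1 (by linarith) σ
  have s2 := hB.elliptic_comb r2 (by linarith) τ
  have s3 := hA.lower σ
  -- `y` and `z` collect the `δ`-perturbation of the `B`-block. It need not satisfy the ellipticity
  -- ratio and is estimated in absolute value.
  obtain ⟨y, hy⟩ : ∃ y, y = δ * s ^ 2 / (t * w) := ⟨_, rfl⟩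
  obtain ⟨z, hz⟩ : ∃ z, z = δ * s ^ 2 * (g' / w ^ 2) := ⟨_, rfl⟩
  have hz0 : 0 ≤ z := by rw [hz]; positivity
  have hzy : z ≤ y := by
    have : g' / w ^ 2 ≤ (w / t) / w ^ 2 := by gcongr
    calc z ≤ δ * s ^ 2 * ((w / t) / w ^ 2) := by rw [hz]; gcongr
      _ = y := by rw [hy]; field_simp
  have hyw : y ≤ δ * (w / t) := by
    calc y = δ * (s ^ 2 / (t * w)) := by rw [hy]; ring
      _ ≤ δ * (w ^ 2 / (t * w)) := by gcongr
      _ = δ * (w / t) := by congr 1; field_simp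
  have s4 := (abs_le.1 (hB.norm_comb_le ((y - z) / 2) (-(y + z) / 2) τ)).1
  have r3 : |(y - z) / 2| + |-(y + z) / 2| = y := by
    rw [abs_of_nonneg (by linarith), abs_of_nonpos (by linarith)]
    ring
  rw [r3] at s4
  -- The condition `4 δ ΛB ≤ ΔB` limits the loss to half of the gain `(w/t)/2 · ΔB ‖τ‖²`.
  have s5 : ΛB * (y * ‖τ‖ ^ 2) ≤ (w / t) / 4 * (ΔB * ‖τ‖ ^ 2) := by
    calc ΛB * (y * ‖τ‖ ^ 2) ≤ ΛB * (δ * (w / t) * ‖τ‖ ^ 2) := by gcongr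
      _ = (4 * δ * ΛB) * ((w / t) * ‖τ‖ ^ 2 / 4) := by ring
      _ ≤ ΔB * ((w / t) * ‖τ‖ ^ 2 / 4) := by gcongr
      _ = _ := by ring
  have hA1 := (abs_le.1 (hA.re_inner_le σ τ)).1
  have hA2 := (abs_le.1 (hA.re_inner_le σ (conjVec τ))).1
  have hB1 := (abs_le.1 (hB.re_inner_le τ σ)).1
  have hB2 := (abs_le.1 (hB.re_inner_le τ (conjVec σ))).1
  rw [norm_conjVec] at hA2 hB2
  have hΛ0 : 0 ≤ Λ := hΛB0.trans hΛB
  have cA : ΛA * ‖σ‖ * ‖τ‖ ≤ Λ * ‖σ‖ * ‖τ‖ := by gcongr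
  have cB : ΛB * ‖τ‖ * ‖σ‖ ≤ Λ * ‖τ‖ * ‖σ‖ := by gcongr
  have cross : -(4 * δ * Λ * (‖σ‖ * ‖τ‖)) ≤ δ * (s / w) *
      ((inner ℂ (τ + conjVec τ) (act A σ)).re + (inner ℂ (σ + conjVec σ) (act B τ)).re) := by
    rw [inner_add_left, inner_add_left, Complex.add_re, Complex.add_re]
    have hsw : s / w ≤ 1 := (div_le_one hw).2 hws.le
    have p1 : 0 ≤ δ * (s / w) := by positivity
    have p2 : δ * (s / w) ≤ δ := mul_le_of_le_one_right hδ.le hsw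
    calc -(4 * δ * Λ * (‖σ‖ * ‖τ‖)) ≤ -(δ * (s / w) * (4 * Λ * (‖σ‖ * ‖τ‖))) := by
          rw [neg_le_neg_iff, show 4 * δ * Λ * (‖σ‖ * ‖τ‖) = δ * (4 * Λ * (‖σ‖ * ‖τ‖)) by ring]
          gcongr
      _ = δ * (s / w) * (-(4 * Λ * (‖σ‖ * ‖τ‖))) := by ring
      _ ≤ _ := by
          refine mul_le_mul_of_nonneg_left ?_ p1
          linarith
  have split1 : (inner ℂ (((x + 2 * δ * K + (f' - x) / 2 : ℝ) : ℂ) • σ +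
      (((f' - x) / 2 : ℝ) : ℂ) • conjVec σ) (act A σ)).re =
      (inner ℂ ((((f' + x) / 2 : ℝ) : ℂ) • σ + (((f' - x) / 2 : ℝ) : ℂ) • conjVec σ)
        (act A σ)).re + 2 * δ * K * (inner ℂ σ (act A σ)).re := by
    simp only [inner_add_left, inner_smul_left, Complex.conj_ofReal, Complex.add_re,
      Complex.re_ofReal_mul]
    ring
  have split2 : (inner ℂ (((w / t + δ * s ^ 2 / (t * w) +
        (g' - w / t - δ * s ^ 2 * (g' / w ^ 2 + 1 / (t * w))) / 2 : ℝ) : ℂ) • τ +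
      (((g' - w / t - δ * s ^ 2 * (g' / w ^ 2 + 1 / (t * w))) / 2 : ℝ) : ℂ) • conjVec τ)
        (act B τ)).re =
      (inner ℂ ((((g' + w / t) / 2 : ℝ) : ℂ) • τ + (((g' - w / t) / 2 : ℝ) : ℂ) • conjVec τ)
        (act B τ)).re +
      (inner ℂ ((((y - z) / 2 : ℝ) : ℂ) • τ + ((-(y + z) / 2 : ℝ) : ℂ) • conjVec τ)
        (act B τ)).re := by
    simp only [inner_add_left, inner_smul_left, Complex.conj_ofReal, Complex.add_re,
      Complex.re_ofReal_mul, hy, hz]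
    ring
  rw [split1, split2]
  -- The `Φ`-part of the `A`-block is simply discarded.
  have u1 : 0 ≤ (f' + x) / 2 * (ΔA * ‖σ‖ ^ 2) := by positivity
  have u2 : 2 * δ * (M / (M - 1) * (t / w)) * (lamA * ‖σ‖ ^ 2) ≤
      2 * δ * K * (inner ℂ σ (act A σ)).re := by
    have : M / (M - 1) * (t / w) ≤ K := by
      rw [div_mul_eq_mul_div, div_le_iff₀ hM1]
      linarith
    gcongr
  have u3 : (w / t) / 2 * (ΔB * ‖τ‖ ^ 2) ≤ (g' + w / t) / 2 * (ΔB * ‖τ‖ ^ 2) := by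
    gcongr
    linarith
  have hR : 1 ≤ M / (M - 1) := by
    rw [one_le_div hM1]
    linarith
  have u4 := outer_scalar_bound hδ hR hlamA hΔB hd2 hκ (div_pos ht hw) (norm_nonneg σ)
    (norm_nonneg τ)
  rw [inv_div] at u4
  linarith

end YoungPair

/-- The Bellman function in terms of `s = |u|`, `t = |v|`. -/
def radialBellman (Φ Ψ : ℝ → ℝ) (δ s t : ℝ) : ℝ :=
  if t ≤ D1 Φ s then (1 + δ) * (Φ s + Ψ t) + δ * s ^ 2 * intLeft Φ s
  else Φ s + Ψ t + δ * s ^ 2 * intRight Ψ t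

lemma bellman_eq (Φ Ψ : ℝ → ℝ) (δ : ℝ) (q : ℂ × ℂ) :
    bellman Φ Ψ δ q = radialBellman Φ Ψ δ ‖q.1‖ ‖q.2‖ := rfl

/-! ### Derivatives and size of the radial profile. -/

namespace YoungPair

variable {Φ Ψ : ℝ → ℝ} (h : YoungPair Φ Ψ) {δ s t : ℝ}
include h

lemma lt_D1_left_iff (hs : 0 ≤ s) (ht : 0 ≤ t) : D1 Φ s < t ↔ s < D1 Ψ t := by
  rw [← not_le, ← not_le, h.le_D1_left_iff hs ht]

lemma eventually_inner_left (hs : 0 < s) (hst : t < D1 Φ s) :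
    ∀ᶠ x in 𝓝 s, 0 < x ∧ t < D1 Φ x :=
  (eventually_gt_nhds hs).and
    ((hasDerivAt_D1 h.c2_left hs).continuousAt.eventually (lt_mem_nhds hst))

lemma eventually_outer_left (hs : 0 < s) (hst : D1 Φ s < t) :
    ∀ᶠ x in 𝓝 s, 0 < x ∧ D1 Φ x < t :=
  (eventually_gt_nhds hs).and
    ((hasDerivAt_D1 h.c2_left hs).continuousAt.eventually (gt_mem_nhds hst))

omit h in
lemma eventually_inner_right (ht : 0 < t) (hst : t < D1 Φ s) :
    ∀ᶠ x in 𝓝 t, 0 < x ∧ x < D1 Φ s :=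
  (eventually_gt_nhds ht).and (eventually_lt_nhds hst)

omit h in
lemma eventually_outer_right (ht : 0 < t) (hst : D1 Φ s < t) :
    ∀ᶠ x in 𝓝 t, 0 < x ∧ D1 Φ s < x :=
  (eventually_gt_nhds ht).and (eventually_gt_nhds hst)

/-- On the inner side `intRight_D1` rewrites the derivative with `intRight` at `Φ'(s)`, so the `max`
in `coefU` unites the two branches. -/
lemma hasDerivAt_radialBellman_left (hs : 0 < s) (hst : t ≠ D1 Φ s) :
    HasDerivAt (fun x => radialBellman Φ Ψ δ x t) (s * coefU Φ Ψ δ s t) s := by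
  have hΦ := hasDerivAt_of_c1 h.c1_left hs
  have hsq : HasDerivAt (fun x : ℝ => δ * x ^ 2) (δ * (2 * s)) s := by
    simpa using (hasDerivAt_pow 2 s).const_mul δ
  rcases hst.lt_or_gt with hst | hst
  · have hd := ((hΦ.add_const (Ψ t)).const_mul (1 + δ)).add (hsq.mul (h.hasDerivAt_intLeft hs))
    refine (hd.congr_of_eventuallyEq ?_).congr_deriv ?_
    · filter_upwards [h.eventually_inner_left hs hst] with x hx
      simp only [radialBellman, if_pos hx.2.le, Pi.add_apply, Pi.mul_apply]
    · rw [coefU, max_eq_right hst.le, h.intRight_D1 hs.le]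
      field_simp
      ring
  · have hd := (hΦ.add_const (Ψ t)).add (hsq.mul_const (intRight Ψ t))
    refine (hd.congr_of_eventuallyEq ?_).congr_deriv ?_
    · filter_upwards [h.eventually_outer_left hs hst] with x hx
      simp only [radialBellman, if_neg hx.2.not_ge, Pi.add_apply]
    · rw [coefU, max_eq_left hst.le]
      field_simp

lemma hasDerivAt_radialBellman_right (hs : 0 < s) (ht : 0 < t) (hst : t ≠ D1 Φ s) :
    HasDerivAt (fun x => radialBellman Φ Ψ δ s x) (t * coefV Ψ δ s t) t := by
  have hΨ := hasDerivAt_of_c1 h.c1_right ht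
  have hg := h.D1_right_pos ht
  rcases hst.lt_or_gt with hst | hst
  · have hd := ((hΨ.const_add (Φ s)).const_mul (1 + δ)).add_const (δ * s ^ 2 * intLeft Φ s)
    refine (hd.congr_of_eventuallyEq ?_).congr_deriv ?_
    · filter_upwards [eventually_inner_right ht hst] with x hx
      simp only [radialBellman, if_pos hx.2.le]
    · rw [coefV, min_eq_right ((h.le_D1_left_iff hs.le ht.le).1 hst.le)]
      field_simp
  · have hd := (hΨ.const_add (Φ s)).add ((h.hasDerivAt_intRight ht).const_mul (δ * s ^ 2))
    refine (hd.congr_of_eventuallyEq ?_).congr_deriv ?_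
    · filter_upwards [eventually_outer_right ht hst] with x hx
      simp only [radialBellman, if_neg hx.2.not_ge, Pi.add_apply]
    · rw [coefV, min_eq_left ((h.lt_D1_left_iff hs.le ht.le).1 hst).le]
      field_simp

lemma hasDerivAt_coefU_left (hs : 0 < s) (hst : t ≠ D1 Φ s) :
    HasDerivAt (fun x => coefU Φ Ψ δ x t) (s * coefUU Φ δ s t) s := by
  have hh := h.hasDerivAt_D1_div hs
  rcases hst.lt_or_gt with hst | hst
  · have hd := hh.add ((hh.add (h.hasDerivAt_intLeft hs)).const_mul (2 * δ))
    refine (hd.congr_of_eventuallyEq ?_).congr_deriv ?_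
    · filter_upwards [h.eventually_inner_left hs hst] with x hx
      simp only [coefU, max_eq_right hx.2.le, h.intRight_D1 hx.1.le, Pi.add_apply]
    · rw [coefUU, if_pos hst.le, D2_eq_deriv hs]
      field_simp
      ring
  · have hd := hh.add_const (2 * δ * intRight Ψ t)
    refine (hd.congr_of_eventuallyEq ?_).congr_deriv ?_
    · filter_upwards [h.eventually_outer_left hs hst] with x hx
      simp only [coefU, max_eq_left hx.2.le]
    · rw [coefUU, if_neg hst.not_ge, D2_eq_deriv hs]
      field_simp
      ring

lemma hasDerivAt_coefU_right (ht : 0 < t) (hst : t ≠ D1 Φ s) :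
    HasDerivAt (fun x => coefU Φ Ψ δ s x) (t * coefUV Φ Ψ δ s t) t := by
  have hg := h.D1_right_pos ht
  rcases hst.lt_or_gt with hst | hst
  · refine ((hasDerivAt_const t (coefU Φ Ψ δ s t)).congr_of_eventuallyEq ?_).congr_deriv ?_
    · filter_upwards [eventually_inner_right ht hst] with x hx
      simp only [coefU, max_eq_right hx.2.le, max_eq_right hst.le]
    · rw [coefUV, if_pos hst.le, mul_zero]
  · have hd := ((h.hasDerivAt_intRight ht).const_mul (2 * δ)).const_add (D1 Φ s / s)
    refine (hd.congr_of_eventuallyEq ?_).congr_deriv ?_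
    · filter_upwards [eventually_outer_right ht hst] with x hx
      simp only [coefU, max_eq_left hx.2.le]
    · rw [coefUV, if_neg hst.not_ge]
      field_simp

lemma hasDerivAt_coefV_left (hs : 0 < s) (ht : 0 < t) (hst : t ≠ D1 Φ s) :
    HasDerivAt (fun x => coefV Ψ δ x t) (s * coefUV Φ Ψ δ s t) s := by
  have hg := h.D1_right_pos ht
  rcases hst.lt_or_gt with hst | hst
  · refine ((hasDerivAt_const s (coefV Ψ δ s t)).congr_of_eventuallyEq ?_).congr_deriv ?_
    · filter_upwards [h.eventually_inner_left hs hst] with x hx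
      simp only [coefV, min_eq_right ((h.le_D1_left_iff hx.1.le ht.le).1 hx.2.le),
        min_eq_right ((h.le_D1_left_iff hs.le ht.le).1 hst.le)]
    · rw [coefUV, if_pos hst.le, mul_zero]
  · have hsq : HasDerivAt (fun x : ℝ => δ * x ^ 2) (δ * (2 * s)) s := by
      simpa using (hasDerivAt_pow 2 s).const_mul δ
    have hd := ((hsq.div_const (D1 Ψ t)).const_add (D1 Ψ t)).div_const t
    refine (hd.congr_of_eventuallyEq ?_).congr_deriv ?_
    · filter_upwards [h.eventually_outer_left hs hst] with x hx
      simp only [coefV, min_eq_left ((h.lt_D1_left_iff hx.1.le ht.le).1 hx.2).le]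
    · rw [coefUV, if_neg hst.not_ge]
      field_simp

lemma hasDerivAt_coefV_right (hs : 0 < s) (ht : 0 < t) (hst : t ≠ D1 Φ s) :
    HasDerivAt (fun x => coefV Ψ δ s x) (t * coefVV Φ Ψ δ s t) t := by
  have hg := h.D1_right_pos ht
  have hd1 := hasDerivAt_D1 h.c2_right ht
  rcases hst.lt_or_gt with hst | hst
  · have hd := (hd1.div (hasDerivAt_id t) ht.ne').const_mul (1 + δ)
    refine (hd.congr_of_eventuallyEq ?_).congr_deriv ?_
    · filter_upwards [eventually_inner_right ht hst] with x hx
      have := h.D1_right_pos hx.1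
      simp only [coefV, min_eq_right ((h.le_D1_left_iff hs.le hx.1.le).1 hx.2.le), Pi.div_apply, id]
      field_simp
    · rw [coefVV, if_pos hst.le, D2_eq_deriv ht]
      simp only [id]
      field_simp
  · have hd := (hd1.add ((hasDerivAt_const t (δ * s ^ 2)).div hd1 hg.ne')).div
      (hasDerivAt_id t) ht.ne'
    refine (hd.congr_of_eventuallyEq ?_).congr_deriv ?_
    · filter_upwards [eventually_outer_right ht hst] with x hx
      simp only [coefV, min_eq_left ((h.lt_D1_left_iff hs.le hx.1.le).1 hx.2).le, Pi.div_apply,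
        Pi.add_apply, id]
    · rw [coefVV, if_neg hst.not_ge, D2_eq_deriv ht]
      simp only [id, Pi.add_apply, Pi.div_apply]
      field_simp
      ring

/-! Size estimates; `8 δ m̃ ≤ m̃ - 1` is all that is needed of `δ`. -/

lemma mul_intRight_le (hδ : 0 ≤ δ) (hδm : 8 * (δ * tildeSmallM Φ) ≤ tildeSmallM Φ - 1)
    (ht : 0 ≤ t) : 8 * δ * intRight Ψ t ≤ t / D1 Ψ t := by
  have h1 := h.intRight_le ht
  have h2 := h.one_lt_tildeSmallM
  have h3 : 0 ≤ t / D1 Ψ t := div_nonneg ht (h.D1_right_nonneg ht)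
  have h4 : 8 * (δ * tildeSmallM Φ) * (t / D1 Ψ t) ≤ (tildeSmallM Φ - 1) * (t / D1 Ψ t) := by gcongr
  have h5 : 8 * δ * ((tildeSmallM Φ - 1) * intRight Ψ t) ≤
      8 * δ * (tildeSmallM Φ * (t / D1 Ψ t)) := by gcongr
  have h6 : 0 < tildeSmallM Φ - 1 := by linarith
  rw [← mul_le_mul_iff_right₀ h6]
  linarith

lemma delta_le (hδm : 8 * (δ * tildeSmallM Φ) ≤ tildeSmallM Φ - 1) : δ ≤ 1 / 8 := by
  have h2 := h.one_lt_tildeSmallM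
  by_contra! hlt
  have : 8 * ((1 / 8) * tildeSmallM Φ) < 8 * (δ * tildeSmallM Φ) := by gcongr
  linarith

lemma coefU_nonneg (hδ : 0 ≤ δ) (hs : 0 ≤ s) (ht : 0 ≤ t) : 0 ≤ coefU Φ Ψ δ s t := by
  have h1 := h.D1_div_nonneg hs
  have h2 := h.intRight_nonneg (ht.trans (le_max_left t (D1 Φ s)))
  rw [coefU]
  positivity

lemma coefV_nonneg (hδ : 0 ≤ δ) (ht : 0 ≤ t) : 0 ≤ coefV Ψ δ s t := by
  have h1 := h.D1_right_nonneg ht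
  rw [coefV]
  positivity

/-- With `T = max t (Φ'(s))` one has `s ≤ Ψ'(T)`, so `8 δ s · intRight Ψ T ≤ s T / Ψ'(T) ≤ T`. -/
lemma mul_coefU_le (hδ : 0 ≤ δ) (hδm : 8 * (δ * tildeSmallM Φ) ≤ tildeSmallM Φ - 1)
    (hs : 0 ≤ s) (ht : 0 ≤ t) : s * coefU Φ Ψ δ s t ≤ 2 * max (D1 Φ s) t := by
  rcases hs.eq_or_lt with rfl | hs
  · rw [zero_mul]
    have := le_max_right (D1 Φ 0) t
    linarith
  have hf := h.D1_left_pos hs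
  set T := max t (D1 Φ s) with hT
  have hT0 : 0 < T := hf.trans_le (le_max_right _ _)
  have h1 := h.mul_intRight_le hδ hδm hT0.le
  have hg := h.D1_right_pos hT0
  have h2 : s ≤ D1 Ψ T := by
    rw [← h.D1_right_left hs.le]
    exact h.strictMonoOn_D1_right.monotoneOn hf.le hT0.le (le_max_right _ _)
  have h3 : s * (T / D1 Ψ T) ≤ T := by
    rw [← mul_div_assoc, div_le_iff₀ hg, mul_comm]
    gcongr
  have h4 : s * (8 * δ * intRight Ψ T) ≤ s * (T / D1 Ψ T) := by gcongr
  have h5 : D1 Φ s ≤ T := le_max_right _ _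
  rw [coefU, ← hT, mul_add, mul_div_cancel₀ _ hs.ne', max_comm (D1 Φ s) t, ← hT]
  linarith

lemma mul_coefV_le (hδ : 0 ≤ δ) (hs : 0 ≤ s) (ht : 0 ≤ t) :
    t * coefV Ψ δ s t ≤ (1 + δ) * D1 Ψ t := by
  rcases ht.eq_or_lt with rfl | ht
  · have := h.D1_right_zero
    simp [this]
  have hg := h.D1_right_pos ht
  rw [coefV, mul_div_cancel₀ _ ht.ne']
  have h1 : (min s (D1 Ψ t)) ^ 2 ≤ D1 Ψ t ^ 2 := by
    have : 0 ≤ min s (D1 Ψ t) := le_min hs hg.le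
    gcongr
    exact min_le_right _ _
  have h2 : δ * (min s (D1 Ψ t)) ^ 2 / D1 Ψ t ≤ δ * D1 Ψ t := by
    rw [div_le_iff₀ hg]
    nlinarith
  linarith

lemma radialBellman_nonneg (hδ : 0 ≤ δ) (hs : 0 ≤ s) (ht : 0 ≤ t) :
    0 ≤ radialBellman Φ Ψ δ s t := by
  have h1 := h.young_left.nonneg s hs
  have h2 := h.young_right.nonneg t ht
  have h3 := h.intLeft_nonneg hs
  have h4 := h.intRight_nonneg ht
  rw [radialBellman]
  split_ifs <;> positivity

lemma sq_mul_intLeft_le (hδ : 0 ≤ δ) (hδm : 8 * (δ * tildeSmallM Φ) ≤ tildeSmallM Φ - 1)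
    (hs : 0 ≤ s) : 8 * (δ * s ^ 2 * intLeft Φ s) ≤ bigM Φ / tildeSmallM Φ * Φ s := by
  rcases hs.eq_or_lt with rfl | hs
  · simp [h.young_left.zero]
  have hm := h.one_lt_tildeSmallM
  have h1 := h.intLeft_le hs.le
  have h2 := h.mul_D1_le_bigM_mul hs
  have h3 := h.intLeft_nonneg hs.le
  rw [div_mul_eq_mul_div, le_div_iff₀ (by linarith)]
  refine le_trans ?_ h2
  have h4 : 8 * (δ * tildeSmallM Φ) * (s ^ 2 * intLeft Φ s) ≤
      (tildeSmallM Φ - 1) * (s ^ 2 * intLeft Φ s) := by gcongr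
  have h5 : s ^ 2 * ((tildeSmallM Φ - 1) * intLeft Φ s) ≤ s ^ 2 * (D1 Φ s / s) := by gcongr
  have h6 : s ^ 2 * (D1 Φ s / s) = s * D1 Φ s := by field_simp
  have h7 : 0 ≤ δ * tildeSmallM Φ * (s ^ 2 * intLeft Φ s) := by positivity
  linarith

/-- In the outer region `s < Ψ'(t)` bounds the extra term by a multiple of `s t`, which Young's
inequality absorbs; in the inner region `s Φ' ≤ M Φ` is used. -/
lemma radialBellman_le (hδ : 0 ≤ δ) (hδm : 8 * (δ * tildeSmallM Φ) ≤ tildeSmallM Φ - 1)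
    (hs : 0 ≤ s) (ht : 0 ≤ t) : radialBellman Φ Ψ δ s t ≤
      2 * max 1 (bigM Φ / tildeSmallM Φ) * (Φ s + Ψ t) := by
  have hd := h.delta_le hδm
  have h1 := h.young_left.nonneg s hs
  have h2 := h.young_right.nonneg t ht
  have hm1 := le_max_left 1 (bigM Φ / tildeSmallM Φ)
  have hm2 := le_max_right 1 (bigM Φ / tildeSmallM Φ)
  set m := max 1 (bigM Φ / tildeSmallM Φ)
  have p1 : 1 * (Φ s + Ψ t) ≤ m * (Φ s + Ψ t) := by gcongr
  rw [radialBellman]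
  split_ifs with hst
  · have q1 := h.sq_mul_intLeft_le hδ hδm hs
    have q2 : bigM Φ / tildeSmallM Φ * Φ s ≤ m * Φ s := by gcongr
    have q3 : 0 ≤ m * Ψ t := by positivity
    have q4 : δ * (Φ s + Ψ t) ≤ 1 / 8 * (Φ s + Ψ t) := by gcongr
    linarith
  · have hst := not_le.1 hst
    have hsg := (h.lt_D1_left_iff hs ht).1 hst
    have hg : 0 < D1 Ψ t := hs.trans_lt hsg
    have q1 := h.mul_intRight_le hδ hδm ht
    have q2 : s ^ 2 * (8 * δ * intRight Ψ t) ≤ s ^ 2 * (t / D1 Ψ t) := by gcongr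
    have q3 : s ^ 2 * (t / D1 Ψ t) ≤ s * t := by
      rw [← mul_div_assoc, div_le_iff₀ hg]
      have : s * (s * t) ≤ D1 Ψ t * (s * t) := by gcongr
      linarith
    have q4 := h.young_inequality hs ht
    linarith

end YoungPair

/-! ### Coordinate lines, the axes and the interface. -/

section Lines

/-- The real coordinates of `ℂ² = ℝ⁴`. -/
def coord (i : Fin 4) (q : ℂ × ℂ) : ℝ := ![q.1.re, q.1.im, q.2.re, q.2.im] i

lemma hasLineDerivAt_norm {u e : ℂ} (hu : u ≠ 0) :
    HasDerivAt (fun x : ℝ => ‖u + x • e‖) ((u.re * e.re + u.im * e.im) / ‖u‖) 0 := by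
  have h1 : HasDerivAt (fun x : ℝ => u + x • e) e 0 := by
    simpa using ((hasDerivAt_id (0 : ℝ)).smul_const e).const_add u
  have h2 := h1.norm_sq
  have h3 := h2.sqrt (by simpa using hu)
  simp only [Real.sqrt_sq (norm_nonneg _), zero_smul, add_zero, Complex.inner] at h3
  refine h3.congr_deriv ?_
  rw [mul_div_mul_left _ _ two_ne_zero]
  simp [mul_comm]

lemma add_smul_dir (q : ℂ × ℂ) (x : ℝ) :
    q + x • dir 0 = (q.1 + x • 1, q.2) ∧ q + x • dir 1 = (q.1 + x • Complex.I, q.2) ∧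
      q + x • dir 2 = (q.1, q.2 + x • 1) ∧ q + x • dir 3 = (q.1, q.2 + x • Complex.I) := by
  refine ⟨?_, ?_, ?_, ?_⟩ <;> ext <;> simp [dir]

lemma hasLineDerivAt_radial {G : ℝ → ℝ → ℝ} {q : ℂ × ℂ} {a b : ℝ} (h1 : q.1 ≠ 0) (h2 : q.2 ≠ 0)
    (ha : HasDerivAt (fun s => G s ‖q.2‖) (‖q.1‖ * a) ‖q.1‖)
    (hb : HasDerivAt (fun t => G ‖q.1‖ t) (‖q.2‖ * b) ‖q.2‖) (i : Fin 4) :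
    HasLineDerivAt ℝ (fun q : ℂ × ℂ => G ‖q.1‖ ‖q.2‖) (![a, a, b, b] i * coord i q) q (dir i) := by
  have key1 : ∀ e : ℂ, HasDerivAt (fun x : ℝ => G ‖q.1 + x • e‖ ‖q.2‖)
      (a * (q.1.re * e.re + q.1.im * e.im)) 0 := fun e => by
    have := HasDerivAt.comp (h₂ := fun s => G s ‖q.2‖) 0 (by simpa using ha)
      (hasLineDerivAt_norm (e := e) h1)
    refine this.congr_deriv ?_
    have := norm_pos_iff.2 h1
    field_simp
  have key2 : ∀ e : ℂ, HasDerivAt (fun x : ℝ => G ‖q.1‖ ‖q.2 + x • e‖)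
      (b * (q.2.re * e.re + q.2.im * e.im)) 0 := fun e => by
    have := HasDerivAt.comp (h₂ := fun t => G ‖q.1‖ t) 0 (by simpa using hb)
      (hasLineDerivAt_norm (e := e) h2)
    refine this.congr_deriv ?_
    have := norm_pos_iff.2 h2
    field_simp
  rw [HasLineDerivAt]
  match i with
  | 0 => simpa [add_smul_dir, coord] using key1 1
  | 1 => simpa [add_smul_dir, coord] using key1 Complex.I
  | 2 => simpa [add_smul_dir, coord] using key2 1
  | 3 => simpa [add_smul_dir, coord] using key2 Complex.I

lemma hasLineDerivAt_coord (i j : Fin 4) (q : ℂ × ℂ) :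
    HasLineDerivAt ℝ (coord j) (if i = j then 1 else 0) q (dir i) := by
  have h1 : ∀ x : ℝ, coord j (q + x • dir i) = coord j q + x * (if i = j then 1 else 0) := by
    intro x
    fin_cases i <;> fin_cases j <;> simp [coord, dir]
  rw [HasLineDerivAt]
  simp_rw [h1]
  refine (((hasDerivAt_id (0 : ℝ)).mul_const (if i = j then (1 : ℝ) else 0)).const_add
    (coord j q)).congr_deriv ?_
  rw [one_mul]

lemma ae_coord_ne_zero : ∀ᵐ q : ℂ × ℂ, ∀ i, coord i q ≠ 0 := by
  rw [ae_all_iff]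
  intro i
  let S : Submodule ℝ (ℂ × ℂ) :=
    { carrier := {q | coord i q = 0}
      add_mem' := fun {a b} ha hb => by
        have : coord i (a + b) = coord i a + coord i b := by fin_cases i <;> simp [coord]
        simp_all
      zero_mem' := by fin_cases i <;> simp [coord]
      smul_mem' := fun c a ha => by
        have : coord i (c • a) = c * coord i a := by fin_cases i <;> simp [coord]
        simp_all }
  have hS : S ≠ ⊤ := by
    intro hS
    have h1 : dir i ∈ S := hS ▸ Submodule.mem_top
    have h2 : coord i (dir i) = 0 := h1
    fin_cases i <;> simp [coord, dir] at h2
  have := Measure.addHaar_submodule volume S hS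
  rw [ae_iff]
  simpa [S] using this

/-- The set where neither coordinate vanishes. -/
def regular : Set (ℂ × ℂ) := {q | q.1 ≠ 0 ∧ q.2 ≠ 0}

/-- Moving one real coordinate leaves a nonzero real coordinate in each of the two complex
variables. -/
lemma line_mem_regular {q : ℂ × ℂ} (hq : ∀ i, coord i q ≠ 0) (i : Fin 4) (x : ℝ) :
    q + x • dir i ∈ regular := by
  have h0 : q.1.re ≠ 0 := hq 0
  have h1 : q.1.im ≠ 0 := hq 1
  have h2 : q.2.re ≠ 0 := hq 2
  have h3 : q.2.im ≠ 0 := hq 3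
  match i with
  | 0 =>
    rw [(add_smul_dir q x).1]
    exact ⟨fun h => h1 (by simpa using congrArg Complex.im h),
      fun h => h2 (by simpa using congrArg Complex.re h)⟩
  | 1 =>
    rw [(add_smul_dir q x).2.1]
    exact ⟨fun h => h0 (by simpa using congrArg Complex.re h),
      fun h => h2 (by simpa using congrArg Complex.re h)⟩
  | 2 =>
    rw [(add_smul_dir q x).2.2.1]
    exact ⟨fun h => h0 (by simpa using congrArg Complex.re h),
      fun h => h3 (by simpa using congrArg Complex.im h)⟩
  | 3 =>
    rw [(add_smul_dir q x).2.2.2]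
    exact ⟨fun h => h0 (by simpa using congrArg Complex.re h),
      fun h => h2 (by simpa using congrArg Complex.re h)⟩

/-- A line meets a circle in at most two points: completing the square gives `|x + a| = c`. -/
lemma countable_norm_add_smul_eq (u : ℂ) {e : ℂ} (he : ‖e‖ = 1) (r : ℝ) :
    {x : ℝ | ‖u + x • e‖ = r}.Countable := by
  have he2 : e.re ^ 2 + e.im ^ 2 = 1 := by
    rw [← Complex.normSq_add_mul_I, Complex.re_add_im, Complex.normSq_eq_norm_sq, he, one_pow]
  set a := u.re * e.re + u.im * e.im with ha
  set c := √(r ^ 2 - (u.re ^ 2 + u.im ^ 2) + a ^ 2) with hc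
  refine Set.Countable.mono (s₂ := {c - a, -c - a}) ?_ (Set.toFinite _).countable
  intro x hx
  have h1 : (u + x • e).re ^ 2 + (u + x • e).im ^ 2 = r ^ 2 := by
    rw [← Complex.normSq_add_mul_I, Complex.re_add_im, Complex.normSq_eq_norm_sq, hx]
  simp only [Complex.add_re, Complex.add_im, Complex.real_smul, Complex.re_ofReal_mul,
    Complex.im_ofReal_mul] at h1
  have h2 : (x + a) ^ 2 = r ^ 2 - (u.re ^ 2 + u.im ^ 2) + a ^ 2 := by
    rw [ha]
    linear_combination h1 - x ^ 2 * he2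
  have h3 : |x + a| = c := by rw [hc, ← h2, Real.sqrt_sq_eq_abs]
  rcases abs_choice (x + a) with h4 | h4
  · left
    linarith
  · right
    simp only [mem_singleton_iff]
    linarith

namespace YoungPair

variable {Φ Ψ : ℝ → ℝ} (h : YoungPair Φ Ψ)
include h

lemma countable_interface (q : ℂ × ℂ) (i : Fin 4) :
    {x : ℝ | ‖(q + x • dir i).2‖ = D1 Φ ‖(q + x • dir i).1‖}.Countable := by
  have key1 : ∀ e : ℂ, ‖e‖ = 1 → {x : ℝ | ‖q.2‖ = D1 Φ ‖q.1 + x • e‖}.Countable := fun e he => by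
    -- Inverting `Φ'` turns the interface into the circle `|u| = Ψ'(|v|)` when `v` is fixed.
    refine (countable_norm_add_smul_eq q.1 he (D1 Ψ ‖q.2‖)).mono fun x hx => ?_
    rw [mem_ofPred_eq] at hx ⊢
    rw [hx, h.D1_right_left (norm_nonneg _)]
  have key2 : ∀ e : ℂ, ‖e‖ = 1 → {x : ℝ | ‖q.2 + x • e‖ = D1 Φ ‖q.1‖}.Countable := fun e he =>
    countable_norm_add_smul_eq q.2 he _
  match i with
  | 0 => simpa only [add_smul_dir] using key1 1 (by simp)
  | 1 => simpa only [add_smul_dir] using key1 Complex.I (by simp)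
  | 2 => simpa only [add_smul_dir] using key2 1 (by simp)
  | 3 => simpa only [add_smul_dir] using key2 Complex.I (by simp)

/-- Along a generic line `F` is continuous and differentiable off a countable set, and `W` bounds
the derivative locally; this suffices for the fundamental theorem of calculus. -/
lemma hasIntegralLineDeriv_of_regular {F F' W : ℂ × ℂ → ℝ} (i : Fin 4)
    (hF : ContinuousOn F regular) (hm : Measurable F') (hW : ContinuousOn W regular)
    (hb : ∀ q ∈ regular, |F' q| ≤ W q)
    (hd : ∀ q ∈ regular, ‖q.2‖ ≠ D1 Φ ‖q.1‖ → HasLineDerivAt ℝ F (F' q) q (dir i)) :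
    HasIntegralLineDeriv F F' (dir i) := by
  filter_upwards [ae_coord_ne_zero] with p hp b
  have hline : Continuous fun x : ℝ => p + x • dir i := by fun_prop
  have hmem := fun x => line_mem_regular hp i x
  have hint : IntervalIntegrable (fun x => F' (p + x • dir i)) volume 0 b := by
    have hWi : IntervalIntegrable (fun x => W (p + x • dir i)) volume 0 b :=
      (hW.comp_continuous hline hmem).intervalIntegrable _ _
    refine hWi.mono_fun (hm.comp hline.measurable).aestronglyMeasurable
      (Eventually.of_forall fun x => ?_)
    exact (hb _ (hmem x)).trans (le_abs_self _)
  have := integral_eq_of_hasDerivAt_off_countable (fun x => F (p + x • dir i))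
    (fun x => F' (p + x • dir i)) (h.countable_interface p i)
    (hF.comp_continuous hline hmem).continuousOn (fun x hx => ?_) hint
  · rw [this]
    simp
  · have h1 : HasDerivAt (fun t : ℝ => F (p + x • dir i + t • dir i)) (F' (p + x • dir i)) (x - x) := by
      rw [sub_self]
      exact hd _ (hmem x) hx.2
    have h2 := h1.comp_sub_const x x
    refine h2.congr_of_eventuallyEq (Eventually.of_forall fun y => ?_)
    simp only
    rw [add_assoc, ← add_smul, add_sub_cancel]

end YoungPair

end Lines

/-! ### Regularity, bounds and line derivatives of the Bellman function and its gradient. -/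

section Gradient

/-- The gradient of the Bellman function. -/
def bellmanGrad (Φ Ψ : ℝ → ℝ) (δ : ℝ) (i : Fin 4) (q : ℂ × ℂ) : ℝ :=
  (if i < 2 then coefU Φ Ψ δ ‖q.1‖ ‖q.2‖ else coefV Ψ δ ‖q.1‖ ‖q.2‖) * coord i q

/-- A bound for the entries of the Hessian of the Bellman function. -/
def hessBound (Φ Ψ : ℝ → ℝ) (δ : ℝ) (q : ℂ × ℂ) : ℝ :=
  (1 + tildeBigM Φ + 2 * δ * tildeBigM Φ) * (D1 Φ ‖q.1‖ / ‖q.1‖) +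
    2 * δ * intRight Ψ (max ‖q.2‖ (D1 Φ ‖q.1‖)) + 2 * δ + (2 + 3 * δ) * (D1 Ψ ‖q.2‖ * ‖q.2‖⁻¹)

lemma continuous_coord (i : Fin 4) : Continuous (coord i) := by
  match i with
  | 0 => exact Complex.continuous_re.comp continuous_fst
  | 1 => exact Complex.continuous_im.comp continuous_fst
  | 2 => exact Complex.continuous_re.comp continuous_snd
  | 3 => exact Complex.continuous_im.comp continuous_snd

lemma abs_radialHess_le (P p m Q r : ℝ) (u v : ℂ) (i j : Fin 4) :
    |radialHess P p m Q r u v i j| ≤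
      |P| + |p| * ‖u‖ ^ 2 + |m| * (‖u‖ * ‖v‖) + (|Q| + |r| * ‖v‖ ^ 2) := by
  have aux : ∀ a x y S T : ℝ, |x| ≤ S → |y| ≤ T → |a * x * y| ≤ |a| * (S * T) := by
    intro a x y S T hx hy
    rw [mul_assoc, abs_mul, abs_mul]
    have := abs_nonneg x
    gcongr
    exact this.trans hx
  have aux2 : ∀ b a x y S T : ℝ, |x| ≤ S → |y| ≤ T → |b + a * x * y| ≤ |b| + |a| * (S * T) :=
    fun b a x y S T hx hy => (abs_add_le _ _).trans (by gcongr; exact aux a x y S T hx hy)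
  have hP := abs_nonneg P
  have hQ := abs_nonneg Q
  have hp : 0 ≤ |p| * (‖u‖ * ‖u‖) := by positivity
  have hm : 0 ≤ |m| * (‖u‖ * ‖v‖) := by positivity
  have hr : 0 ≤ |r| * (‖v‖ * ‖v‖) := by positivity
  have a1 := Complex.abs_re_le_norm u
  have a2 := Complex.abs_im_le_norm u
  have b1 := Complex.abs_re_le_norm v
  have b2 := Complex.abs_im_le_norm v
  rw [sq, sq]
  have auxm : ∀ x y, |x| ≤ ‖v‖ → |y| ≤ ‖u‖ → |m * x * y| ≤ |m| * (‖u‖ * ‖v‖) :=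
    fun x y hx hy => by
      rw [mul_comm ‖u‖]
      exact aux m x y _ _ hx hy
  match i, j with
  | 0, 0 => exact (aux2 P p _ _ _ _ a1 a1).trans (by linarith)
  | 0, 1 => exact (aux p _ _ _ _ a1 a2).trans (by linarith)
  | 0, 2 => exact (aux m _ _ _ _ a1 b1).trans (by linarith)
  | 0, 3 => exact (aux m _ _ _ _ a1 b2).trans (by linarith)
  | 1, 0 => exact (aux p _ _ _ _ a2 a1).trans (by linarith)
  | 1, 1 => exact (aux2 P p _ _ _ _ a2 a2).trans (by linarith)
  | 1, 2 => exact (aux m _ _ _ _ a2 b1).trans (by linarith)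
  | 1, 3 => exact (aux m _ _ _ _ a2 b2).trans (by linarith)
  | 2, 0 => exact (auxm _ _ b1 a1).trans (by linarith)
  | 2, 1 => exact (auxm _ _ b1 a2).trans (by linarith)
  | 2, 2 => exact (aux2 Q r _ _ _ _ b1 b1).trans (by linarith)
  | 2, 3 => exact (aux r _ _ _ _ b1 b2).trans (by linarith)
  | 3, 0 => exact (auxm _ _ b2 a1).trans (by linarith)
  | 3, 1 => exact (auxm _ _ b2 a2).trans (by linarith)
  | 3, 2 => exact (aux r _ _ _ _ b2 b1).trans (by linarith)
  | 3, 3 => exact (aux2 Q r _ _ _ _ b2 b2).trans (by linarith)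

lemma measurable_radialHess {P p m Q r : ℂ × ℂ → ℝ} (hP : Measurable P) (hp : Measurable p)
    (hm : Measurable m) (hQ : Measurable Q) (hr : Measurable r) (i j : Fin 4) :
    Measurable fun q : ℂ × ℂ => radialHess (P q) (p q) (m q) (Q q) (r q) q.1 q.2 i j := by
  have a1 := (continuous_coord 0).measurable
  have a2 := (continuous_coord 1).measurable
  have b1 := (continuous_coord 2).measurable
  have b2 := (continuous_coord 3).measurable
  match i, j with
  | 0, 0 => exact hP.add ((hp.mul a1).mul a1)
  | 0, 1 => exact (hp.mul a1).mul a2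
  | 0, 2 => exact (hm.mul a1).mul b1
  | 0, 3 => exact (hm.mul a1).mul b2
  | 1, 0 => exact (hp.mul a2).mul a1
  | 1, 1 => exact hP.add ((hp.mul a2).mul a2)
  | 1, 2 => exact (hm.mul a2).mul b1
  | 1, 3 => exact (hm.mul a2).mul b2
  | 2, 0 => exact (hm.mul b1).mul a1
  | 2, 1 => exact (hm.mul b1).mul a2
  | 2, 2 => exact hQ.add ((hr.mul b1).mul b1)
  | 2, 3 => exact (hr.mul b1).mul b2
  | 3, 0 => exact (hm.mul b2).mul a1
  | 3, 1 => exact (hm.mul b2).mul a2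
  | 3, 2 => exact (hr.mul b2).mul b1
  | 3, 3 => exact hQ.add ((hr.mul b2).mul b2)

lemma radialHess_eq (P p m Q r : ℝ) (q : ℂ × ℂ) (i j : Fin 4) :
    radialHess P p m Q r q.1 q.2 i j =
      (if j < 2 then ![p, p, m, m] i * coord i q else ![m, m, r, r] i * coord i q) * coord j q +
        (if j < 2 then P else Q) * (if i = j then 1 else 0) := by
  match i, j with
  | 0, 0 | 0, 1 | 0, 2 | 0, 3 | 1, 0 | 1, 1 | 1, 2 | 1, 3
  | 2, 0 | 2, 1 | 2, 2 | 2, 3 | 3, 0 | 3, 1 | 3, 2 | 3, 3 =>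
    simp [radialHess, coord] <;> ring

namespace YoungPair

variable {Φ Ψ : ℝ → ℝ} (h : YoungPair Φ Ψ) {δ : ℝ}
include h

lemma continuous_D1_norm_fst : Continuous fun q : ℂ × ℂ => D1 Φ ‖q.1‖ :=
  (continuousOn_D1 h.c1_left).comp_continuous (by fun_prop) fun q => norm_nonneg q.1

lemma continuous_D1_norm_snd : Continuous fun q : ℂ × ℂ => D1 Ψ ‖q.2‖ :=
  (continuousOn_D1 h.c1_right).comp_continuous (by fun_prop) fun q => norm_nonneg q.2

lemma continuous_D1_div_norm_fst : Continuous fun q : ℂ × ℂ => D1 Φ ‖q.1‖ / ‖q.1‖ :=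
  h.continuousOn_D1_div.comp_continuous (f := fun q : ℂ × ℂ => ‖q.1‖) (by fun_prop)
    fun q => norm_nonneg q.1

lemma continuous_intRight_max :
    Continuous fun q : ℂ × ℂ => intRight Ψ (max ‖q.2‖ (D1 Φ ‖q.1‖)) :=
  h.continuousOn_intRight.comp_continuous
    ((continuous_norm.comp continuous_snd).max h.continuous_D1_norm_fst)
    fun q => (norm_nonneg q.2).trans (le_max_left _ _)

lemma continuous_coefU : Continuous fun q : ℂ × ℂ => coefU Φ Ψ δ ‖q.1‖ ‖q.2‖ :=
  h.continuous_D1_div_norm_fst.add (h.continuous_intRight_max.const_mul _)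

lemma measurable_coefV : Measurable fun q : ℂ × ℂ => coefV Ψ δ ‖q.1‖ ‖q.2‖ := by
  have h1 := h.continuous_D1_norm_snd.measurable
  have h2 : Measurable fun q : ℂ × ℂ => ‖q.1‖ := by fun_prop
  have h3 : Measurable fun q : ℂ × ℂ => ‖q.2‖ := by fun_prop
  exact (h1.add ((((h2.min h1).pow_const 2).const_mul δ).div h1)).div h3

lemma continuousOn_coefV : ContinuousOn (fun q : ℂ × ℂ => coefV Ψ δ ‖q.1‖ ‖q.2‖) regular := by
  have h1 := h.continuous_D1_norm_snd
  have h2 : Continuous fun q : ℂ × ℂ => ‖q.1‖ := by fun_prop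
  have h3 : Continuous fun q : ℂ × ℂ => ‖q.2‖ := by fun_prop
  refine (h1.continuousOn.add ((((h2.min h1).pow 2).const_mul δ).continuousOn.div h1.continuousOn
    fun q hq => (h.D1_right_pos (norm_pos_iff.2 hq.2)).ne')).div h3.continuousOn
    fun q hq => norm_ne_zero_iff.2 hq.2

lemma measurableSet_inner : MeasurableSet {q : ℂ × ℂ | ‖q.2‖ ≤ D1 Φ ‖q.1‖} :=
  measurableSet_le (by fun_prop) h.continuous_D1_norm_fst.measurable

lemma measurable_bellmanHess (i j : Fin 4) :
    Measurable fun q => bellmanHess Φ Ψ δ q i j := by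
  have h1 := h.continuous_D1_norm_snd.measurable
  have h2 : Measurable fun q : ℂ × ℂ => ‖q.1‖ := by fun_prop
  have h3 : Measurable fun q : ℂ × ℂ => ‖q.2‖ := by fun_prop
  have h4 := h.continuous_D1_norm_fst.measurable
  -- The coefficients use `deriv` in place of `D2` so that `measurable_deriv` applies.
  have h5 : Measurable fun q : ℂ × ℂ => deriv (D1 Φ) ‖q.1‖ := (measurable_deriv _).comp h2
  have h6 : Measurable fun q : ℂ × ℂ => deriv (D1 Ψ) ‖q.2‖ := (measurable_deriv _).comp h3
  refine measurable_radialHess h.continuous_coefU.measurable ?_ ?_ h.measurable_coefV ?_ i j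
  · exact ((h5.sub (h4.div h2)).add (Measurable.ite h.measurableSet_inner (h5.const_mul _)
      measurable_const)).div (h2.pow_const 2)
  · exact Measurable.ite h.measurableSet_inner measurable_const ((h3.mul h1).const_div _)
  · refine ((h6.sub (h1.div h3)).add (Measurable.ite h.measurableSet_inner
      ((h6.sub (h1.div h3)).const_mul _) ?_)).div (h3.pow_const 2)
    exact (((h2.pow_const 2).const_mul δ).mul
      ((h6.div (h1.pow_const 2)).add ((h3.mul h1).const_div 1))).neg

lemma measurable_bellmanGrad (i : Fin 4) : Measurable (bellmanGrad Φ Ψ δ i) := by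
  refine Measurable.mul ?_ (continuous_coord i).measurable
  split_ifs
  · exact h.continuous_coefU.measurable
  · exact h.measurable_coefV

lemma continuousOn_bellmanGrad (i : Fin 4) : ContinuousOn (bellmanGrad Φ Ψ δ i) regular := by
  refine ContinuousOn.mul ?_ (continuous_coord i).continuousOn
  split_ifs
  · exact h.continuous_coefU.continuousOn
  · exact h.continuousOn_coefV

lemma continuous_left_norm : Continuous fun q : ℂ × ℂ => Φ ‖q.1‖ :=
  h.c1_left.continuousOn.comp_continuous (by fun_prop) fun q => norm_nonneg q.1

lemma continuous_right_norm : Continuous fun q : ℂ × ℂ => Ψ ‖q.2‖ :=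
  h.c1_right.continuousOn.comp_continuous (by fun_prop) fun q => norm_nonneg q.2

lemma continuous_bellman : Continuous (bellman Φ Ψ δ) := by
  have h1 : Continuous fun q : ℂ × ℂ => ‖q.1‖ := by fun_prop
  have h2 : Continuous fun q : ℂ × ℂ => ‖q.2‖ := by fun_prop
  have h3 : Continuous fun q : ℂ × ℂ => intLeft Φ ‖q.1‖ :=
    h.continuousOn_intLeft.comp_continuous h1 fun q => norm_nonneg q.1
  have h4 : Continuous fun q : ℂ × ℂ => intRight Ψ ‖q.2‖ :=
    h.continuousOn_intRight.comp_continuous h2 fun q => norm_nonneg q.2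
  have h5 := h.continuous_left_norm
  have h6 := h.continuous_right_norm
  refine Continuous.if_le (((h5.add h6).const_mul _).add (((h1.pow 2).const_mul δ).mul h3))
    ((h5.add h6).add (((h1.pow 2).const_mul δ).mul h4)) h2 h.continuous_D1_norm_fst ?_
  intro q hq
  -- On the interface the formulas agree by the matching identity and `Ψ(Φ'(s)) = s Φ'(s) - Φ(s)`.
  rw [hq, ← intRight, h.intRight_D1 (norm_nonneg _), ← intLeft]
  rcases eq_or_ne q.1 0 with h0 | h0
  · simp [h0, h.D1_left_zero, h.young_left.zero, h.young_right.zero]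
  · have hpos := norm_pos_iff.2 h0
    rw [h.right_D1_left hpos]
    field_simp
    ring

lemma hasLineDerivAt_bellman {q : ℂ × ℂ} (hq : q ∈ regular) (hne : ‖q.2‖ ≠ D1 Φ ‖q.1‖)
    (i : Fin 4) : HasLineDerivAt ℝ (bellman Φ Ψ δ) (bellmanGrad Φ Ψ δ i q) q (dir i) := by
  have h1 := norm_pos_iff.2 hq.1
  have h2 := norm_pos_iff.2 hq.2
  have := hasLineDerivAt_radial (G := radialBellman Φ Ψ δ) hq.1 hq.2
    (h.hasDerivAt_radialBellman_left h1 hne) (h.hasDerivAt_radialBellman_right h1 h2 hne) i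
  have e : bellmanGrad Φ Ψ δ i q = ![coefU Φ Ψ δ ‖q.1‖ ‖q.2‖, coefU Φ Ψ δ ‖q.1‖ ‖q.2‖,
      coefV Ψ δ ‖q.1‖ ‖q.2‖, coefV Ψ δ ‖q.1‖ ‖q.2‖] i * coord i q := by
    match i with
    | 0 | 1 | 2 | 3 => rfl
  rw [e]
  exact this

lemma hasLineDerivAt_bellmanGrad {q : ℂ × ℂ} (hq : q ∈ regular) (hne : ‖q.2‖ ≠ D1 Φ ‖q.1‖)
    (i j : Fin 4) :
    HasLineDerivAt ℝ (bellmanGrad Φ Ψ δ j) (bellmanHess Φ Ψ δ q i j) q (dir i) := by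
  have h1 := norm_pos_iff.2 hq.1
  have h2 := norm_pos_iff.2 hq.2
  have hU := hasLineDerivAt_radial (G := coefU Φ Ψ δ) hq.1 hq.2
    (h.hasDerivAt_coefU_left h1 hne) (h.hasDerivAt_coefU_right h2 hne) i
  have hV := hasLineDerivAt_radial (G := coefV Ψ δ) hq.1 hq.2
    (h.hasDerivAt_coefV_left h1 h2 hne) (h.hasDerivAt_coefV_right h1 h2 hne) i
  have hc := hasLineDerivAt_coord i j q
  rw [HasLineDerivAt] at hU hV hc ⊢
  rw [bellmanHess, radialHess_eq]
  simp only [bellmanGrad]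
  by_cases hj : j < 2
  · simp only [if_pos hj]
    have := hU.mul hc
    simp only [zero_smul, add_zero] at this
    exact this
  · simp only [if_neg hj]
    have := hV.mul hc
    simp only [zero_smul, add_zero] at this
    exact this

/-- The growth bounds replace `Φ''` and `Ψ''` by first-order quotients, and `s < Ψ'(t)` controls the
outer `δ`-terms. -/
lemma abs_bellmanHess_le (hδ : 0 ≤ δ) {q : ℂ × ℂ} (hq : q ∈ regular) (i j : Fin 4) :
    |bellmanHess Φ Ψ δ q i j| ≤ hessBound Φ Ψ δ q := by
  refine (abs_radialHess_le _ _ _ _ _ _ _ i j).trans ?_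
  have hs := norm_pos_iff.2 hq.1
  have ht := norm_pos_iff.2 hq.2
  rw [hessBound]
  generalize ‖q.1‖ = s at *
  generalize ‖q.2‖ = t at *
  have hg := h.D1_right_pos ht
  have hM := h.one_lt_tildeBigM
  have k1 := h.div_le_D2_left hs
  have k2 := h.D2_left_le_div hs
  have k3 := h.D2_right_le_div ht
  have k5 := h.pos_left s hs
  have k6 := h.pos_right t ht
  have k7 := h.D1_div_nonneg hs.le
  have b1 : |coefU Φ Ψ δ s t| = D1 Φ s / s + 2 * δ * intRight Ψ (max t (D1 Φ s)) := by
    rw [abs_of_nonneg (h.coefU_nonneg hδ hs.le ht.le), coefU]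
  have b2 : |coefUU Φ δ s t| * s ^ 2 ≤ (tildeBigM Φ + 2 * δ * tildeBigM Φ) * (D1 Φ s / s) := by
    rw [coefUU, abs_div, abs_of_pos (by positivity : 0 < s ^ 2), div_mul_cancel₀ _ (by positivity),
      ← D2_eq_deriv hs]
    have q1 : δ * D2 Φ s ≤ δ * (tildeBigM Φ * (D1 Φ s / s)) := by gcongr
    have q2 : 0 ≤ δ * D2 Φ s := by positivity
    split_ifs <;> rw [abs_of_nonneg (by linarith)] <;> linarith
  have b3 : |coefUV Φ Ψ δ s t| * (s * t) ≤ 2 * δ := by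
    rw [coefUV]
    split_ifs with hst
    · rw [abs_zero, zero_mul]
      positivity
    · have hsg := (h.lt_D1_left_iff hs.le ht.le).1 (not_le.1 hst)
      rw [abs_of_nonneg (by positivity)]
      calc 2 * δ / (t * D1 Ψ t) * (s * t) = 2 * δ * (s / D1 Ψ t) := by field_simp
        _ ≤ 2 * δ * 1 := by
          gcongr
          exact (div_le_one hg).2 hsg.le
        _ = 2 * δ := mul_one _
  have b4 : |coefV Ψ δ s t| ≤ (1 + δ) * (D1 Ψ t / t) := by
    rw [abs_of_nonneg (h.coefV_nonneg hδ ht.le), ← mul_div_assoc, le_div_iff₀ ht, mul_comm]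
    exact h.mul_coefV_le hδ hs.le ht.le
  have b5 : |coefVV Φ Ψ δ s t| * t ^ 2 ≤ (1 + 2 * δ) * (D1 Ψ t / t) := by
    have k8 : 0 ≤ D1 Ψ t / t := by positivity
    rw [coefVV, abs_div, abs_of_pos (by positivity : 0 < t ^ 2), div_mul_cancel₀ _ (by positivity),
      ← D2_eq_deriv ht]
    have q1 : 0 ≤ δ * D2 Ψ t := by positivity
    have q2 : 0 ≤ δ * (D1 Ψ t / t) := by positivity
    have q3 : δ * D2 Ψ t ≤ δ * (D1 Ψ t / t) := by gcongr
    split_ifs with hst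
    · rw [abs_of_nonpos (by linarith)]
      linarith
    · have hsg := (h.lt_D1_left_iff hs.le ht.le).1 (not_le.1 hst)
      have q4 : 0 ≤ δ * s ^ 2 * (D2 Ψ t / D1 Ψ t ^ 2 + 1 / (t * D1 Ψ t)) := by positivity
      have q5 : δ * s ^ 2 * (D2 Ψ t / D1 Ψ t ^ 2 + 1 / (t * D1 Ψ t)) ≤
          2 * (δ * (D1 Ψ t / t)) := by
        calc δ * s ^ 2 * (D2 Ψ t / D1 Ψ t ^ 2 + 1 / (t * D1 Ψ t))
            ≤ δ * D1 Ψ t ^ 2 * ((D1 Ψ t / t) / D1 Ψ t ^ 2 + 1 / (t * D1 Ψ t)) := by gcongr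
          _ = 2 * (δ * (D1 Ψ t / t)) := by
            field_simp
            ring
      rw [abs_of_nonpos (by linarith)]
      linarith
  rw [b1]
  rw [← div_eq_mul_inv]
  linarith

lemma continuousOn_hessBound : ContinuousOn (hessBound Φ Ψ δ) regular := by
  have h3 : Continuous fun q : ℂ × ℂ => ‖q.2‖ := by fun_prop
  exact (((h.continuous_D1_div_norm_fst.const_mul _).add
    (h.continuous_intRight_max.const_mul _)).add continuous_const).continuousOn.add
    ((h.continuous_D1_norm_snd.continuousOn.mul
      (h3.continuousOn.inv₀ fun q hq => norm_ne_zero_iff.2 hq.2)).const_mul _)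

omit h in
lemma ae_mem_regular : ∀ᵐ q : ℂ × ℂ, q ∈ regular := by
  filter_upwards [ae_coord_ne_zero] with q hq
  simpa using line_mem_regular hq 0 0

lemma locallyIntegrable_hessBound : LocallyIntegrable (hessBound Φ Ψ δ) := by
  have h1 : LocallyIntegrable fun q : ℂ × ℂ => (D1 Ψ ‖q.2‖ * ‖q.2‖⁻¹) := by
    rw [locallyIntegrable_iff]
    intro K hK
    exact ((locallyIntegrable_iff.1 locallyIntegrable_inv_norm_snd) K hK).continuousOn_mul
      h.continuous_D1_norm_snd.continuousOn hK
  have h2 := (((h.continuous_D1_div_norm_fst.const_mul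
    (1 + tildeBigM Φ + 2 * δ * tildeBigM Φ)).add
    (h.continuous_intRight_max.const_mul (2 * δ))).add
      (continuous_const (y := 2 * δ))).locallyIntegrable (μ := volume)
  exact h2.add (h1.smul (2 + 3 * δ))

lemma locallyIntegrable_bellmanHess (hδ : 0 ≤ δ) (i j : Fin 4) :
    LocallyIntegrable fun q => bellmanHess Φ Ψ δ q i j := by
  refine (h.locallyIntegrable_hessBound (δ := δ)).mono (h.measurable_bellmanHess i j).aestronglyMeasurable ?_
  filter_upwards [ae_mem_regular] with q hq
  exact (h.abs_bellmanHess_le hδ hq i j).trans (le_abs_self _)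

omit h in
lemma abs_coord_le (q : ℂ × ℂ) (i : Fin 4) : |coord i q| ≤ if i < 2 then ‖q.1‖ else ‖q.2‖ := by
  match i with
  | 0 => exact Complex.abs_re_le_norm q.1
  | 1 => exact Complex.abs_im_le_norm q.1
  | 2 => exact Complex.abs_re_le_norm q.2
  | 3 => exact Complex.abs_im_le_norm q.2

lemma abs_bellmanGrad_le (hδ : 0 ≤ δ) (hδm : 8 * (δ * tildeSmallM Φ) ≤ tildeSmallM Φ - 1)
    (q : ℂ × ℂ) (i : Fin 4) :
    |bellmanGrad Φ Ψ δ i q| ≤ 2 * max (D1 Φ ‖q.1‖) ‖q.2‖ + (1 + δ) * D1 Ψ ‖q.2‖ := by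
  have h1 := h.mul_coefU_le hδ hδm (norm_nonneg q.1) (norm_nonneg q.2)
  have h2 := h.mul_coefV_le hδ (norm_nonneg q.1) (norm_nonneg q.2)
  have h3 := abs_coord_le q i
  have h4 := h.coefU_nonneg hδ (norm_nonneg q.1) (norm_nonneg q.2)
  have h5 := h.coefV_nonneg (s := ‖q.1‖) hδ (norm_nonneg q.2)
  have h6 : 0 ≤ (1 + δ) * D1 Ψ ‖q.2‖ :=
    mul_nonneg (by linarith) (h.D1_right_nonneg (norm_nonneg _))
  have h7 : 0 ≤ max (D1 Φ ‖q.1‖) ‖q.2‖ := (norm_nonneg _).trans (le_max_right _ _)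
  rw [bellmanGrad, abs_mul]
  split_ifs at h3 ⊢
  · rw [abs_of_nonneg h4, mul_comm]
    have := mul_le_mul_of_nonneg_right h3 h4
    linarith
  · rw [abs_of_nonneg h5, mul_comm]
    have := mul_le_mul_of_nonneg_right h3 h5
    linarith

lemma continuous_gradBound : Continuous fun q : ℂ × ℂ =>
    2 * max (D1 Φ ‖q.1‖) ‖q.2‖ + (1 + δ) * D1 Ψ ‖q.2‖ :=
  ((h.continuous_D1_norm_fst.max (continuous_norm.comp continuous_snd)).const_mul _).add
    (h.continuous_D1_norm_snd.const_mul _)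

lemma locallyIntegrable_bellmanGrad (hδ : 0 ≤ δ)
    (hδm : 8 * (δ * tildeSmallM Φ) ≤ tildeSmallM Φ - 1) (i : Fin 4) :
    LocallyIntegrable (bellmanGrad Φ Ψ δ i) := by
  refine (h.continuous_gradBound (δ := δ)).locallyIntegrable.mono
    (h.measurable_bellmanGrad i).aestronglyMeasurable (Eventually.of_forall fun q => ?_)
  exact (h.abs_bellmanGrad_le hδ hδm q i).trans (le_abs_self _)

lemma hasIntegralLineDeriv_bellman (hδ : 0 ≤ δ)
    (hδm : 8 * (δ * tildeSmallM Φ) ≤ tildeSmallM Φ - 1) (i : Fin 4) :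
    HasIntegralLineDeriv (bellman Φ Ψ δ) (bellmanGrad Φ Ψ δ i) (dir i) :=
  h.hasIntegralLineDeriv_of_regular i h.continuous_bellman.continuousOn
    (h.measurable_bellmanGrad i) (h.continuous_gradBound (δ := δ)).continuousOn
    (fun q _ => h.abs_bellmanGrad_le hδ hδm q i)
    fun _ hq hne => h.hasLineDerivAt_bellman hq hne i

lemma hasIntegralLineDeriv_bellmanGrad (hδ : 0 ≤ δ) (i j : Fin 4) :
    HasIntegralLineDeriv (bellmanGrad Φ Ψ δ j) (fun q => bellmanHess Φ Ψ δ q i j) (dir i) :=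
  h.hasIntegralLineDeriv_of_regular i (h.continuousOn_bellmanGrad j)
    (h.measurable_bellmanHess i j) h.continuousOn_hessBound
    (fun _ hq => h.abs_bellmanHess_le hδ hq i j)
    fun _ hq hne => h.hasLineDerivAt_bellmanGrad hq hne i j

end YoungPair

end Gradient

/-! ### Arithmetic of the constants. -/

section Parameters

lemma bound_constants {m M ΛA lamA ΔA ΛB lamB ΔB μ : ℝ} (hm : 1 < m) (hmM : m ≤ M)
    (hΔA : 0 < ΔA) (hΔB : 0 < ΔB) (hlamA : 0 < lamA) (hlamB : 0 < lamB)
    (hA1 : lamA ≤ ΛA) (hA2 : ΔA ≤ ΛA) (hB2 : ΔB ≤ ΛB)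
    (hμ : μ = min (ΔA / (8 * ΛA)) (min (ΔB / (4 * ΛB))
      (lamA * ΔB / (100 * max (ΛA ^ 2) (ΛB ^ 2))))) :
    0 < μ ∧ 8 * μ ≤ 1 ∧ 4 * μ * ΛB ≤ ΔB ∧ 100 * μ * (max ΛA ΛB) ^ 2 ≤ lamA * ΔB ∧
      (min ΔA ΔB * min lamA lamB / max ΛA ΛB) ^ 2 ≤ 100 * (μ * (lamA * ΔB)) ∧
      min ΔA ΔB * min lamA lamB / max ΛA ΛB ≤ min ΔA ΔB ∧
      M / m * ((m - 1) / (M - 1)) ≤ 1 := by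
  have hΛA : 0 < ΛA := hΔA.trans_le hA2
  have hΛB : 0 < ΛB := hΔB.trans_le hB2
  have hmax : max (ΛA ^ 2) (ΛB ^ 2) = (max ΛA ΛB) ^ 2 := by
    rcases le_total ΛA ΛB with hle | hle
    · rw [max_eq_right hle, max_eq_right (by gcongr)]
    · rw [max_eq_left hle, max_eq_left (by gcongr)]
  rw [hmax] at hμ
  have hAΛ := le_max_left ΛA ΛB
  have hBΛ := le_max_right ΛA ΛB
  have d1 := min_le_left ΔA ΔB
  have d2 := min_le_right ΔA ΔB
  have l1 := min_le_left lamA lamB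
  have hd0 : 0 < min ΔA ΔB := lt_min hΔA hΔB
  have hl0 : 0 < min lamA lamB := lt_min hlamA hlamB
  set Λ := max ΛA ΛB
  set D := min ΔA ΔB
  set l := min lamA lamB
  have hΛ : 0 < Λ := hΛA.trans_le hAΛ
  have hlΛ : l ≤ Λ := l1.trans (hA1.trans hAΛ)
  have m1 : μ ≤ ΔA / (8 * ΛA) := hμ ▸ min_le_left _ _
  have m2 : μ ≤ ΔB / (4 * ΛB) := hμ ▸ (min_le_right _ _).trans (min_le_left _ _)
  have m3 : μ ≤ lamA * ΔB / (100 * Λ ^ 2) := hμ ▸ (min_le_right _ _).trans (min_le_right _ _)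
  have hμ0 : 0 < μ := by rw [hμ]; positivity
  rw [le_div_iff₀ (by positivity)] at m1 m2 m3
  -- Since `l ≤ Λ`, this single quantity lies below all three terms of the minimum. It yields the
  -- lower bound on `μ` behind the final constant.
  have key : D * l / (100 * Λ ^ 2) ≤ μ := by
    have e : D / (100 * Λ) = D * Λ / (100 * Λ ^ 2) := by field_simp
    have a1 : D * l / (100 * Λ ^ 2) ≤ D / (100 * Λ) := by
      rw [e]
      gcongr
    rw [hμ]
    refine le_min ?_ (le_min ?_ ?_)
    · exact a1.trans (by gcongr; linarith)
    · exact a1.trans (by gcongr; linarith)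
    · rw [mul_comm lamA]
      gcongr
  refine ⟨hμ0, ?_, by linarith, by linarith, ?_, ?_, ?_⟩
  · by_contra! hlt
    have : 1 * ΛA < 8 * μ * ΛA := by gcongr
    linarith
  · calc (D * l / Λ) ^ 2 = 100 * (D * l / (100 * Λ ^ 2) * (l * D)) := by
          field_simp
      _ ≤ 100 * (μ * (lamA * ΔB)) := by gcongr
  · rw [div_le_iff₀ hΛ]
    gcongr
  · have hm1 : 0 < M - 1 := by linarith
    rw [div_mul_div_comm, div_le_one (by positivity)]
    linarith

end Parameters

/-! ### Assembly: constants, the pointwise bound, and mollification. -/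

section Main

variable {Φ Ψ : ℝ → ℝ} {d : ℕ}

namespace YoungPair

variable (h : YoungPair Φ Ψ)
include h

lemma abs_one_sub_two_div : |1 - 2 / expP Φ| * (tildeBigM Φ + 1) = tildeBigM Φ - 1 := by
  have hM := h.one_lt_tildeBigM
  have e : 1 - 2 / expP Φ = (tildeBigM Φ - 1) / (tildeBigM Φ + 1) := by
    rw [expP]
    field_simp
    ring
  have : 0 < tildeBigM Φ - 1 := by linarith
  rw [e, abs_of_nonneg (by positivity), div_mul_cancel₀ _ (by linarith)]

lemma delta_bounds (hd : 0 < d) {A B : MatFun d} (hA : IsPElliptic (expP Φ) A)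
    (hB : IsPElliptic (expP Φ) B) :
    0 < delta Φ A B ∧ 8 * (delta Φ A B * tildeSmallM Φ) ≤ tildeSmallM Φ - 1 := by
  have hm := h.one_lt_tildeSmallM
  obtain ⟨μ, hμdef⟩ : ∃ μ, μ = min (Delta (expP Φ) A / (8 * bigLambda A))
      (min (Delta (expP Φ) B / (4 * bigLambda B)) (smallLambda A * Delta (expP Φ) B /
        (100 * max (bigLambda A ^ 2) (bigLambda B ^ 2)))) := ⟨_, rfl⟩
  obtain ⟨hμ, h8, -⟩ := bound_constants hm h.tildeSmallM_le_tildeBigM hA.pElliptic hB.pElliptic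
    hA.elliptic hB.elliptic (hA.smallLambda_le hd).1 (hA.smallLambda_le hd).2
    (hB.smallLambda_le hd).2 hμdef
  have hm1 : 0 < tildeSmallM Φ - 1 := by linarith
  rw [delta, ← hμdef]
  refine ⟨by positivity, ?_⟩
  have e : 8 * ((tildeSmallM Φ - 1) / tildeSmallM Φ * μ * tildeSmallM Φ) =
      (tildeSmallM Φ - 1) * (8 * μ) := by field_simp
  rw [e]
  exact mul_le_of_le_one_right hm1.le h8

lemma hessian_constant_bounds (hd : 0 < d) {A B : MatFun d} (hA : IsPElliptic (expP Φ) A)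
    (hB : IsPElliptic (expP Φ) B) {κ : ℝ}
    (hκ : κ = 1 / 10 * √(tildeBigM Φ / tildeSmallM Φ * ((tildeSmallM Φ - 1) /
      (tildeBigM Φ - 1))) * (ellipC (expP Φ) A B)⁻¹) :
    0 ≤ κ ∧ κ ≤ min (Delta (expP Φ) A) (Delta (expP Φ) B) ∧
      4 * delta Φ A B * bigLambda B ≤ Delta (expP Φ) B ∧
      100 * delta Φ A B * (max (bigLambda A) (bigLambda B)) ^ 2 ≤
        smallLambda A * Delta (expP Φ) B ∧
      κ ^ 2 ≤ delta Φ A B * (tildeBigM Φ / (tildeBigM Φ - 1)) * smallLambda A *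
        Delta (expP Φ) B := by
  have hm := h.one_lt_tildeSmallM
  have hM := h.one_lt_tildeBigM
  obtain ⟨μ, hμdef⟩ : ∃ μ, μ = min (Delta (expP Φ) A / (8 * bigLambda A))
      (min (Delta (expP Φ) B / (4 * bigLambda B)) (smallLambda A * Delta (expP Φ) B /
        (100 * max (bigLambda A ^ 2) (bigLambda B ^ 2)))) := ⟨_, rfl⟩
  obtain ⟨hμ, -, h4, h100, hsq, hle, hone⟩ := bound_constants hm h.tildeSmallM_le_tildeBigM
    hA.pElliptic hB.pElliptic hA.elliptic hB.elliptic (hA.smallLambda_le hd).1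
    (hA.smallLambda_le hd).2 (hB.smallLambda_le hd).2 hμdef
  have hΔA := hA.pElliptic
  have hΔB := hB.pElliptic
  have hlA := hA.elliptic
  have hlB := hB.elliptic
  have hΛB : 0 < bigLambda B := hΔB.trans_le (hB.smallLambda_le hd).2
  rw [delta, ← hμdef]
  rw [ellipC, inv_div] at hκ
  obtain ⟨E, hE⟩ : ∃ E, E = min (Delta (expP Φ) A) (Delta (expP Φ) B) *
      min (smallLambda A) (smallLambda B) / max (bigLambda A) (bigLambda B) := ⟨_, rfl⟩
  have hE0 : 0 ≤ E := by
    rw [hE]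
    exact div_nonneg (mul_nonneg (lt_min hΔA hΔB).le (lt_min hlA hlB).le)
      (hΛB.trans_le (le_max_right (bigLambda A) (bigLambda B))).le
  rw [← hE] at hκ hsq hle
  clear hE hμdef
  have hm1 : 0 < tildeSmallM Φ - 1 := by linarith
  have hM1 : 0 < tildeBigM Φ - 1 := by linarith
  obtain ⟨θ, hθ⟩ : ∃ θ, θ = tildeBigM Φ / tildeSmallM Φ *
    ((tildeSmallM Φ - 1) / (tildeBigM Φ - 1)) := ⟨_, rfl⟩
  have hθ0 : 0 ≤ θ := by rw [hθ]; positivity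
  rw [← hθ] at hκ hone
  have hsqrt : √θ ≤ 1 := Real.sqrt_le_one.2 hone
  have hδμ : (tildeSmallM Φ - 1) / tildeSmallM Φ * μ ≤ μ := by
    refine mul_le_of_le_one_left hμ.le ?_
    rw [div_le_one (by linarith)]
    linarith
  refine ⟨by rw [hκ]; positivity, ?_, le_trans (by gcongr) h4, le_trans (by gcongr) h100, ?_⟩
  · rw [hκ]
    refine (mul_le_of_le_one_left hE0 ?_).trans hle
    linarith
  -- The factor `(m̃ - 1)/m̃` of `θ` is the one in `δ`, and its factor `M̃/(M̃ - 1)` is the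
  -- comparison constant for `intRight`.
  · calc κ ^ 2 = 1 / 100 * θ * E ^ 2 := by
          rw [hκ, mul_pow, mul_pow, Real.sq_sqrt hθ0]
          norm_num
      _ ≤ 1 / 100 * θ * (100 * (μ * (smallLambda A * Delta (expP Φ) B))) := by gcongr
      _ = _ := by
          rw [hθ]
          field_simp

lemma bellmanHess_lower (hd : 0 < d) {A B : MatFun d} (hA : IsPElliptic (expP Φ) A)
    (hB : IsPElliptic (expP Φ) B) {A₀ B₀ : Matrix (Fin d) (Fin d) ℂ}
    (hA₀ : MatBounds A₀ |1 - 2 / expP Φ| (bigLambda A) (smallLambda A) (Delta (expP Φ) A))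
    (hB₀ : MatBounds B₀ |1 - 2 / expP Φ| (bigLambda B) (smallLambda B) (Delta (expP Φ) B))
    {q : ℂ × ℂ} (hq : q ∈ regular) (ζ η : Vec d) :
    1 / 10 * √(tildeBigM Φ / tildeSmallM Φ * ((tildeSmallM Φ - 1) / (tildeBigM Φ - 1))) *
      (ellipC (expP Φ) A B)⁻¹ * (‖ζ‖ * ‖η‖) ≤
      hessForm A₀ B₀ (bellmanHess Φ Ψ (delta Φ A B) q) ζ η := by
  obtain ⟨κ, hκ⟩ : ∃ κ, κ = 1 / 10 * √(tildeBigM Φ / tildeSmallM Φ * ((tildeSmallM Φ - 1) /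
      (tildeBigM Φ - 1))) * (ellipC (expP Φ) A B)⁻¹ := ⟨_, rfl⟩
  obtain ⟨hκ0, hκΔ, hd1, hd2, hκ2⟩ := h.hessian_constant_bounds hd hA hB hκ
  have hδ := (h.delta_bounds hd hA hB).1
  rw [← hκ]
  have hΔA := hA.pElliptic
  have hΔB := hB.pElliptic
  have hΛB : 0 < bigLambda B := hΔB.trans_le (hB.smallLambda_le hd).2
  generalize delta Φ A B = δ at *
  -- Polar form of `u` and `v`; the vectors are rotated by the inverse phases to reach the setting
  -- of `hessForm_radialHess`.
  have hunit : ∀ z : ℂ, z ≠ 0 → ‖z / (‖z‖ : ℂ)‖ = 1 ∧ z = (‖z‖ : ℂ) * (z / (‖z‖ : ℂ)) :=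
    fun z hz => by
      constructor
      · rw [norm_div, Complex.norm_real, norm_norm, div_self (norm_ne_zero_iff.2 hz)]
      · rw [mul_div_cancel₀ _ (by exact_mod_cast norm_ne_zero_iff.2 hz)]
  obtain ⟨he, hqe1⟩ := hunit _ hq.1
  obtain ⟨he', hqe2⟩ := hunit _ hq.2
  have hvec : ∀ (z : ℂ) (ξ : Vec d), ‖z‖ = 1 → z • (z⁻¹ • ξ) = ξ ∧ ‖z⁻¹ • ξ‖ = ‖ξ‖ :=
    fun z ξ hz => by
      have hz0 : z ≠ 0 := norm_ne_zero_iff.1 (by rw [hz]; exact one_ne_zero)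
      exact ⟨smul_inv_smul₀ hz0 ξ, by rw [norm_smul, norm_inv, hz, inv_one, one_mul]⟩
  obtain ⟨v1, v2⟩ := hvec _ ζ he
  obtain ⟨v3, v4⟩ := hvec _ η he'
  have hn1 := norm_pos_iff.2 hq.1
  have hn2 := norm_pos_iff.2 hq.2
  rw [bellmanHess]
  rw [← v2, ← v4]
  conv_rhs => rw [← v1, ← v3]
  generalize q.1 / (‖q.1‖ : ℂ) = e at *
  generalize q.2 / (‖q.2‖ : ℂ) = e' at *
  generalize ‖q.1‖ = s at *
  generalize ‖q.2‖ = t at *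
  rw [hqe1, hqe2]
  have hc := h.abs_one_sub_two_div
  rcases le_or_gt t (D1 Φ s) with hst | hst
  · refine h.hessForm_lower_inner hA₀ hB₀ hc hΔA hΔB hδ hκ0 ?_ ?_ hn1 hn2 hst he he' _ _
    · have := min_le_left (Delta (expP Φ) A) (Delta (expP Φ) B)
      linarith
    · have := min_le_right (Delta (expP Φ) A) (Delta (expP Φ) B)
      linarith
  · exact h.hessForm_lower_outer hA₀ hB₀ hc hΔA hΔB hA.elliptic hδ (le_max_left _ _)
      (le_max_right _ _) hd1 hd2 hΛB.le hκ2 hn1 hn2 hst he he' _ _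

variable {φ : ℂ × ℂ → ℝ} (hφ : IsMollifier φ) {δ ν : ℝ} (hν : 0 < ν) (hδ : 0 ≤ δ)
  (hδm : 8 * (δ * tildeSmallM Φ) ≤ tildeSmallM Φ - 1)
include hφ hν

omit hφ hν in
lemma locallyIntegrable_bellman : LocallyIntegrable (bellman Φ Ψ δ) :=
  (h.continuous_bellman).locallyIntegrable

lemma integrable_bellman_mul_dilate (q : ℂ × ℂ) :
    Integrable (fun r => bellman Φ Ψ δ (q - r) * dilate φ ν r) :=
  integrable_sub_mul h.locallyIntegrable_bellman hφ.continuous_dilate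
    (hφ.hasCompactSupport_dilate hν) q

lemma contDiff_mollify_bellman : ContDiff ℝ ∞ (mollify (bellman Φ Ψ δ) φ ν) :=
  contDiff_integral_sub_mul h.locallyIntegrable_bellman hφ.contDiff_dilate
    (hφ.hasCompactSupport_dilate hν)

omit h in
lemma norm_sub_le {r : ℂ × ℂ} (hr : dilate φ ν r ≠ 0) (u v : ℂ) :
    ‖((u, v) - r : ℂ × ℂ).1‖ ≤ ‖u‖ + ν ∧ ‖((u, v) - r : ℂ × ℂ).2‖ ≤ ‖v‖ + ν := by
  have := hφ.norm_le_of_dilate_ne_zero hν hr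
  exact ⟨(_root_.norm_sub_le _ _).trans (by linarith), (_root_.norm_sub_le _ _).trans (by linarith)⟩

include hδ hδm

lemma mollify_bellman_bounds (u v : ℂ) : 0 ≤ mollify (bellman Φ Ψ δ) φ ν (u, v) ∧
    mollify (bellman Φ Ψ δ) φ ν (u, v) ≤
      2 * max 1 (bigM Φ / tildeSmallM Φ) * (Φ (‖u‖ + ν) + Ψ (‖v‖ + ν)) := by
  constructor
  · exact integral_nonneg fun r => mul_nonneg
      (h.radialBellman_nonneg hδ (norm_nonneg _) (norm_nonneg _)) (hφ.dilate_nonneg r)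
  · have := norm_integral_smul_le_of_forall (k := dilate φ ν)
      (f := fun r => bellman Φ Ψ δ ((u, v) - r))
      (C := 2 * max 1 (bigM Φ / tildeSmallM Φ) * (Φ (‖u‖ + ν) + Ψ (‖v‖ + ν)))
      hφ.continuous_dilate (hφ.hasCompactSupport_dilate hν) hφ.dilate_nonneg
      (hφ.integral_dilate hν) fun r hr => ?_
    · refine (le_abs_self _).trans (le_trans (le_of_eq ?_) this)
      simp only [mollify, smul_eq_mul, mul_comm, Real.norm_eq_abs]
    · obtain ⟨h1, h2⟩ := norm_sub_le hφ hν hr u v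
      rw [bellman_eq, Real.norm_of_nonneg (h.radialBellman_nonneg hδ (norm_nonneg _) (norm_nonneg _))]
      refine (h.radialBellman_le hδ hδm (norm_nonneg _) (norm_nonneg _)).trans ?_
      have h3 := h.left_mono (norm_nonneg _) h1
      have h4 := h.right_mono (norm_nonneg _) h2
      have h5 := le_max_left 1 (bigM Φ / tildeSmallM Φ)
      gcongr

lemma partialD_mollify_bellman (i : Fin 4) : partialD i (mollify (bellman Φ Ψ δ) φ ν) =
    fun q => ∫ r, bellmanGrad Φ Ψ δ i (q - r) * dilate φ ν r := by
  ext q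
  exact (h.hasIntegralLineDeriv_bellman hδ hδm i).lineDeriv_integral_sub_mul
    h.locallyIntegrable_bellman (h.locallyIntegrable_bellmanGrad hδ hδm i)
    (h.measurable_bellmanGrad i) hφ.continuous_dilate hφ.dilate_nonneg
    (hφ.hasCompactSupport_dilate hν) q

/-- Differentiation passes under the convolution twice. No singular part arises on the interface or
the axes, because the gradient is also an integral of its derivative along almost every line. -/
lemma hess_mollify_bellman (q : ℂ × ℂ) (i j : Fin 4) : hess (mollify (bellman Φ Ψ δ) φ ν) q i j =
    ∫ r, bellmanHess Φ Ψ δ (q - r) i j * dilate φ ν r := by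
  simp only [hess, Matrix.of_apply]
  rw [h.partialD_mollify_bellman hφ hν hδ hδm]
  exact (h.hasIntegralLineDeriv_bellmanGrad hδ i j).lineDeriv_integral_sub_mul
    (h.locallyIntegrable_bellmanGrad hδ hδm j) (h.locallyIntegrable_bellmanHess hδ i j)
    (h.measurable_bellmanHess i j) hφ.continuous_dilate hφ.dilate_nonneg
    (hφ.hasCompactSupport_dilate hν) q

lemma complex_integral_grad (i j : Fin 4) (q : ℂ × ℂ) :
    ((partialD i (mollify (bellman Φ Ψ δ) φ ν) q : ℂ) +
      Complex.I * (partialD j (mollify (bellman Φ Ψ δ) φ ν) q : ℂ)) / 2 =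
    ∫ r, dilate φ ν r • (((bellmanGrad Φ Ψ δ i (q - r) : ℂ) +
      Complex.I * (bellmanGrad Φ Ψ δ j (q - r) : ℂ)) / 2) := by
  have hi : ∀ i, Integrable fun r => ((bellmanGrad Φ Ψ δ i (q - r) * dilate φ ν r : ℝ) : ℂ) :=
    fun i => (integrable_sub_mul (h.locallyIntegrable_bellmanGrad hδ hδm i) hφ.continuous_dilate
      (hφ.hasCompactSupport_dilate hν) q).ofReal
  rw [h.partialD_mollify_bellman hφ hν hδ hδm, h.partialD_mollify_bellman hφ hν hδ hδm]
  simp only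
  rw [← integral_complex_ofReal, ← integral_complex_ofReal, ← integral_const_mul,
    ← integral_add (hi i) ((hi j).const_mul _), ← integral_div]
  congr 1
  ext r
  rw [Complex.real_smul]
  push_cast
  ring

lemma norm_dbarU_le (u v : ℂ) : ‖dbarU (mollify (bellman Φ Ψ δ) φ ν) (u, v)‖ ≤
    max (D1 Φ (‖u‖ + ν)) (‖v‖ + ν) := by
  rw [dbarU, h.complex_integral_grad hφ hν hδ hδm]
  refine norm_integral_smul_le_of_forall hφ.continuous_dilate (hφ.hasCompactSupport_dilate hν)
    hφ.dilate_nonneg (hφ.integral_dilate hν) fun r hr => ?_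
  obtain ⟨h1, h2⟩ := norm_sub_le hφ hν hr u v
  set p := ((u, v) : ℂ × ℂ) - r
  -- The factor `1/2` in `∂_ū` compensates the factor `2` in `mul_coefU_le`.
  have e : ((bellmanGrad Φ Ψ δ 0 p : ℂ) + Complex.I * (bellmanGrad Φ Ψ δ 1 p : ℂ)) / 2 =
      ((coefU Φ Ψ δ ‖p.1‖ ‖p.2‖ / 2 : ℝ) : ℂ) * p.1 := by
    apply Complex.ext <;> simp [bellmanGrad, coord] <;> ring
  have h3 := h.coefU_nonneg hδ (norm_nonneg p.1) (norm_nonneg p.2)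
  have h4 := h.mul_coefU_le hδ hδm (norm_nonneg p.1) (norm_nonneg p.2)
  rw [e, norm_mul, Complex.norm_real, Real.norm_of_nonneg (by positivity)]
  have h5 : max (D1 Φ ‖p.1‖) ‖p.2‖ ≤ max (D1 Φ (‖u‖ + ν)) (‖v‖ + ν) :=
    max_le_max (h.strictMonoOn_D1_left.monotoneOn (norm_nonneg _)
      ((norm_nonneg _).trans h1) h1) h2
  linarith

lemma norm_dbarV_le (u v : ℂ) : ‖dbarV (mollify (bellman Φ Ψ δ) φ ν) (u, v)‖ ≤
    D1 Ψ (‖v‖ + ν) := by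
  rw [dbarV, h.complex_integral_grad hφ hν hδ hδm]
  refine norm_integral_smul_le_of_forall hφ.continuous_dilate (hφ.hasCompactSupport_dilate hν)
    hφ.dilate_nonneg (hφ.integral_dilate hν) fun r hr => ?_
  obtain ⟨h1, h2⟩ := norm_sub_le hφ hν hr u v
  set p := ((u, v) : ℂ × ℂ) - r
  have e : ((bellmanGrad Φ Ψ δ 2 p : ℂ) + Complex.I * (bellmanGrad Φ Ψ δ 3 p : ℂ)) / 2 =
      ((coefV Ψ δ ‖p.1‖ ‖p.2‖ / 2 : ℝ) : ℂ) * p.2 := by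
    apply Complex.ext <;> simp [bellmanGrad, coord] <;> ring
  have h3 := h.coefV_nonneg (s := ‖p.1‖) hδ (norm_nonneg p.2)
  have h4 := h.mul_coefV_le hδ (norm_nonneg p.1) (norm_nonneg p.2)
  rw [e, norm_mul, Complex.norm_real, Real.norm_of_nonneg (by positivity)]
  have h5 : D1 Ψ ‖p.2‖ ≤ D1 Ψ (‖v‖ + ν) :=
    h.strictMonoOn_D1_right.monotoneOn (norm_nonneg _) ((norm_nonneg _).trans h2) h2
  have h6 := h.delta_le hδm
  have h7 := h.D1_right_nonneg (norm_nonneg p.2)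
  nlinarith

/-- The generalized Hessian is linear in the Hessian matrix, so it too is averaged, and a lower
bound off a null set survives. -/
lemma le_genHess_mollify {A₀ B₀ : Matrix (Fin d) (Fin d) ℂ} {ζ η : Vec d} {C : ℝ}
    (hC : ∀ p ∈ regular, C ≤ hessForm A₀ B₀ (bellmanHess Φ Ψ δ p) ζ η) (q : ℂ × ℂ) :
    C ≤ genHess A₀ B₀ (mollify (bellman Φ Ψ δ) φ ν) q ζ η := by
  have hint : ∀ i j, Integrable fun r => bellmanHess Φ Ψ δ (q - r) i j * dilate φ ν r :=
    fun i j => integrable_sub_mul (h.locallyIntegrable_bellmanHess hδ i j) hφ.continuous_dilate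
      (hφ.hasCompactSupport_dilate hν) q
  have hk : Integrable (dilate φ ν) :=
    hφ.continuous_dilate.integrable_of_hasCompactSupport (hφ.hasCompactSupport_dilate hν)
  have e : genHess A₀ B₀ (mollify (bellman Φ Ψ δ) φ ν) q ζ η =
      ∫ r, hessForm A₀ B₀ (bellmanHess Φ Ψ δ (q - r)) ζ η * dilate φ ν r := by
    change hessForm A₀ B₀ (hess _ q) ζ η = _
    simp only [hessForm_eq_sum, h.hess_mollify_bellman hφ hν hδ hδm, Finset.sum_mul,
      mul_right_comm]
    rw [integral_finsetSum _ fun i _ => integrable_finsetSum _ fun j _ =>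
      (hint i j).mul_const _]
    refine Finset.sum_congr rfl fun i _ => ?_
    rw [integral_finsetSum _ fun j _ => (hint i j).mul_const _]
    exact Finset.sum_congr rfl fun j _ => (integral_mul_const _ _).symm
  have hi : Integrable fun r => hessForm A₀ B₀ (bellmanHess Φ Ψ δ (q - r)) ζ η * dilate φ ν r := by
    simp only [hessForm_eq_sum, Finset.sum_mul, mul_right_comm]
    exact integrable_finsetSum _ fun i _ => integrable_finsetSum _ fun j _ =>
      (hint i j).mul_const _
  have hae := (Measure.measurePreserving_sub_left (volume : Measure (ℂ × ℂ))
    q).quasiMeasurePreserving.ae ae_mem_regular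
  calc C = ∫ r, C * dilate φ ν r := by rw [integral_const_mul, hφ.integral_dilate hν, mul_one]
    _ ≤ ∫ r, hessForm A₀ B₀ (bellmanHess Φ Ψ δ (q - r)) ζ η * dilate φ ν r := by
        refine integral_mono_ae (hk.const_mul C) hi ?_
        filter_upwards [hae] with r hr
        exact mul_le_mul_of_nonneg_right (hC _ hr) (hφ.dilate_nonneg r)
    _ = _ := e.symm

end YoungPair

end Main

end

end OrliczBellman

theorem proposition5p1 (d : ℕ) (hd : 0 < d) (Φ Ψ : ℝ → ℝ) (hΦΨ : YoungPair Φ Ψ)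
    (A B : MatFun d) (hA : IsPElliptic (expP Φ) A) (hB : IsPElliptic (expP Φ) B)
    (φ : ℂ × ℂ → ℝ) (hφ : IsMollifier φ)
    (X : ℂ × ℂ → ℝ) (hX : X = bellman Φ Ψ (delta Φ A B))
    (Xν : ℝ → ℂ × ℂ → ℝ) (hXν : Xν = mollify X φ) :
    -- the integrals in the definitions of `X` and `Xν` converge
    (∀ t, 0 < t → IntervalIntegrable (fun s => D1 Φ s / s ^ 2) volume 0 t ∧
      IntervalIntegrable (fun s => 1 / D1 Ψ s) volume 0 t) ∧
    (∀ ν ∈ Set.Ioc (0 : ℝ) 1, ∀ q : ℂ × ℂ, Integrable (fun r => X (q - r) * dilate φ ν r)) ∧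
    (∀ ν ∈ Set.Ioc (0 : ℝ) 1, ContDiff ℝ ∞ (Xν ν)) ∧
    (∀ ν ∈ Set.Ioc (0 : ℝ) 1, ∀ u v : ℂ,
      0 ≤ Xν ν (u, v) ∧
      Xν ν (u, v) ≤ 2 * max 1 (bigM Φ / tildeSmallM Φ) * (Φ (‖u‖ + ν) + Ψ (‖v‖ + ν))) ∧
    (∀ ν ∈ Set.Ioc (0 : ℝ) 1, ∀ u v : ℂ,
      ‖dbarU (Xν ν) (u, v)‖ ≤ max (D1 Φ (‖u‖ + ν)) (‖v‖ + ν) ∧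
      ‖dbarV (Xν ν) (u, v)‖ ≤ D1 Ψ (‖v‖ + ν)) ∧
    (∀ᵐ x : EuclideanSpace ℝ (Fin d), ∀ ν ∈ Set.Ioc (0 : ℝ) 1, ∀ u v : ℂ,
      ∀ ζ η : EuclideanSpace ℂ (Fin d),
        1 / 10 * √(tildeBigM Φ / tildeSmallM Φ * ((tildeSmallM Φ - 1) / (tildeBigM Φ - 1))) *
            (ellipC (expP Φ) A B)⁻¹ * ‖ζ‖ * ‖η‖ ≤
          genHess (A x) (B x) (Xν ν) (u, v) ζ η) := by
  subst hX hXν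
  obtain ⟨hδ, hδm⟩ := hΦΨ.delta_bounds hd hA hB
  refine ⟨fun t ht => ⟨hΦΨ.intervalIntegrable_left ht.le, hΦΨ.intervalIntegrable_right ht.le⟩,
    fun ν hν q => hΦΨ.integrable_bellman_mul_dilate hφ hν.1 q,
    fun ν hν => hΦΨ.contDiff_mollify_bellman hφ hν.1,
    fun ν hν u v => hΦΨ.mollify_bellman_bounds hφ hν.1 hδ.le hδm u v,
    fun ν hν u v => ⟨hΦΨ.norm_dbarU_le hφ hν.1 hδ.le hδm u v,
      hΦΨ.norm_dbarV_le hφ hν.1 hδ.le hδm u v⟩, ?_⟩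
  filter_upwards [hA.ae_matBounds hd, hB.ae_matBounds hd] with x hAx hBx ν hν u v ζ η
  rw [mul_assoc _ ‖ζ‖]
  exact hΦΨ.le_genHess_mollify hφ hν.1 hδ.le hδm
    (fun p hp => hΦΨ.bellmanHess_lower hd hA hB hAx hBx hp ζ η) (u, v)
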